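/- **Setting.** Identify $\mathbb T^1$ with $[0,1)$; "open interval" means a nonempty open interval $(l,r)\subset(0,1)$, and $|A|$ is Lebesgue measure. Let $f:[0,1)\to[0,1)$ and $\tau:[0,1)\to\mathbb R$ be the data of the skew product $F(x,y)=(f(x),y+\tau(x))$, let $\alpha\in(0,1)$, $\lambda>\ln 2$, $D\ge 0$, $C_\tau\in\mathbb R$, and let $\{O_i\}$ be a countable family of pairwise disjoint open intervals covering $[0,1)$ up to a countable set (the joint partition of $f$ and $\tau$). Let $\mathcal H^n$ be the set of inverse branches $h:f^n(O_h)\to O_h$ of $f^n$, where the $O_h$ are the nonempty sets $\{x\in(0,1): f^k(x)\in O_{i_k},\,0\le k<n\}$; put $\tau_n=\sum_{j<n}\tau\circ f^j$. Assume: 1. on each $O_i$, $f$ is $C^1$ with $\alpha$-Hölder derivative (so $f$ is $C^{1+\alpha}$ up to the endpoints) and $\tau$ is $C^1$; 2. $|(f^n)'|\ge e^{\lambda n}$ on $O_h$ for all $n$ and $h\in\mathcal H^n$; 3. $|h'(x)|/|h'(y)|\le e^{D|x-y|^\alpha}$ for all $n$, $h\in\mathcal H^n$, $x,y\in f^n(O_h)$;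 4. $\sum_{h\in\mathcal H^n}\sup_{f^n(O_h)}|h'|<\infty$ for all $n$; 5. (covering) for every $n$ there is $N$ such that for all $h\in\mathcal H^n$ the set $f^N(O_h)$ contains all but countably many points of $[0,1)$ (this holds in particular if $f^N(\overline{O_h})=\mathbb T^1$); 6. there is no Lipschitz function $\phi:[0,1)\to\mathbb R$ (not required to be periodic) such that $\tau-\phi\circ f+\phi$ is constant on each $O_i$; 7. $|(\tau_n\circ h)'|\le C_\tau$ on $f^n(O_h)$ for all $n$ and $h\in\mathcal H^n$. **Standard families.** For $a,b,\varepsilon_0$, a *standard pair* $(I,\rho)$ is an open interval $I$ with $|I|<\varepsilon_0\le 1$ and a nowhere vanishing $\rho\in L^1(I,\mathbb C)$ with $\int_I|\rho|=1$, $\bigl|\ln|\rho(x)|-\ln|\rho(y)|\bigr|\le a|x-y|^\alpha$ for $x,y\in I$, and $\rho=|\rho|e^{i\theta}$ on $I$ for a differentiable $\theta$ with $|\theta'|\le a|b|$. The class $\mathcal M_{a,b,B,\varepsilon_0}$ consists of the countable families $\mathcal G=\{(I_j,\rho_j)\}_{j\in\mathcal J}$ of standard pairs with weights $w_{\mathcal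 G}(j)\ge0$ such that $B>0$ and $\sum_j w_{\mathcal G}(j)\int_{\partial_\varepsilon I_j}|\rho_j|\le B\varepsilon$ for $0<\varepsilon<\varepsilon_0$, where $\partial_\varepsilon I_j$ is the set of points of $I_j$ at distance less than $\varepsilon$ from $\partial I_j$. Put $|\mathcal G|=\sum_j w_{\mathcal G}(j)$; $\mathcal G$ is a *standard probability family* if $|\mathcal G|=1$. Two families are *equivalent* if their densities $\rho_{\mathcal G}=\sum_j w_{\mathcal G}(j)\rho_j$ (each $\rho_j$ extended by $0$) agree almost everywhere. An *$n$-th iterate* $\mathcal G_n$ of $\mathcal G$ arises as follows. Each nonempty interval $f^n(I_j\cap O_h)$, $h\in\mathcal H^n$, is kept as one piece $U$ if it is shorter than $\varepsilon_0$, and otherwise is cut, up to finitely many points, into finitely many disjoint open intervals $U$ with $\varepsilon_0/3\le|U|<\varepsilon_0$. To each piece belong the interval $U$, the density $z^{-1}e^{ib\tau_n\circ h}\,(\rho_j\circ h)\,|h'|$ with $z=\int_U|\rho_j|\circ h\,|h'|$, and the weight $z\,w_{\mathcal G}(j)$. **Proposition.** There is $a_*>0$ such that for every $a\ge a_*$ there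 is $\varepsilon_*>0$ such that for every $\varepsilon_0\in(0,\varepsilon_*]$ there is $B_*>0$ such that for every $B\ge B_*$ the following holds. There are constants $b_0>1$ and $C>0$ such that for every $\gamma>0$ there is $\gamma_1$ with $0<\gamma_1<\gamma$ such that for every real $b$ with $|b|\ge b_0$ and $n_b:=\lceil C\ln|b|\rceil$: every standard probability family $\mathcal G\in\mathcal M_{a,b,B,\varepsilon_0}$ has an $n_b$-th iterate, and for every choice of the $n_b$-th iterate $\mathcal G_{n_b}$ there is a standard family $\mathcal G^*_{n_b}\in\mathcal M_{a,b,B,\varepsilon_0}$ equivalent to $\mathcal G_{n_b}$ with $|\mathcal G^*_{n_b}|\le e^{-\gamma_1}$. -/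

import Mathlib

open MeasureTheory Set
open scoped NNReal ENNReal

noncomputable section

/-- An open interval contained in the circle `𝕋¹`, which is identified with `[0, 1)`. -/
def IsOpenInterval (I : Set ℝ) : Prop :=
  ∃ l r : ℝ, 0 ≤ l ∧ l < r ∧ r ≤ 1 ∧ I = Ioo l r

/-- The data of a skew product `F (x, y) = (f x, y + τ x)`: the base map `f` of `𝕋¹ = [0, 1)`, the
function `τ`, and the countable joint partition of `f` and `τ` into the intervals `O i`. -/
structure SkewProduct where
  f : ℝ → ℝ
  τ : ℝ → ℝ
  ι : Type
  countable : Countable ι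
  O : ι → Set ℝ

namespace SkewProduct

variable (S : SkewProduct)

/-- The points of `(0, 1)` with itinerary `u` during the times `0, …, n - 1`. -/
def cylinder {n : ℕ} (u : Fin n → S.ι) : Set ℝ :=
  {x | x ∈ Ioo (0 : ℝ) 1 ∧ ∀ k : Fin n, S.f^[(k : ℕ)] x ∈ S.O (u k)}

/-- The set `ℋⁿ` of inverse branches of `f^n`, each of them encoded by its itinerary. -/
def Branch (n : ℕ) : Type := {u : Fin n → S.ι // (S.cylinder u).Nonempty}

variable {S}

/-- The partition element `O_h` of `f^n`, which is the range of the inverse branch `h`. -/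
def Branch.cell {n : ℕ} (h : S.Branch n) : Set ℝ := S.cylinder h.1

/-- The domain `f^n (O_h)` of the inverse branch `h`. -/
def Branch.dom {n : ℕ} (h : S.Branch n) : Set ℝ := S.f^[n] '' h.cell

/-- The inverse branch `h : f^n (O_h) → O_h` as a function. -/
def Branch.map {n : ℕ} (h : S.Branch n) : ℝ → ℝ := Function.invFunOn S.f^[n] h.cell

/-- The standing assumptions on the skew product, with Hölder exponent `α`, expansion rate `lam`,
distortion constant `D` and bound `Cτ` for the derivatives of `τ_n ∘ h`. -/
structure IsAdmissible (S : SkewProduct) (α lam D Cτ : ℝ) : Prop where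
  alpha_pos : 0 < α
  alpha_lt_one : α < 1
  mapsTo : MapsTo S.f (Ico 0 1) (Ico 0 1)
  /- `[0, 1)` is partitioned into countably many open intervals, modulo a countable set. -/
  interval : ∀ i, IsOpenInterval (S.O i)
  disjoint : Pairwise fun i j => Disjoint (S.O i) (S.O j)
  cover : (Ico (0 : ℝ) 1 \ ⋃ i, S.O i).Countable
  /- `f` is `C^{1+α}` on each partition element, up to its endpoints. -/
  f_contDiff : ∀ i, ContDiffOn ℝ 1 S.f (S.O i)
  f_holder : ∀ i, ∃ K : ℝ, ∀ x ∈ S.O i, ∀ y ∈ S.O i,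
    |deriv S.f x - deriv S.f y| ≤ K * |x - y| ^ α
  /- `f` is expanding. -/
  log_two_lt : Real.log 2 < lam
  expanding : ∀ (n : ℕ) (h : S.Branch n), ∀ x ∈ h.cell,
    Real.exp (lam * n) ≤ |deriv (S.f^[n]) x|
  /- Distortion bound. -/
  D_nonneg : 0 ≤ D
  distortion : ∀ (n : ℕ) (h : S.Branch n), ∀ x ∈ h.dom, ∀ y ∈ h.dom,
    |deriv h.map x| / |deriv h.map y| ≤ Real.exp (D * |x - y| ^ α)
  /- Summability of the branches. -/
  summability : ∀ n : ℕ,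
    ∑' h : S.Branch n, ⨆ x ∈ h.dom, ENNReal.ofReal |deriv h.map x| < ∞
  /- Covering. The countable exceptional set makes the values of `f` at the endpoints of the
  partition elements irrelevant; it allows for every convention about `f^N` on closures. -/
  covering : ∀ n : ℕ, ∃ N : ℕ, ∀ h : S.Branch n,
    (Ico (0 : ℝ) 1 \ S.f^[N] '' h.cell).Countable
  /- `τ` is piecewise `C¹`. -/
  τ_contDiff : ∀ i, ContDiffOn ℝ 1 S.τ (S.O i)
  /- `τ` is not Lipschitz-cohomologous to a function that is constant on each partition element. -/
  not_cohomologous : ¬ ∃ (φ : ℝ → ℝ) (K : ℝ≥0) (ψ : S.ι → ℝ), LipschitzOnWith K φ (Ico 0 1) ∧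
    ∀ i, ∀ x ∈ S.O i, S.τ x = φ (S.f x) - φ x + ψ i
  /- The derivatives of `τ_n ∘ h` are bounded, where `τ_n = ∑_{j < n} τ ∘ f^j`. -/
  τ_bound : ∀ (n : ℕ) (h : S.Branch n), ∀ x ∈ h.dom,
    |deriv (fun y => birkhoffSum S.f S.τ n (h.map y)) x| ≤ Cτ

end SkewProduct

/-- A standard pair `(I, ρ)` with parameters `a, b, ε₀`. -/
structure IsStandardPair (α a b ε₀ : ℝ) (I : Set ℝ) (ρ : ℝ → ℂ) : Prop where
  interval : IsOpenInterval I
  width : volume I < ENNReal.ofReal ε₀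
  le_one : ε₀ ≤ 1
  integrable : IntegrableOn ρ I
  normalized : ∫ x in I, ‖ρ x‖ = 1
  /- `H(ρ) ≤ a`; the supremum `H(ρ)` is finite only for nowhere vanishing `ρ`. -/
  ne_zero : ∀ x ∈ I, ρ x ≠ 0
  modulus : ∀ x ∈ I, ∀ y ∈ I, |Real.log ‖ρ x‖ - Real.log ‖ρ y‖| ≤ a * |x - y| ^ α
  /- `|arg(ρ)'| ≤ a |b|` for a differentiable determination `θ` of the argument. -/
  argument : ∃ θ : ℝ → ℝ, ∀ x ∈ I, ρ x = ‖ρ x‖ * Complex.exp (Complex.I * θ x) ∧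
    DifferentiableAt ℝ θ x ∧ |deriv θ x| ≤ a * |b|

/-- A countable family of intervals, complex densities on them, and weights. -/
structure WeightedFamily where
  J : Type
  countable : Countable J
  I : J → Set ℝ
  ρ : J → ℝ → ℂ
  w : J → ℝ≥0

/-- The `ε`-boundary `∂_ε I` of `I`. -/
def epsBoundary (ε : ℝ) (I : Set ℝ) : Set ℝ := I ∩ Metric.thickening ε (frontier I)

namespace WeightedFamily

/-- The total weight `|𝒢|`. -/
def totalWeight (G : WeightedFamily) : ℝ≥0∞ := ∑' j, (G.w j : ℝ≥0∞)

/-- The weight `|∂_ε 𝒢|` of the `ε`-boundary. -/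
def boundaryWeight (G : WeightedFamily) (ε : ℝ) : ℝ≥0∞ :=
  ∑' j, (G.w j : ℝ≥0∞) * ∫⁻ x in epsBoundary ε (G.I j), ‖G.ρ j x‖ₑ

/-- The density `ρ_𝒢 = ∑ w(j) ρ_j`, where each `ρ_j` is extended by zero outside `I_j`. -/
def density (G : WeightedFamily) (x : ℝ) : ℂ :=
  ∑' j, (G.w j : ℝ) • (G.I j).indicator (G.ρ j) x

/-- Equivalent families: they induce the same absolutely continuous measure. -/
def Equivalent (G G' : WeightedFamily) : Prop := G.density =ᵐ[volume] G'.density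

/-- Membership in the class `ℳ_{a,b,B,ε₀}` of standard families. -/
structure IsStandard (α a b B ε₀ : ℝ) (G : WeightedFamily) : Prop where
  pair : ∀ j, IsStandardPair α a b ε₀ (G.I j) (G.ρ j)
  B_pos : 0 < B
  boundary : ∀ ε : ℝ, 0 < ε → ε < ε₀ → G.boundaryWeight ε ≤ ENNReal.ofReal (B * ε)

/-- A choice `P` of pieces of the interval `V`: no piece if `V` is empty, `V` itself if it is shorter
than `ε₀`, and otherwise finitely many disjoint open intervals of lengths in `[ε₀ / 3, ε₀)` that
fill `V` up to finitely many points. -/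
def IsCutting (ε₀ : ℝ) (V : Set ℝ) (P : Finset (Set ℝ)) : Prop :=
  (V = ∅ → P = ∅) ∧
  (V.Nonempty → volume V < ENNReal.ofReal ε₀ → P = {V}) ∧
  (V.Nonempty → ENNReal.ofReal ε₀ ≤ volume V →
    (∀ U ∈ P, IsOpenInterval U ∧ U ⊆ V ∧ ENNReal.ofReal (ε₀ / 3) ≤ volume U ∧
      volume U < ENNReal.ofReal ε₀) ∧
    (∀ U ∈ P, ∀ U' ∈ P, U ≠ U' → Disjoint U U') ∧
    (V \ ⋃ U ∈ P, U).Finite)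

/-- The choice of a cutting of each of the images `f^n (I_j ∩ O_h)`. -/
structure Cutting (S : SkewProduct) (ε₀ : ℝ) (n : ℕ) (G : WeightedFamily) where
  pieces : G.J → S.Branch n → Finset (Set ℝ)
  isCutting : ∀ j h, IsCutting ε₀ (S.f^[n] '' (G.I j ∩ h.cell)) (pieces j h)

/-- The index set `𝒥_n` of the `n`-th iterate. -/
abbrev Cutting.Index {S : SkewProduct} {ε₀ : ℝ} {n : ℕ} {G : WeightedFamily}
    (c : Cutting S ε₀ n G) : Type :=
  Σ (j : G.J) (h : S.Branch n), {U : Set ℝ // U ∈ c.pieces j h}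

theorem Cutting.countable_index {S : SkewProduct} {ε₀ : ℝ} {n : ℕ}
    {G : WeightedFamily} (c : Cutting S ε₀ n G) : Countable c.Index := by
  have := S.countable
  have := G.countable
  have : Countable (S.Branch n) := by unfold SkewProduct.Branch; infer_instance
  infer_instance

section

variable {S : SkewProduct} {ε₀ : ℝ} {n : ℕ} {G : WeightedFamily} (c : Cutting S ε₀ n G)

/-- The interval `f^n (I_j ∩ O_h) ∩ U`. -/
def iterI (k : c.Index) : Set ℝ := S.f^[n] '' (G.I k.1 ∩ k.2.1.cell) ∩ k.2.2.1

/-- The normalizing constant `z = ∫ |ρ_j| ∘ h |h'|` over the interval `iterI`. -/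
def iterZ (k : c.Index) : ℝ :=
  ∫ x in iterI c k, ‖G.ρ k.1 (k.2.1.map x)‖ * |deriv k.2.1.map x|

/-- The density `e^{i b τ_n ∘ h} ρ_j ∘ h |h'| z⁻¹`. -/
def iterRho (b : ℝ) (k : c.Index) (x : ℝ) : ℂ :=
  Complex.exp (Complex.I * b * birkhoffSum S.f S.τ n (k.2.1.map x)) *
    G.ρ k.1 (k.2.1.map x) * |deriv k.2.1.map x| * (iterZ c k : ℂ)⁻¹

end

/-- The `n`-th iterate `𝒢_n` of the family `𝒢`, for a given choice of the cuttings. -/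
def iterate {S : SkewProduct} {ε₀ : ℝ} {n : ℕ} {G : WeightedFamily} (b : ℝ)
    (c : Cutting S ε₀ n G) : WeightedFamily where
  J := c.Index
  countable := c.countable_index
  I := iterI c
  ρ := iterRho c b
  w k := (iterZ c k).toNNReal * G.w k.1

end WeightedFamily

end

/-! Equivalence of families only concerns densities. The density of an n-th iterate is the image of
the original density under the transfer operator of f^n with weight e^{ibτ_n}, whatever the cuttings
are (`isTransfer_density`), and this image is determined almost everywhere in [0,1)
(`IsTransfer.unique`). So it suffices to find one decomposition of it into standard pairs whose
total weight is smaller than 1 by a fixed amount; the predicate `Decomposes` records such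
decompositions.

The boundary condition is traded for the length sum ∑ w(j)/|I_j|. Once ε₀ is small relative to a,
every |ρ_j| is constant up to a factor 2, so boundary condition and length sum bound each other up
to constants. Under f^n the length sum is multiplied by a factor that is small for suitable n and
short intervals, up to an additive multiple of weight/ε₀ (`lengthSum_iterate_le`): a large partition
element that meets a short interval contains one of its two endpoints, and the other elements
contribute the tail of a convergent series. The regularity constant is multiplied by e^{-αλn}, up to
the additive constant D + Cτ (`isRegularOn_push`).

Weight is lost by Dolgopyat's cancellation. Let the slope of a branch h be the derivative of τ_n∘h.
If the slopes of any two branches at a common point differed by at most K e^{-λm} for all m, they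
would converge to a bounded function g with f'·(g∘f) = τ' + g, and the primitive of g would be a
Lipschitz solution of the cohomological equation, which is excluded (`exists_lt_abs_slope_sub`).
With the covering property, every interval of length at least δ therefore contains the images of two
branches whose slopes differ by at least a constant on a common interval (`exists_isTransversal`).

The phases of the two contributions to the transferred density then separate at a speed comparable
to |b|. At scale 1/|b| they become opposite somewhere, and near such a point part of the sum is
rewritten with half the mass by e^{iθ₁} + e^{iθ₂} = (e^{iη₁} + e^{iη₂})/2, where the functions η₁
and η₂ have derivatives of order |b| (`exp_add_exp_eq`, `TransversalPhases.cancelsOn`). At least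
half of the weight sits on intervals of length at least δ = 1/(4B), so a family loses a fixed amount
σ after a fixed number of steps (`exists_isTransfer_isStandard`).

The price is a regularity constant 10a and a length sum of order |b|, because of the subdivision at
scale 1/|b|. About C ln|b| further steps halve the length sum often enough to bring it back to a
bound independent of b, and bring the regularity constant back to a (`exists_isTransfer_ceil_log`).
-/

open Filter Topology

/-! ### Open subintervals of the circle -/

/-- An open connected nonempty subset of `[0, 1)` is an open interval. -/
theorem isOpenInterval_of_isOpen {s : Set ℝ} (hne : s.Nonempty) (ho : IsOpen s)
    (hc : IsPreconnected s) (hs : s ⊆ Ico 0 1) : IsOpenInterval s := by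
  have hb : BddBelow s := ⟨0, fun x hx => (hs hx).1⟩
  have ha : BddAbove s := ⟨1, fun x hx => (hs hx).2.le⟩
  have h1 : Ioo (sInf s) (sSup s) ⊆ s := IsConnected.Ioo_csInf_csSup_subset ⟨hne, hc⟩ hb ha
  have key : ∀ x ∈ s, sInf s < x ∧ x < sSup s := by
    intro x hx
    obtain ⟨e, he, hball⟩ := Metric.isOpen_iff.1 ho x hx
    have h2 : x - e / 2 ∈ s := hball (by
      rw [Metric.mem_ball, Real.dist_eq, abs_lt]; constructor <;> linarith)
    have h3 : x + e / 2 ∈ s := hball (by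
      rw [Metric.mem_ball, Real.dist_eq, abs_lt]; constructor <;> linarith)
    exact ⟨by linarith [csInf_le hb h2], by linarith [le_csSup ha h3]⟩
  obtain ⟨x, hx⟩ := hne
  refine ⟨sInf s, sSup s, le_csInf ⟨x, hx⟩ fun y hy => (hs hy).1, (key x hx).1.trans (key x hx).2,
    csSup_le ⟨x, hx⟩ fun y hy => (hs hy).2.le, ?_⟩
  exact Subset.antisymm key h1

theorem IsOpenInterval.isOpen {I : Set ℝ} (h : IsOpenInterval I) : IsOpen I := by
  obtain ⟨l, r, -, -, -, rfl⟩ := h; exact isOpen_Ioo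

theorem IsOpenInterval.ordConnected {I : Set ℝ} (h : IsOpenInterval I) : I.OrdConnected := by
  obtain ⟨l, r, -, -, -, rfl⟩ := h; exact ordConnected_Ioo

theorem IsOpenInterval.nonempty {I : Set ℝ} (h : IsOpenInterval I) : I.Nonempty := by
  obtain ⟨l, r, -, h, -, rfl⟩ := h; exact nonempty_Ioo.2 h

theorem IsOpenInterval.subset_Ioo {I : Set ℝ} (h : IsOpenInterval I) : I ⊆ Ioo 0 1 := by
  obtain ⟨l, r, hl, h, hr, rfl⟩ := h; exact Ioo_subset_Ioo hl hr

theorem IsOpenInterval.subset_Ico {I : Set ℝ} (h : IsOpenInterval I) : I ⊆ Ico 0 1 :=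
  h.subset_Ioo.trans Ioo_subset_Ico_self

theorem IsOpenInterval.volume_pos {I : Set ℝ} (h : IsOpenInterval I) : 0 < volume I :=
  h.isOpen.measure_pos volume h.nonempty

theorem IsOpenInterval.volume_ne_zero {I : Set ℝ} (h : IsOpenInterval I) : volume I ≠ 0 :=
  h.volume_pos.ne'

theorem IsOpenInterval.volume_ne_top {I : Set ℝ} (h : IsOpenInterval I) : volume I ≠ ∞ :=
  (measure_mono_top h.subset_Ioo).mt (by simp)

theorem ContDiffAt.continuousAt_deriv_one {f : ℝ → ℝ} {x : ℝ} (h : ContDiffAt ℝ 1 f x) :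
    ContinuousAt (deriv f) x := by
  have h1 : ContinuousAt (fderiv ℝ f) x :=
    (h.fderiv_right (m := 0) (by norm_num)).continuousAt
  have : deriv f = fun y => fderiv ℝ f y 1 := by ext y; simp
  rw [this]
  exact h1.clm_apply continuousAt_const

/-! ### Partition elements, inverse branches and slopes -/

namespace SkewProduct

variable {S : SkewProduct} {α lam D Cτ : ℝ}

variable (S) in
/-- The points of `(0, 1)` with an itinerary of length `n`. -/
def reg (n : ℕ) : Set ℝ := {x | x ∈ Ioo (0 : ℝ) 1 ∧ ∀ k < n, ∃ i, S.f^[k] x ∈ S.O i}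

theorem reg_antitone {m n : ℕ} (h : m ≤ n) : S.reg n ⊆ S.reg m :=
  fun _ hx => ⟨hx.1, fun k hk => hx.2 k (hk.trans_le h)⟩

theorem mem_reg_succ {n : ℕ} {x : ℝ} :
    x ∈ S.reg (n + 1) ↔ x ∈ S.reg n ∧ ∃ i, S.f^[n] x ∈ S.O i := by
  constructor
  · intro h
    exact ⟨reg_antitone n.le_succ h, h.2 n n.lt_succ_self⟩
  · rintro ⟨h1, h2⟩
    refine ⟨h1.1, fun k hk => ?_⟩
    rcases Nat.lt_succ_iff_lt_or_eq.1 hk with h | rfl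
    · exact h1.2 k h
    · exact h2

theorem reg_subset_Ioo {n : ℕ} : S.reg n ⊆ Ioo 0 1 := fun _ hx => hx.1

theorem reg_subset_Ico {n : ℕ} : S.reg n ⊆ Ico 0 1 := reg_subset_Ioo.trans Ioo_subset_Ico_self

theorem mem_reg_add {m n : ℕ} {x : ℝ} (h1 : x ∈ S.reg m) (h2 : S.f^[m] x ∈ S.reg n) :
    x ∈ S.reg (m + n) := by
  refine ⟨h1.1, fun k hk => ?_⟩
  rcases lt_or_ge k m with h | h
  · exact h1.2 k h
  · obtain ⟨i, hi⟩ := h2.2 (k - m) (by omega)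
    refine ⟨i, ?_⟩
    rwa [← Function.iterate_add_apply, Nat.sub_add_cancel h] at hi

theorem Branch.cell_subset_reg {n : ℕ} (h : S.Branch n) : h.cell ⊆ S.reg n :=
  fun _ hx => ⟨hx.1, fun k hk => ⟨_, hx.2 ⟨k, hk⟩⟩⟩

theorem exists_branch {n : ℕ} {x : ℝ} (hx : x ∈ S.reg n) : ∃ h : S.Branch n, x ∈ h.cell := by
  choose i hi using hx.2
  have : x ∈ S.cylinder (fun k : Fin n => i k k.2) := ⟨hx.1, fun k => hi k k.2⟩
  exact ⟨⟨_, x, this⟩, this⟩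

theorem Branch.cell_nonempty {n : ℕ} (h : S.Branch n) : h.cell.Nonempty := h.2

theorem countable_branch (S : SkewProduct) (n : ℕ) : Countable (S.Branch n) := by
  have := S.countable
  unfold SkewProduct.Branch; infer_instance

namespace IsAdmissible

variable (hS : S.IsAdmissible α lam D Cτ)
include hS

theorem lam_pos : 0 < lam := (Real.log_pos one_lt_two).trans hS.log_two_lt

theorem mapsTo_iterate (n : ℕ) : MapsTo S.f^[n] (Ico 0 1) (Ico 0 1) := hS.mapsTo.iterate n

theorem branch_ext {n : ℕ} {h h' : S.Branch n} {x : ℝ} (hx : x ∈ h.cell) (hx' : x ∈ h'.cell) :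
    h = h' := by
  apply Subtype.ext
  funext k
  by_contra hne
  exact Set.disjoint_left.1 (hS.disjoint hne) (hx.2 k) (hx'.2 k)

theorem disjoint_cell {n : ℕ} {h h' : S.Branch n} (hne : h ≠ h') : Disjoint h.cell h'.cell :=
  Set.disjoint_left.2 fun _ hx hx' => hne (hS.branch_ext hx hx')

theorem deriv_iterate_ne_zero {n : ℕ} {x : ℝ} (hx : x ∈ S.reg n) : deriv S.f^[n] x ≠ 0 := by
  obtain ⟨h, hh⟩ := exists_branch hx
  have := hS.expanding n h x hh
  intro h0
  rw [h0, abs_zero] at this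
  exact absurd this (not_le.2 (Real.exp_pos _))

theorem mem_reg_one {i : S.ι} {x : ℝ} (hx : x ∈ S.O i) : x ∈ S.reg 1 :=
  ⟨(hS.interval i).subset_Ioo hx, fun k hk => ⟨i, by
    obtain rfl : k = 0 := by omega
    simpa using hx⟩⟩

theorem deriv_ne_zero {i : S.ι} {x : ℝ} (hx : x ∈ S.O i) : deriv S.f x ≠ 0 := by
  simpa using hS.deriv_iterate_ne_zero (hS.mem_reg_one hx)

theorem contDiffAt_f {i : S.ι} {x : ℝ} (hx : x ∈ S.O i) : ContDiffAt ℝ 1 S.f x :=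
  (hS.f_contDiff i).contDiffAt ((hS.interval i).isOpen.mem_nhds hx)

theorem contDiffAt_τ {i : S.ι} {x : ℝ} (hx : x ∈ S.O i) : ContDiffAt ℝ 1 S.τ x :=
  (hS.τ_contDiff i).contDiffAt ((hS.interval i).isOpen.mem_nhds hx)

theorem injOn_O (i : S.ι) : InjOn S.f (S.O i) := by
  have key : ∀ x ∈ S.O i, ∀ y ∈ S.O i, x < y → S.f x ≠ S.f y := by
    intro x hx y hy hxy heq
    have hsub : Icc x y ⊆ S.O i := (hS.interval i).ordConnected.out hx hy
    obtain ⟨c, hc, hc'⟩ := exists_deriv_eq_zero hxy ((hS.f_contDiff i).continuousOn.mono hsub) heq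
    exact hS.deriv_ne_zero (hsub (Ioo_subset_Icc_self hc)) hc'
  intro x hx y hy heq
  rcases lt_trichotomy x y with h | h | h
  · exact absurd heq (key x hx y hy h)
  · exact h
  · exact absurd heq.symm (key y hy x hx h)

theorem contDiffAt_iterate {n : ℕ} {x : ℝ} (hx : x ∈ S.reg n) : ContDiffAt ℝ 1 S.f^[n] x := by
  induction n with
  | zero => simpa using contDiffAt_id
  | succ n ih =>
    obtain ⟨h1, i, hi⟩ := mem_reg_succ.1 hx
    rw [Function.iterate_succ']
    exact (hS.contDiffAt_f hi).comp x (ih h1)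

theorem contDiffAt_birkhoffSum {n : ℕ} {x : ℝ} (hx : x ∈ S.reg n) :
    ContDiffAt ℝ 1 (birkhoffSum S.f S.τ n) x := by
  induction n with
  | zero =>
    rw [birkhoffSum_zero']
    exact contDiffAt_const
  | succ n ih =>
    obtain ⟨h1, i, hi⟩ := mem_reg_succ.1 hx
    have : birkhoffSum S.f S.τ (n + 1) =
        fun y => birkhoffSum S.f S.τ n y + S.τ (S.f^[n] y) := by
      ext y; exact birkhoffSum_succ _ _ _ _
    rw [this]
    exact (ih h1).add ((hS.contDiffAt_τ hi).comp x (hS.contDiffAt_iterate h1))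

theorem isOpen_reg (n : ℕ) : IsOpen (S.reg n) := by
  rw [isOpen_iff_mem_nhds]
  intro x hx
  have h1 : ∀ᶠ y in 𝓝 x, ∀ k ∈ Finset.range n, ∃ i, S.f^[k] y ∈ S.O i := by
    rw [Filter.eventually_all_finset]
    intro k hk
    have hk := Finset.mem_range.1 hk
    obtain ⟨i, hi⟩ := hx.2 k hk
    filter_upwards [(hS.contDiffAt_iterate (reg_antitone hk.le hx)).continuousAt.eventually
      ((hS.interval i).isOpen.mem_nhds hi)] with y hy using ⟨i, hy⟩
  filter_upwards [h1, isOpen_Ioo.mem_nhds hx.1] with y hy hy'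
  exact ⟨hy', fun k hk => hy k (Finset.mem_range.2 hk)⟩

theorem isOpen_cell {n : ℕ} (h : S.Branch n) : IsOpen h.cell := by
  rw [isOpen_iff_mem_nhds]
  intro x hx
  have h1 : ∀ᶠ y in 𝓝 x, ∀ k : Fin n, S.f^[(k : ℕ)] y ∈ S.O (h.1 k) := by
    rw [Filter.eventually_all]
    intro k
    exact (hS.contDiffAt_iterate (reg_antitone k.2.le
      (h.cell_subset_reg hx))).continuousAt.eventually ((hS.interval _).isOpen.mem_nhds (hx.2 k))
  filter_upwards [h1, isOpen_Ioo.mem_nhds hx.1] with y hy hy' using ⟨hy', hy⟩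

theorem injOn_cell {n : ℕ} (h : S.Branch n) : InjOn S.f^[n] h.cell := by
  have key : ∀ k ≤ n, InjOn S.f^[k] h.cell := by
    intro k
    induction k with
    | zero => intro _ x _ y _ hxy; simpa using hxy
    | succ k ih =>
      intro hk x hx y hy hxy
      rw [Function.iterate_succ_apply', Function.iterate_succ_apply'] at hxy
      exact ih (by omega) hx hy
        (hS.injOn_O _ (hx.2 ⟨k, by omega⟩) (hy.2 ⟨k, by omega⟩) hxy)
  exact key n le_rfl

/-- By induction on k, f^k is continuous and injective on [x, y], hence strictly monotone, so f^k z
lies between f^k x and f^k y, which belong to the same interval of the partition. -/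
theorem ordConnected_cell {n : ℕ} (h : S.Branch n) : h.cell.OrdConnected := by
  refine ⟨fun x hx y hy => ?_⟩
  rcases lt_or_ge y x with hlt | hle
  · rw [Icc_eq_empty (not_le.2 hlt)]; exact empty_subset _
  have h01 : Icc x y ⊆ Ioo (0 : ℝ) 1 := ordConnected_Ioo.out hx.1 hy.1
  have key : ∀ k ≤ n, (∀ z ∈ Icc x y, ∀ j : Fin n, (j : ℕ) < k → S.f^[(j : ℕ)] z ∈ S.O (h.1 j)) ∧
      InjOn S.f^[k] (Icc x y) := by
    intro k
    induction k with
    | zero => intro _; exact ⟨fun _ _ _ hj => absurd hj (by omega), fun a _ b _ hab => by simpa using hab⟩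
    | succ k ih =>
      intro hk
      obtain ⟨ih1, ih2⟩ := ih (by omega)
      have hreg : ∀ z ∈ Icc x y, z ∈ S.reg k := fun z hz =>
        ⟨h01 hz, fun j hj => ⟨_, ih1 z hz ⟨j, by omega⟩ hj⟩⟩
      have hcont : ContinuousOn S.f^[k] (Icc x y) := fun z hz =>
        (hS.contDiffAt_iterate (hreg z hz)).continuousAt.continuousWithinAt
      have hO : ∀ z ∈ Icc x y, S.f^[k] z ∈ S.O (h.1 ⟨k, by omega⟩) := by
        intro z hz
        have hoc := (hS.interval (h.1 ⟨k, by omega⟩)).ordConnected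
        have hfx := hx.2 ⟨k, by omega⟩
        have hfy := hy.2 ⟨k, by omega⟩
        have hxm := left_mem_Icc.2 hle
        have hym := right_mem_Icc.2 hle
        rcases hcont.strictMonoOn_of_injOn_Icc' hle ih2 with hm | hm
        · exact hoc.out hfx hfy ⟨hm.monotoneOn hxm hz hz.1, hm.monotoneOn hz hym hz.2⟩
        · exact hoc.out hfy hfx ⟨hm.antitoneOn hz hym hz.2, hm.antitoneOn hxm hz hz.1⟩
      refine ⟨fun z hz j hj => ?_, fun a ha b hb hab => ?_⟩
      · rcases Nat.lt_succ_iff_lt_or_eq.1 hj with h1 | h1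
        · exact ih1 z hz j h1
        · have h2 : j = ⟨k, by omega⟩ := Fin.ext h1
          have := hO z hz
          rwa [← h2, ← h1] at this
      · rw [Function.iterate_succ_apply', Function.iterate_succ_apply'] at hab
        exact ih2 ha hb (hS.injOn_O _ (hO a ha) (hO b hb) hab)
  exact fun z hz => ⟨h01 hz, fun k => (key n le_rfl).1 z hz k k.2⟩

theorem isOpenInterval_cell {n : ℕ} (h : S.Branch n) : IsOpenInterval h.cell :=
  isOpenInterval_of_isOpen h.cell_nonempty (hS.isOpen_cell h)
    (hS.ordConnected_cell h).isPreconnected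
    (h.cell_subset_reg.trans reg_subset_Ico)

theorem hasStrictDerivAt_iterate {n : ℕ} {x : ℝ} (hx : x ∈ S.reg n) :
    HasStrictDerivAt S.f^[n] (deriv S.f^[n] x) x :=
  (hS.contDiffAt_iterate hx).hasStrictDerivAt (by norm_num)

theorem isOpen_image {n : ℕ} {J : Set ℝ} (hJ : IsOpen J) (hJ' : J ⊆ S.reg n) :
    IsOpen (S.f^[n] '' J) := by
  rw [isOpen_iff_mem_nhds]
  rintro _ ⟨x, hx, rfl⟩
  rw [← (hS.hasStrictDerivAt_iterate (hJ' hx)).map_nhds_eq (hS.deriv_iterate_ne_zero (hJ' hx))]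
  exact image_mem_map (hJ.mem_nhds hx)

/-- The assumptions only send [0,1) to itself; openness of the image is what excludes the endpoint
0. This makes regularity of orbits compatible with composition, as in `reg_add`. -/
theorem image_subset_Ioo {n : ℕ} {J : Set ℝ} (hJ : IsOpen J) (hJ' : J ⊆ S.reg n) :
    S.f^[n] '' J ⊆ Ioo 0 1 := by
  have h1 : S.f^[n] '' J ⊆ Ico 0 1 := by
    rintro _ ⟨x, hx, rfl⟩
    exact hS.mapsTo_iterate n (reg_subset_Ico (hJ' hx))
  rw [← interior_Ico]
  exact interior_maximal h1 (hS.isOpen_image hJ hJ')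

theorem iterate_mem_Ioo {n : ℕ} {x : ℝ} (hx : x ∈ S.reg n) : S.f^[n] x ∈ Ioo (0 : ℝ) 1 :=
  hS.image_subset_Ioo (hS.isOpen_reg n) Subset.rfl ⟨x, hx, rfl⟩

theorem isOpenInterval_image {n : ℕ} {J : Set ℝ} (hne : J.Nonempty) (hJ : IsOpen J)
    (hJ' : J ⊆ S.reg n) (hc : J.OrdConnected) : IsOpenInterval (S.f^[n] '' J) := by
  refine isOpenInterval_of_isOpen (hne.image _) (hS.isOpen_image hJ hJ') ?_
    ((hS.image_subset_Ioo hJ hJ').trans Ioo_subset_Ico_self)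
  exact hc.isPreconnected.image _ fun z hz =>
    (hS.contDiffAt_iterate (hJ' hz)).continuousAt.continuousWithinAt

theorem isOpenInterval_dom {n : ℕ} (h : S.Branch n) : IsOpenInterval h.dom :=
  hS.isOpenInterval_image h.cell_nonempty (hS.isOpen_cell h) h.cell_subset_reg
    (hS.ordConnected_cell h)

theorem reg_add {m n : ℕ} {x : ℝ} :
    x ∈ S.reg (m + n) ↔ x ∈ S.reg m ∧ S.f^[m] x ∈ S.reg n := by
  refine ⟨fun h => ?_, fun h => mem_reg_add h.1 h.2⟩
  have h1 := reg_antitone (Nat.le_add_right m n) h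
  refine ⟨h1, hS.iterate_mem_Ioo h1, fun k hk => ?_⟩
  obtain ⟨i, hi⟩ := h.2 (k + m) (by omega)
  exact ⟨i, by rwa [Function.iterate_add_apply] at hi⟩

end IsAdmissible

theorem Branch.map_mem {n : ℕ} {h : S.Branch n} {x : ℝ} (hx : x ∈ h.dom) : h.map x ∈ h.cell :=
  Function.invFunOn_mem hx

theorem Branch.iterate_map {n : ℕ} {h : S.Branch n} {x : ℝ} (hx : x ∈ h.dom) :
    S.f^[n] (h.map x) = x :=
  Function.invFunOn_eq hx

theorem Branch.iterate_mem_dom {n : ℕ} {h : S.Branch n} {z : ℝ} (hz : z ∈ h.cell) :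
    S.f^[n] z ∈ h.dom := ⟨z, hz, rfl⟩

theorem Branch.map_mem_reg {n : ℕ} {h : S.Branch n} {x : ℝ} (hx : x ∈ h.dom) :
    h.map x ∈ S.reg n := h.cell_subset_reg (map_mem hx)

theorem Branch.map_injOn {n : ℕ} {h : S.Branch n} : InjOn h.map h.dom := by
  intro x hx y hy hxy
  rw [← iterate_map hx, hxy, iterate_map hy]

variable (S) in
/-- The quotient `τ_n' / (f^n)'`, which is the derivative of `τ_n ∘ h` at `f^n z` for the inverse
branch `h` through `z`. -/
noncomputable def slope (n : ℕ) (z : ℝ) : ℝ := deriv (birkhoffSum S.f S.τ n) z / deriv S.f^[n] z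

namespace IsAdmissible

variable (hS : S.IsAdmissible α lam D Cτ)
include hS

theorem map_iterate {n : ℕ} {h : S.Branch n} {z : ℝ} (hz : z ∈ h.cell) :
    h.map (S.f^[n] z) = z :=
  hS.injOn_cell h (Branch.map_mem (Branch.iterate_mem_dom hz)) hz
    (Branch.iterate_map (Branch.iterate_mem_dom hz))

theorem hasStrictDerivAt_map {n : ℕ} {h : S.Branch n} {x : ℝ} (hx : x ∈ h.dom) :
    HasStrictDerivAt h.map (deriv S.f^[n] (h.map x))⁻¹ x := by
  have hz := Branch.map_mem hx
  have := (hS.hasStrictDerivAt_iterate (h.cell_subset_reg hz)).to_local_left_inverse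
    (hS.deriv_iterate_ne_zero (h.cell_subset_reg hz)) (g := h.map) (by
      filter_upwards [(hS.isOpen_cell h).mem_nhds hz] with y hy using hS.map_iterate hy)
  rwa [Branch.iterate_map hx] at this

theorem hasDerivAt_map {n : ℕ} {h : S.Branch n} {x : ℝ} (hx : x ∈ h.dom) :
    HasDerivAt h.map (deriv S.f^[n] (h.map x))⁻¹ x := (hS.hasStrictDerivAt_map hx).hasDerivAt

theorem deriv_map {n : ℕ} {h : S.Branch n} {x : ℝ} (hx : x ∈ h.dom) :
    deriv h.map x = (deriv S.f^[n] (h.map x))⁻¹ := (hS.hasDerivAt_map hx).deriv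

theorem deriv_map_ne_zero {n : ℕ} {h : S.Branch n} {x : ℝ} (hx : x ∈ h.dom) :
    deriv h.map x ≠ 0 := by
  rw [hS.deriv_map hx]
  exact inv_ne_zero (hS.deriv_iterate_ne_zero (Branch.map_mem_reg hx))

theorem abs_deriv_map_le {n : ℕ} {h : S.Branch n} {x : ℝ} (hx : x ∈ h.dom) :
    |deriv h.map x| ≤ Real.exp (-(lam * n)) := by
  rw [hS.deriv_map hx, abs_inv, Real.exp_neg]
  exact inv_anti₀ (Real.exp_pos _) (hS.expanding n h _ (Branch.map_mem hx))

theorem continuousOn_map {n : ℕ} (h : S.Branch n) : ContinuousOn h.map h.dom :=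
  fun _ hx => (hS.hasDerivAt_map hx).continuousAt.continuousWithinAt

theorem abs_map_sub_le {n : ℕ} {h : S.Branch n} {x y : ℝ} (hx : x ∈ h.dom) (hy : y ∈ h.dom) :
    |h.map x - h.map y| ≤ Real.exp (-(lam * n)) * |x - y| := by
  have hc : Convex ℝ h.dom := (hS.isOpenInterval_dom h).ordConnected.convex
  simpa [Real.norm_eq_abs] using hc.norm_image_sub_le_of_norm_deriv_le (f := h.map)
    (fun z hz => (hS.hasDerivAt_map hz).differentiableAt)
    (fun z hz => hS.abs_deriv_map_le hz) hy hx

theorem hasDerivAt_birkhoffSum {n : ℕ} {z : ℝ} (hz : z ∈ S.reg n) :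
    HasDerivAt (birkhoffSum S.f S.τ n) (deriv (birkhoffSum S.f S.τ n) z) z :=
  ((hS.contDiffAt_birkhoffSum hz).differentiableAt (by norm_num)).hasDerivAt

theorem hasDerivAt_birkhoffSum_map {n : ℕ} {h : S.Branch n} {x : ℝ} (hx : x ∈ h.dom) :
    HasDerivAt (fun y => birkhoffSum S.f S.τ n (h.map y)) (S.slope n (h.map x)) x :=
  (hS.hasDerivAt_birkhoffSum (Branch.map_mem_reg hx)).comp x (hS.hasDerivAt_map hx)

theorem abs_slope_le {n : ℕ} {z : ℝ} (hz : z ∈ S.reg n) : |S.slope n z| ≤ Cτ := by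
  obtain ⟨h, hh⟩ := exists_branch hz
  have := hS.τ_bound n h _ (Branch.iterate_mem_dom hh)
  rwa [(hS.hasDerivAt_birkhoffSum_map (Branch.iterate_mem_dom hh)).deriv, hS.map_iterate hh]
    at this

theorem continuousAt_slope {n : ℕ} {z : ℝ} (hz : z ∈ S.reg n) : ContinuousAt (S.slope n) z :=
  (hS.contDiffAt_birkhoffSum hz).continuousAt_deriv_one.div
    (hS.contDiffAt_iterate hz).continuousAt_deriv_one (hS.deriv_iterate_ne_zero hz)

/-- Cocycle relation: the slope of the earlier part of the orbit is divided by the derivative of the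
later part. Since slopes are bounded by `Cτ`, the past beyond the last n steps changes a slope by at
most Cτ e^{-λn}. -/
theorem slope_add {m n : ℕ} {z : ℝ} (hz : z ∈ S.reg m) (hz' : S.f^[m] z ∈ S.reg n) :
    S.slope (m + n) z = S.slope n (S.f^[m] z) + S.slope m z / deriv S.f^[n] (S.f^[m] z) := by
  have h1 := hS.hasDerivAt_birkhoffSum hz
  have h2 := hS.hasDerivAt_birkhoffSum hz'
  have h3 := (hS.hasStrictDerivAt_iterate hz).hasDerivAt
  have h4 := (hS.hasStrictDerivAt_iterate hz').hasDerivAt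
  have e1 : birkhoffSum S.f S.τ (m + n) =
      birkhoffSum S.f S.τ m + birkhoffSum S.f S.τ n ∘ S.f^[m] := by
    ext y; exact birkhoffSum_add _ _ _ _ _
  have e2 : S.f^[m + n] = S.f^[n] ∘ S.f^[m] := by rw [add_comm, Function.iterate_add]
  have n3 := hS.deriv_iterate_ne_zero hz
  have n4 := hS.deriv_iterate_ne_zero hz'
  have d1 := h1.add (h2.comp z h3)
  have d2 := h4.comp z h3
  rw [← e2] at d2
  rw [← e1] at d1
  unfold slope
  rw [d1.deriv, d2.deriv]
  field_simp
  ring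

theorem Cτ_nonneg_of_mem {n : ℕ} {z : ℝ} (hz : z ∈ S.reg n) : 0 ≤ Cτ :=
  (abs_nonneg _).trans (hS.abs_slope_le hz)

theorem abs_deriv_ge {n : ℕ} {z : ℝ} (hz : z ∈ S.reg n) :
    Real.exp (lam * n) ≤ |deriv S.f^[n] z| := by
  obtain ⟨h, hh⟩ := exists_branch hz
  exact hS.expanding n h z hh

theorem abs_log_deriv_map_sub_le {n : ℕ} {h : S.Branch n} {x y : ℝ} (hx : x ∈ h.dom)
    (hy : y ∈ h.dom) :
    |Real.log (|deriv h.map x|) - Real.log (|deriv h.map y|)| ≤ D * |x - y| ^ α := by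
  have key : ∀ x ∈ h.dom, ∀ y ∈ h.dom,
      Real.log (|deriv h.map x|) - Real.log (|deriv h.map y|) ≤ D * |x - y| ^ α := by
    intro x hx y hy
    have h1 := abs_pos.2 (hS.deriv_map_ne_zero hx)
    have h2 := abs_pos.2 (hS.deriv_map_ne_zero hy)
    rw [← Real.log_div h1.ne' h2.ne']
    exact (Real.log_le_iff_le_exp (div_pos h1 h2)).2 (hS.distortion n h x hx y hy)
  rw [abs_le]
  constructor
  · have := key y hy x hx
    rw [abs_sub_comm] at this
    linarith
  · exact key x hx y hy

/-- f is injective on each of countably many intervals that cover all but a countable set, so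
countable exceptional sets can be pulled back freely. -/
theorem countable_preimage {A : Set ℝ} (hA : A.Countable) (n : ℕ) :
    (Ico 0 1 ∩ S.f^[n] ⁻¹' A).Countable := by
  have := S.countable
  induction n generalizing A with
  | zero => exact hA.mono fun x hx => hx.2
  | succ n ih =>
    have h1 : (Ico 0 1 ∩ S.f ⁻¹' A).Countable := by
      have h2 : ∀ i, (S.O i ∩ S.f ⁻¹' A).Countable := fun i =>
        MapsTo.countable_of_injOn (f := S.f) (fun x hx => hx.2)
          ((hS.injOn_O i).mono inter_subset_left) hA
      refine (hS.cover.union (countable_iUnion h2)).mono fun x hx => ?_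
      by_cases hx' : x ∈ ⋃ i, S.O i
      · obtain ⟨i, hi⟩ := mem_iUnion.1 hx'
        exact Or.inr (mem_iUnion.2 ⟨i, hi, hx.2⟩)
      · exact Or.inl ⟨hx.1, hx'⟩
    refine (ih h1).mono fun x hx => ?_
    refine ⟨hx.1, hS.mapsTo_iterate n hx.1, ?_⟩
    have := hx.2
    rwa [mem_preimage, Function.iterate_succ_apply'] at this

theorem countable_compl_reg (n : ℕ) : (Ico (0 : ℝ) 1 \ S.reg n).Countable := by
  induction n with
  | zero =>
    refine (countable_singleton (0 : ℝ)).mono fun x hx => ?_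
    by_contra h0
    exact hx.2 ⟨⟨lt_of_le_of_ne hx.1.1 (Ne.symm h0), hx.1.2⟩, fun k hk => absurd hk (by omega)⟩
  | succ n ih =>
    refine (ih.union (hS.countable_preimage hS.cover n)).mono fun x hx => ?_
    by_cases h1 : x ∈ S.reg n
    · refine Or.inr ⟨hx.1, hS.mapsTo_iterate n hx.1, fun h2 => hx.2 (mem_reg_succ.2 ⟨h1, ?_⟩)⟩
      simpa using h2
    · exact Or.inl ⟨hx.1, h1⟩

/-- A version of `f` that vanishes outside `[0, 1)` is measurable. -/
theorem measurable_indicator_of_contDiffAt {g : ℝ → ℝ} (hg : ∀ i, ∀ x ∈ S.O i, ContinuousAt g x) :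
    Measurable (indicator (Ico 0 1) g) := by
  have := S.countable
  have key : Measurable (indicator (⋃ i, S.O i) g) := by
    have hO : IsOpen (⋃ i, S.O i) := isOpen_iUnion fun i => (hS.interval i).isOpen
    have hc : ContinuousOn g (⋃ i, S.O i) := fun x hx => by
      obtain ⟨i, hi⟩ := mem_iUnion.1 hx
      exact (hg i x hi).continuousWithinAt
    classical
    rw [← piecewise_eq_indicator]
    exact ContinuousOn.measurable_piecewise hc continuous_zero.continuousOn hO.measurableSet
  -- The truncations to [0,1) and to the union of the partition elements differ only on the
  -- countable exceptional set.
  refine key.measurable_of_countable_ne (hS.cover.mono fun x hx => ?_)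
  by_cases h1 : x ∈ ⋃ i, S.O i
  · obtain ⟨i, hi⟩ := mem_iUnion.1 h1
    exact absurd (by
      rw [indicator_of_mem h1, indicator_of_mem ((hS.interval i).subset_Ico hi)]) hx
  · refine ⟨?_, h1⟩
    by_contra h2
    exact hx (by rw [indicator_of_notMem h1, indicator_of_notMem h2])

theorem measurable_indicator_f : Measurable (indicator (Ico 0 1) S.f) :=
  hS.measurable_indicator_of_contDiffAt fun _ _ hx => (hS.contDiffAt_f hx).continuousAt

theorem measurable_indicator_τ : Measurable (indicator (Ico 0 1) S.τ) :=
  hS.measurable_indicator_of_contDiffAt fun _ _ hx => (hS.contDiffAt_τ hx).continuousAt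

theorem iterate_indicator {n : ℕ} {x : ℝ} (hx : x ∈ Ico (0 : ℝ) 1) :
    (indicator (Ico 0 1) S.f)^[n] x = S.f^[n] x := by
  induction n with
  | zero => rfl
  | succ n ih =>
    rw [Function.iterate_succ_apply', Function.iterate_succ_apply', ih,
      indicator_of_mem (hS.mapsTo_iterate n hx)]

theorem measurable_indicator_comp_iterate {β : Type*} [MeasurableSpace β] [Zero β] {φ : ℝ → β}
    (hφ : Measurable φ) (n : ℕ) : Measurable (indicator (Ico 0 1) fun x => φ (S.f^[n] x)) := by
  have h1 : Measurable (indicator (Ico 0 1) fun x => φ ((indicator (Ico 0 1) S.f)^[n] x)) :=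
    (hφ.comp (hS.measurable_indicator_f.iterate n)).indicator measurableSet_Ico
  convert h1 using 1
  exact indicator_congr fun x hx => by rw [hS.iterate_indicator hx]

theorem measurable_indicator_birkhoffSum (n : ℕ) :
    Measurable (indicator (Ico 0 1) (birkhoffSum S.f S.τ n)) := by
  have h1 : Measurable fun x => ∑ k ∈ Finset.range n,
      indicator (Ico 0 1) (fun x => indicator (Ico 0 1) S.τ (S.f^[k] x)) x :=
    Finset.measurable_sum _ fun k _ =>
      hS.measurable_indicator_comp_iterate hS.measurable_indicator_τ k
  convert h1 using 1
  ext x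
  by_cases hx : x ∈ Ico (0 : ℝ) 1
  · rw [indicator_of_mem hx, birkhoffSum]
    refine Finset.sum_congr rfl fun k _ => ?_
    rw [indicator_of_mem hx, indicator_of_mem (hS.mapsTo_iterate k hx)]
  · rw [indicator_of_notMem hx]
    exact (Finset.sum_eq_zero fun k _ => indicator_of_notMem hx _).symm

end IsAdmissible
end SkewProduct

/-! ### Weighted transfer operators, characterized by duality -/

theorem ae_summable_norm_of_tsum_lintegral_ne_top {κ X E : Type*} [Countable κ]
    [MeasurableSpace X] {μ : Measure X} [NormedAddCommGroup E] {g : κ → X → E}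
    (hg : ∀ i, AEStronglyMeasurable (g i) μ) (h : ∑' i, ∫⁻ x, ‖g i x‖ₑ ∂μ ≠ ∞) :
    ∀ᵐ x ∂μ, Summable fun i => ‖g i x‖ := by
  rw [← lintegral_tsum fun i => (hg i).enorm] at h
  filter_upwards [ae_lt_top' (AEMeasurable.tsum fun i => (hg i).enorm) h] with x hx
  rw [← summable_norm_iff]
  have : Summable fun i => ‖g i x‖₊ := ENNReal.tsum_coe_ne_top_iff_summable.1 hx.ne
  simpa using NNReal.summable_coe.2 this

theorem integrable_tsum_of_tsum_lintegral_ne_top {κ X E : Type*} [Countable κ]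
    [MeasurableSpace X] {μ : Measure X} [NormedAddCommGroup E] [CompleteSpace E] {g : κ → X → E}
    (hg : ∀ i, AEStronglyMeasurable (g i) μ) (h : ∑' i, ∫⁻ x, ‖g i x‖ₑ ∂μ ≠ ∞) :
    Integrable (fun x => ∑' i, g i x) μ := by
  have hs := ae_summable_norm_of_tsum_lintegral_ne_top hg h
  refine ⟨?_, ?_⟩
  · refine aestronglyMeasurable_of_tendsto_ae (u := (atTop : Filter (Finset κ)))
      (f := fun s x => ∑ i ∈ s, g i x)
      (fun s => Finset.aestronglyMeasurable_fun_sum _ fun i _ => hg i) ?_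
    filter_upwards [hs] with x hx using hx.of_norm.hasSum
  · refine lt_of_le_of_lt ?_ h.lt_top
    rw [← lintegral_tsum fun i => (hg i).enorm]
    refine lintegral_mono_ae ?_
    filter_upwards [hs] with x hx
    exact enorm_tsum_le_tsum_enorm

namespace SkewProduct

variable {S : SkewProduct} {α lam D Cτ : ℝ} {b : ℝ}

variable (S b) in
/-- The weighted composition operator `φ ↦ e^{i b τ_n} φ ∘ f^n`. -/
noncomputable def koopman (n : ℕ) (φ : ℝ → ℂ) (x : ℝ) : ℂ :=
  Complex.exp (Complex.I * b * birkhoffSum S.f S.τ n x) * φ (S.f^[n] x)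

theorem norm_exp_I_mul_mul (b t : ℝ) : ‖Complex.exp (Complex.I * b * t)‖ = 1 := by
  rw [mul_assoc, mul_comm, ← Complex.ofReal_mul, Complex.norm_exp_ofReal_mul_I]

theorem norm_koopman_le {n : ℕ} {φ : ℝ → ℂ} (h : ∀ x, ‖φ x‖ ≤ 1) (x : ℝ) :
    ‖S.koopman b n φ x‖ ≤ 1 := by
  rw [koopman, norm_mul, norm_exp_I_mul_mul, one_mul]
  exact h _

variable (S b) in
/-- `g'` is the image of `g` under the transfer operator of `f^n` with weight `e^{i b τ_n}`; this is
expressed by duality with bounded test functions. -/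
structure IsTransfer (n : ℕ) (g g' : ℝ → ℂ) : Prop where
  integrable : Integrable g
  integrable_image : Integrable g'
  dual : ∀ φ : ℝ → ℂ, Measurable φ → (∀ x, ‖φ x‖ ≤ 1) →
    ∫ x in Ico 0 1, g' x * φ x = ∫ x in Ico 0 1, g x * S.koopman b n φ x

theorem IsTransfer.congr_ae {n : ℕ} {g g' g₁ g₁' : ℝ → ℂ} (h : S.IsTransfer b n g g')
    (hg : g =ᵐ[volume] g₁) (hg' : g' =ᵐ[volume] g₁') : S.IsTransfer b n g₁ g₁' := by
  refine ⟨h.integrable.congr hg, h.integrable_image.congr hg', fun φ hφ hφ' => ?_⟩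
  have h1 : ∫ x in Ico 0 1, g₁' x * φ x = ∫ x in Ico 0 1, g' x * φ x :=
    integral_congr_ae ((ae_restrict_of_ae hg').mono fun x hx => by simp only [hx])
  have h2 : ∫ x in Ico 0 1, g₁ x * S.koopman b n φ x = ∫ x in Ico 0 1, g x * S.koopman b n φ x :=
    integral_congr_ae ((ae_restrict_of_ae hg).mono fun x hx => by simp only [hx])
  rw [h1, h2, h.dual φ hφ hφ']

/-- Indicators of measurable sets are admissible test functions. This is what allows the iterate to
be replaced by any other decomposition of its density. -/
theorem IsTransfer.unique {n : ℕ} {g g' g'' : ℝ → ℂ} (h : S.IsTransfer b n g g')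
    (h' : S.IsTransfer b n g g'') : g' =ᵐ[volume.restrict (Ico 0 1)] g'' := by
  refine Integrable.ae_eq_of_forall_setIntegral_eq _ _ h.integrable_image.restrict
    h'.integrable_image.restrict fun s hs _ => ?_
  have hm : Measurable (indicator s (1 : ℝ → ℂ)) := measurable_one.indicator hs
  have hb : ∀ x, ‖indicator s (1 : ℝ → ℂ) x‖ ≤ 1 := fun x => by
    by_cases hx : x ∈ s <;> simp [hx]
  have h1 := (h.dual _ hm hb).trans (h'.dual _ hm hb).symm
  have e : ∀ k : ℝ → ℂ, (fun x => k x * indicator s (1 : ℝ → ℂ) x) = indicator s k := by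
    intro k; ext x; by_cases hx : x ∈ s <;> simp [hx]
  rwa [e, e, integral_indicator hs, integral_indicator hs] at h1

theorem IsTransfer.const_mul {n : ℕ} {g g' : ℝ → ℂ} (h : S.IsTransfer b n g g') (c : ℂ) :
    S.IsTransfer b n (fun x => c * g x) (fun x => c * g' x) := by
  refine ⟨h.integrable.const_mul c, h.integrable_image.const_mul c, fun φ hφ hφ' => ?_⟩
  simp only [mul_assoc, integral_const_mul]
  rw [h.dual φ hφ hφ']

namespace IsAdmissible

variable (hS : S.IsAdmissible α lam D Cτ)
include hS

theorem measurable_koopman {n : ℕ} {φ : ℝ → ℂ} (hφ : Measurable φ) :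
    Measurable (indicator (Ico 0 1) (S.koopman b n φ)) := by
  have h1 : Measurable (indicator (Ico 0 1) fun x =>
      Complex.exp (Complex.I * b * (indicator (Ico 0 1) (birkhoffSum S.f S.τ n) x : ℝ)) *
        indicator (Ico 0 1) (fun x => φ (S.f^[n] x)) x) := by
    have := hS.measurable_indicator_birkhoffSum n
    have := hS.measurable_indicator_comp_iterate hφ n
    exact Measurable.indicator (by fun_prop) measurableSet_Ico
  convert h1 using 1
  exact indicator_congr fun x hx => by rw [indicator_of_mem hx, indicator_of_mem hx, koopman]

theorem aestronglyMeasurable_koopman {n : ℕ} {φ : ℝ → ℂ} (hφ : Measurable φ) :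
    AEStronglyMeasurable (S.koopman b n φ) (volume.restrict (Ico 0 1)) :=
  (aestronglyMeasurable_indicator_iff measurableSet_Ico).1
    (hS.measurable_koopman hφ).aestronglyMeasurable

theorem isTransfer_comp {m n : ℕ} {g g' g'' : ℝ → ℂ} (h : S.IsTransfer b m g g')
    (h' : S.IsTransfer b n g' g'') : S.IsTransfer b (m + n) g g'' := by
  refine ⟨h.integrable, h'.integrable_image, fun φ hφ hφ' => ?_⟩
  -- Test functions have to be measurable on the whole line, but f and τ are arbitrary outside
  -- [0,1); hence the truncation.
  have h1 : ∫ x in Ico 0 1, g' x * S.koopman b n φ x =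
      ∫ x in Ico 0 1, g' x * indicator (Ico 0 1) (S.koopman b n φ) x :=
    setIntegral_congr_fun measurableSet_Ico fun x hx => by
      simp only [indicator_of_mem hx]
  rw [h'.dual φ hφ hφ', h1, h.dual _ (hS.measurable_koopman hφ) fun x =>
    (norm_indicator_le_norm_self _ _).trans (norm_koopman_le hφ' x)]
  refine setIntegral_congr_fun measurableSet_Ico fun x hx => ?_
  simp only [koopman]
  rw [indicator_of_mem (hS.mapsTo_iterate m hx), koopman, ← Function.iterate_add_apply,
    birkhoffSum_add, add_comm n m, ← mul_assoc (Complex.exp _), ← Complex.exp_add]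
  push_cast
  ring_nf

theorem isTransfer_tsum {κ : Type*} [Countable κ] {n : ℕ} {g g' : κ → ℝ → ℂ}
    (h : ∀ i, S.IsTransfer b n (g i) (g' i)) (hg : ∑' i, ∫⁻ x, ‖g i x‖ₑ ≠ ∞)
    (hg' : ∑' i, ∫⁻ x, ‖g' i x‖ₑ ≠ ∞) :
    S.IsTransfer b n (fun x => ∑' i, g i x) (fun x => ∑' i, g' i x) := by
  refine ⟨integrable_tsum_of_tsum_lintegral_ne_top (fun i => (h i).integrable.1) hg,
    integrable_tsum_of_tsum_lintegral_ne_top (fun i => (h i).integrable_image.1) hg',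
    fun φ hφ hφ' => ?_⟩
  have key : ∀ (u : κ → ℝ → ℂ) (ψ : ℝ → ℂ), (∀ i, AEStronglyMeasurable (u i)) →
      AEStronglyMeasurable ψ (volume.restrict (Ico 0 1)) → (∀ x, ‖ψ x‖ ≤ 1) →
      ∑' i, ∫⁻ x, ‖u i x‖ₑ ≠ ∞ →
      ∫ x in Ico 0 1, (∑' i, u i x) * ψ x = ∑' i, ∫ x in Ico 0 1, u i x * ψ x := by
    intro u ψ hu hψ hψ' hsum
    simp only [← tsum_mul_right]
    refine integral_tsum (fun i => (hu i).restrict.mul hψ) (ne_top_of_le_ne_top hsum ?_)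
    refine ENNReal.tsum_le_tsum fun i => ?_
    refine le_trans (lintegral_mono fun x => ?_) (setLIntegral_le_lintegral (Ico 0 1) _)
    rw [enorm_mul]
    refine mul_le_of_le_one_right' ?_
    rw [← ofReal_norm, ← ENNReal.ofReal_one]
    exact ENNReal.ofReal_le_ofReal (hψ' x)
  rw [key g' φ (fun i => (h i).integrable_image.1) hφ.aestronglyMeasurable hφ' hg',
    key g _ (fun i => (h i).integrable.1) (hS.aestronglyMeasurable_koopman hφ)
      (norm_koopman_le hφ') hg]
  exact tsum_congr fun i => (h i).dual φ hφ hφ'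

theorem isTransfer_add {n : ℕ} {g₁ g₁' g₂ g₂' : ℝ → ℂ} (h₁ : S.IsTransfer b n g₁ g₁')
    (h₂ : S.IsTransfer b n g₂ g₂') :
    S.IsTransfer b n (fun x => g₁ x + g₂ x) (fun x => g₁' x + g₂' x) := by
  have := hS.isTransfer_tsum (κ := Bool) (g := fun i => bif i then g₁ else g₂)
    (g' := fun i => bif i then g₁' else g₂') (n := n) (b := b)
    (fun i => by cases i <;> assumption) (by
      rw [tsum_bool]; exact ENNReal.add_ne_top.2 ⟨h₂.integrable.2.ne, h₁.integrable.2.ne⟩) (by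
      rw [tsum_bool]
      exact ENNReal.add_ne_top.2 ⟨h₂.integrable_image.2.ne, h₁.integrable_image.2.ne⟩)
  simpa [tsum_bool, add_comm] using this

/-- The image of a function on the range of an inverse branch. -/
theorem isTransfer_branch {n : ℕ} (h : S.Branch n) {E : Set ℝ} (hE : MeasurableSet E)
    (hE' : E ⊆ h.dom) {p : ℝ → ℂ} (hp : IntegrableOn p (h.map '' E)) :
    S.IsTransfer b n (indicator (h.map '' E) p) (indicator E fun x =>
      Complex.exp (Complex.I * b * birkhoffSum S.f S.τ n (h.map x)) * p (h.map x) *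
        |deriv h.map x|) := by
  have hd : ∀ x ∈ E, HasDerivWithinAt h.map (deriv h.map x) E x := fun x hx =>
    (hS.hasDerivAt_map (hE' hx)).differentiableAt.hasDerivAt.hasDerivWithinAt
  have hinj : InjOn h.map E := Branch.map_injOn.mono hE'
  have hmE : MeasurableSet (h.map '' E) :=
    hE.image_of_continuousOn_injOn ((hS.continuousOn_map h).mono hE') hinj
  have hsub1 : h.map '' E ⊆ Ico 0 1 := by
    rintro _ ⟨x, hx, rfl⟩
    exact reg_subset_Ico (Branch.map_mem_reg (hE' hx))
  have hsub2 : E ⊆ Ico 0 1 := hE'.trans (hS.isOpenInterval_dom h).subset_Ico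
  have hcont : ContinuousOn (fun x => Complex.exp (Complex.I * b *
      birkhoffSum S.f S.τ n (h.map x))) E := by
    have : ContinuousOn (fun x => birkhoffSum S.f S.τ n (h.map x)) E := fun x hx =>
      (hS.hasDerivAt_birkhoffSum_map (hE' hx)).continuousAt.continuousWithinAt
    fun_prop
  refine ⟨hp.integrable_indicator hmE, ?_, fun φ hφ hφ' => ?_⟩
  · rw [integrable_indicator_iff hE]
    have h1 := (integrableOn_image_iff_integrableOn_abs_deriv_smul hE hd hinj p).1 hp
    refine Integrable.congr (Integrable.bdd_mul (c := 1) h1 (hcont.aestronglyMeasurable hE)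
      (ae_of_all _ fun x => (norm_exp_I_mul_mul _ _).le)) (ae_of_all _ fun x => ?_)
    simp only [Complex.real_smul]
    ring
  · have h1 : ∀ k : ℝ → ℂ, (fun x => indicator E k x * φ x) = indicator E fun x => k x * φ x :=
      fun k => by ext x; by_cases hx : x ∈ E <;> simp [hx]
    have h2 : (fun x => indicator (h.map '' E) p x * S.koopman b n φ x) =
        indicator (h.map '' E) fun x => p x * S.koopman b n φ x := by
      ext x; by_cases hx : x ∈ h.map '' E
      · rw [indicator_of_mem hx, indicator_of_mem hx]
      · rw [indicator_of_notMem hx, indicator_of_notMem hx, zero_mul]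
    rw [h1, h2, setIntegral_indicator hE, setIntegral_indicator hmE, inter_eq_right.2 hsub1,
      inter_eq_right.2 hsub2, integral_image_eq_integral_abs_deriv_smul hE hd hinj]
    refine setIntegral_congr_fun hE fun x hx => ?_
    simp only [koopman, Complex.real_smul, Branch.iterate_map (hE' hx)]
    ring

end IsAdmissible
end SkewProduct

/-! ### Regular densities, standard pairs and the length sum -/

/-- The regularity conditions on the density of a standard pair, without its normalization. -/
structure IsRegularOn (α a b : ℝ) (I : Set ℝ) (ρ : ℝ → ℂ) : Prop where
  ne_zero : ∀ x ∈ I, ρ x ≠ 0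
  modulus : ∀ x ∈ I, ∀ y ∈ I, |Real.log ‖ρ x‖ - Real.log ‖ρ y‖| ≤ a * |x - y| ^ α
  argument : ∃ θ : ℝ → ℝ, ∀ x ∈ I, ρ x = ‖ρ x‖ * Complex.exp (Complex.I * θ x) ∧
    DifferentiableAt ℝ θ x ∧ |deriv θ x| ≤ a * |b|

theorem abs_sub_lt_of_volume_lt {I : Set ℝ} (hI : IsOpenInterval I) {ε : ℝ}
    (h : volume I < ENNReal.ofReal ε) {x y : ℝ} (hx : x ∈ I) (hy : y ∈ I) : |x - y| < ε := by
  obtain ⟨l, r, -, -, -, rfl⟩ := hI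
  rw [Real.volume_Ioo, ENNReal.ofReal_lt_ofReal_iff_of_nonneg (by linarith [hx.1, hx.2])] at h
  rw [abs_lt]
  constructor <;> linarith [hx.1, hx.2, hy.1, hy.2]

namespace IsRegularOn

variable {α a b : ℝ} {I : Set ℝ} {ρ : ℝ → ℂ}

theorem mono_set (h : IsRegularOn α a b I ρ) {J : Set ℝ} (hJ : J ⊆ I) : IsRegularOn α a b J ρ := by
  obtain ⟨θ, hθ⟩ := h.argument
  exact ⟨fun x hx => h.ne_zero x (hJ hx), fun x hx y hy => h.modulus x (hJ hx) y (hJ hy),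
    θ, fun x hx => hθ x (hJ hx)⟩

theorem mono (h : IsRegularOn α a b I ρ) {a' : ℝ} (ha : a ≤ a') : IsRegularOn α a' b I ρ := by
  obtain ⟨θ, hθ⟩ := h.argument
  refine ⟨h.ne_zero, fun x hx y hy => (h.modulus x hx y hy).trans (by gcongr), θ, fun x hx =>
    ⟨(hθ x hx).1, (hθ x hx).2.1, (hθ x hx).2.2.trans (by gcongr)⟩⟩

theorem norm_pos (h : IsRegularOn α a b I ρ) {x : ℝ} (hx : x ∈ I) : 0 < ‖ρ x‖ :=
  norm_pos_iff.2 (h.ne_zero x hx)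

theorem continuousOn_norm (h : IsRegularOn α a b I ρ) (hα : 0 < α) :
    ContinuousOn (fun x => ‖ρ x‖) I := by
  have h1 : ContinuousOn (fun x => Real.log ‖ρ x‖) I := by
    intro x hx
    rw [ContinuousWithinAt, tendsto_iff_norm_sub_tendsto_zero]
    have h2 : Tendsto (fun y => a * |y - x| ^ α) (𝓝[I] x) (𝓝 0) := by
      have : ContinuousAt (fun y => a * |y - x| ^ α) x := by
        refine continuousAt_const.mul (ContinuousAt.rpow_const (by fun_prop) (Or.inr hα.le))
      have h3 := this.tendsto
      simp only [sub_self, abs_zero, Real.zero_rpow hα.ne', mul_zero] at h3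
      exact h3.mono_left nhdsWithin_le_nhds
    refine squeeze_zero' (Eventually.of_forall fun _ => norm_nonneg _) ?_ h2
    filter_upwards [self_mem_nhdsWithin] with y hy using h.modulus y hy x hx
  exact (Real.continuous_exp.comp_continuousOn h1).congr fun x hx =>
    (Real.exp_log (h.norm_pos hx)).symm

theorem continuousOn (h : IsRegularOn α a b I ρ) (hα : 0 < α) : ContinuousOn ρ I := by
  obtain ⟨θ, hθ⟩ := h.argument
  have h1 : ContinuousOn θ I := fun x hx => (hθ x hx).2.1.continuousAt.continuousWithinAt
  have h2 := h.continuousOn_norm hα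
  exact (show ContinuousOn (fun x => (‖ρ x‖ : ℂ) * Complex.exp (Complex.I * θ x)) I by
    fun_prop).congr fun x hx => (hθ x hx).1

/-- The logarithm of the modulus oscillates by at most a ε₀^α ≤ ln 2. The smallness of ε₀ relative
to a is used in this form: densities of standard pairs are comparable to 1/|I|. -/
theorem norm_le_two_mul (h : IsRegularOn α a b I ρ) (hα : 0 < α) {ε₀ : ℝ} (ha : 0 ≤ a)
    (hε : Real.exp (a * ε₀ ^ α) ≤ 2) {x y : ℝ} (hx : x ∈ I) (hy : y ∈ I) (hxy : |x - y| ≤ ε₀) :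
    ‖ρ x‖ ≤ 2 * ‖ρ y‖ := by
  have h1 := (le_abs_self _).trans (h.modulus x hx y hy)
  have h2 : a * |x - y| ^ α ≤ a * ε₀ ^ α := by gcongr
  have hx0 := h.norm_pos hx
  have hy0 := h.norm_pos hy
  rw [← Real.log_div hx0.ne' hy0.ne', Real.log_le_iff_le_exp (div_pos hx0 hy0),
    div_le_iff₀ hy0] at h1
  refine h1.trans ?_
  gcongr
  exact (Real.exp_le_exp.2 h2).trans hε

theorem const_mul (h : IsRegularOn α a b I ρ) {c : ℝ} (hc : 0 < c) :
    IsRegularOn α a b I fun x => (c : ℂ) * ρ x := by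
  have hn : ∀ x, ‖(c : ℂ) * ρ x‖ = c * ‖ρ x‖ := fun x => by
    rw [norm_mul, Complex.norm_real, Real.norm_of_nonneg hc.le]
  obtain ⟨θ, hθ⟩ := h.argument
  refine ⟨fun x hx => mul_ne_zero (by exact_mod_cast hc.ne') (h.ne_zero x hx), fun x hx y hy => ?_,
    θ, fun x hx => ⟨?_, (hθ x hx).2⟩⟩
  · rw [hn, hn, Real.log_mul hc.ne' (h.norm_pos hx).ne', Real.log_mul hc.ne' (h.norm_pos hy).ne',
      add_sub_add_left_eq_sub]
    exact h.modulus x hx y hy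
  · simp only [hn]
    conv_lhs => rw [(hθ x hx).1]
    push_cast
    ring

end IsRegularOn

namespace IsStandardPair

variable {α a b ε₀ : ℝ} {I : Set ℝ} {ρ : ℝ → ℂ}

theorem isRegularOn (h : IsStandardPair α a b ε₀ I ρ) : IsRegularOn α a b I ρ :=
  ⟨h.ne_zero, h.modulus, h.argument⟩

theorem mono (h : IsStandardPair α a b ε₀ I ρ) {a' : ℝ} (ha : a ≤ a') :
    IsStandardPair α a' b ε₀ I ρ :=
  have h' := h.isRegularOn.mono ha
  ⟨h.interval, h.width, h.le_one, h.integrable, h.normalized, h.ne_zero, h'.modulus, h'.argument⟩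

theorem lintegral_enorm (h : IsStandardPair α a b ε₀ I ρ) : ∫⁻ x in I, ‖ρ x‖ₑ = 1 := by
  rw [← ofReal_integral_norm_eq_lintegral_enorm h.integrable, h.normalized, ENNReal.ofReal_one]

theorem measurableSet (h : IsStandardPair α a b ε₀ I ρ) : MeasurableSet I :=
  h.interval.isOpen.measurableSet

theorem enorm_le_two_mul (h : IsStandardPair α a b ε₀ I ρ) (hα : 0 < α) (ha : 0 ≤ a)
    (hε : Real.exp (a * ε₀ ^ α) ≤ 2) {x y : ℝ} (hx : x ∈ I) (hy : y ∈ I) :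
    ‖ρ x‖ₑ ≤ 2 * ‖ρ y‖ₑ := by
  have h1 := h.isRegularOn.norm_le_two_mul hα ha hε hx hy
    (abs_sub_lt_of_volume_lt h.interval h.width hx hy).le
  rw [← ofReal_norm, ← ofReal_norm, show (2 : ℝ≥0∞) = ENNReal.ofReal 2 by norm_num,
    ← ENNReal.ofReal_mul (by norm_num)]
  exact ENNReal.ofReal_le_ofReal h1

theorem enorm_le (h : IsStandardPair α a b ε₀ I ρ) (hα : 0 < α) (ha : 0 ≤ a)
    (hε : Real.exp (a * ε₀ ^ α) ≤ 2) {x : ℝ} (hx : x ∈ I) : ‖ρ x‖ₑ ≤ 2 / volume I := by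
  rw [ENNReal.le_div_iff_mul_le (Or.inl h.interval.volume_ne_zero)
    (Or.inl h.interval.volume_ne_top), ← setLIntegral_const]
  calc ∫⁻ _ in I, ‖ρ x‖ₑ ≤ ∫⁻ y in I, 2 * ‖ρ y‖ₑ :=
        setLIntegral_mono' h.measurableSet fun y hy => h.enorm_le_two_mul hα ha hε hx hy
    _ = 2 := by rw [lintegral_const_mul' _ _ (by simp), h.lintegral_enorm, mul_one]

theorem le_enorm (h : IsStandardPair α a b ε₀ I ρ) (hα : 0 < α) (ha : 0 ≤ a)
    (hε : Real.exp (a * ε₀ ^ α) ≤ 2) {x : ℝ} (hx : x ∈ I) : 1 ≤ 2 * ‖ρ x‖ₑ * volume I := by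
  rw [← h.lintegral_enorm, ← setLIntegral_const]
  exact setLIntegral_mono' h.measurableSet fun y hy => h.enorm_le_two_mul hα ha hε hy hx

end IsStandardPair

namespace WeightedFamily

/-- The sum of the weights divided by the lengths of the intervals; it controls the weight of the
`ε`-boundary. -/
noncomputable def lengthSum (G : WeightedFamily) : ℝ≥0∞ := ∑' j, (G.w j : ℝ≥0∞) / volume (G.I j)

/-- The summands of the density. -/
noncomputable def term (G : WeightedFamily) (j : G.J) (x : ℝ) : ℂ :=
  (G.w j : ℝ) • (G.I j).indicator (G.ρ j) x

variable {α a b ε₀ B : ℝ} {G : WeightedFamily}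

theorem aestronglyMeasurable_term (hG : ∀ j, IsStandardPair α a b ε₀ (G.I j) (G.ρ j)) (j : G.J) :
    AEStronglyMeasurable (G.term j) := by
  exact ((aestronglyMeasurable_indicator_iff (hG j).measurableSet).2 (hG j).integrable.1).const_smul
    (G.w j : ℝ)

theorem lintegral_enorm_term (hG : ∀ j, IsStandardPair α a b ε₀ (G.I j) (G.ρ j)) (j : G.J) :
    ∫⁻ x, ‖G.term j x‖ₑ = G.w j := by
  simp only [term, enorm_smul, enorm_indicator_eq_indicator_enorm]
  rw [lintegral_const_mul' _ _ (by simp), lintegral_indicator (hG j).measurableSet,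
    (hG j).lintegral_enorm, mul_one]
  simp

theorem tsum_lintegral_enorm_term (hG : ∀ j, IsStandardPair α a b ε₀ (G.I j) (G.ρ j)) :
    ∑' j, ∫⁻ x, ‖G.term j x‖ₑ = G.totalWeight :=
  tsum_congr fun j => lintegral_enorm_term hG j

theorem density_eq (G : WeightedFamily) : G.density = fun x => ∑' j, G.term j x := rfl

theorem density_eq_zero (hG : ∀ j, IsStandardPair α a b ε₀ (G.I j) (G.ρ j)) {x : ℝ}
    (hx : x ∉ Ico (0 : ℝ) 1) : G.density x = 0 := by
  have : ∀ j, G.term j x = 0 := fun j => by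
    rw [term, indicator_of_notMem fun h => hx ((hG j).interval.subset_Ico h), smul_zero]
  simp [density_eq, this]

theorem ae_summable_norm_term (hG : ∀ j, IsStandardPair α a b ε₀ (G.I j) (G.ρ j))
    (hw : G.totalWeight ≠ ∞) : ∀ᵐ x, Summable fun j => ‖G.term j x‖ := by
  have := G.countable
  exact ae_summable_norm_of_tsum_lintegral_ne_top (aestronglyMeasurable_term hG)
    ((tsum_lintegral_enorm_term hG).trans_ne hw)

theorem lintegral_density_le (hG : ∀ j, IsStandardPair α a b ε₀ (G.I j) (G.ρ j)) :
    ∫⁻ x, ‖G.density x‖ₑ ≤ G.totalWeight := by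
  have := G.countable
  rcases eq_or_ne G.totalWeight ∞ with hw | hw
  · simp [hw]
  rw [← tsum_lintegral_enorm_term hG,
    ← lintegral_tsum fun j => (aestronglyMeasurable_term hG j).enorm]
  refine lintegral_mono_ae ?_
  filter_upwards [ae_summable_norm_term hG hw] with x hx
  exact enorm_tsum_le_tsum_enorm

/-- The weight of the `ε`-boundary is controlled by `lengthSum`. -/
theorem boundaryWeight_le (hα : 0 < α) (ha : 0 ≤ a) (hε₀ : Real.exp (a * ε₀ ^ α) ≤ 2)
    (hG : ∀ j, IsStandardPair α a b ε₀ (G.I j) (G.ρ j)) {ε : ℝ} (hε : 0 < ε) :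
    G.boundaryWeight ε ≤ ENNReal.ofReal (4 * ε) * G.lengthSum := by
  rw [boundaryWeight, lengthSum, ← ENNReal.tsum_mul_left]
  refine ENNReal.tsum_le_tsum fun j => ?_
  obtain ⟨l, r, hl, hlr, hr, hI⟩ := (hG j).interval
  have hsub : epsBoundary ε (G.I j) ⊆ G.I j ∩ (Ioo (l - ε) (l + ε) ∪ Ioo (r - ε) (r + ε)) := by
    intro x hx
    refine ⟨hx.1, ?_⟩
    have h2 := hx.2
    rw [hI, frontier_Ioo hlr, Metric.mem_thickening_iff] at h2
    obtain ⟨z, hz, hxz⟩ := h2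
    rw [Real.dist_eq, abs_lt] at hxz
    rcases hz with rfl | rfl
    · exact Or.inl ⟨by linarith, by linarith⟩
    · exact Or.inr ⟨by linarith, by linarith⟩
  have hsub2 : epsBoundary ε (G.I j) ⊆ Ioo l (l + ε) ∪ Ioo (r - ε) r := by
    intro x hx
    obtain ⟨h1, h2⟩ := hsub hx
    rw [hI] at h1
    rcases h2 with h2 | h2
    · exact Or.inl ⟨h1.1, h2.2⟩
    · exact Or.inr ⟨h2.1, h1.2⟩
  have hvol : volume (epsBoundary ε (G.I j)) ≤ ENNReal.ofReal (2 * ε) := by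
    refine (measure_mono hsub2).trans ((measure_union_le _ _).trans ?_)
    rw [Real.volume_Ioo, Real.volume_Ioo, ← ENNReal.ofReal_add (by linarith) (by linarith)]
    exact ENNReal.ofReal_le_ofReal (by linarith)
  -- The density is at most 2/|I|, the boundary strip has measure at most 2ε; this is the constant
  -- 4.
  have h1 : ∫⁻ x in epsBoundary ε (G.I j), ‖G.ρ j x‖ₑ ≤
      2 / volume (G.I j) * ENNReal.ofReal (2 * ε) := by
    refine le_trans (setLIntegral_mono' (g := fun _ => 2 / volume (G.I j)) ?_ fun x hx => ?_) ?_
    · exact (hG j).measurableSet.inter Metric.isOpen_thickening.measurableSet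
    · exact (hG j).enorm_le hα ha hε₀ hx.1
    · rw [setLIntegral_const]; gcongr
  calc (G.w j : ℝ≥0∞) * ∫⁻ x in epsBoundary ε (G.I j), ‖G.ρ j x‖ₑ
      ≤ G.w j * (2 / volume (G.I j) * ENNReal.ofReal (2 * ε)) := by gcongr
    _ = ENNReal.ofReal (4 * ε) * (G.w j / volume (G.I j)) := by
      rw [show 4 * ε = 2 * (2 * ε) by ring, ENNReal.ofReal_mul (p := 2) (by norm_num)]
      simp only [div_eq_mul_inv]
      norm_num
      ring

/-- `lengthSum` is finite for standard families. -/
theorem IsStandard.lengthSum_le (hα : 0 < α) (ha : 0 ≤ a) (h0 : 0 < ε₀)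
    (hε₀ : Real.exp (a * ε₀ ^ α) ≤ 2) (hG : G.IsStandard α a b B ε₀) :
    G.lengthSum ≤ ENNReal.ofReal (2 * B) := by
  rw [lengthSum, ENNReal.tsum_eq_iSup_sum]
  refine iSup_le fun s => ?_
  choose l r hl hlr hr hI using fun j => (hG.pair j).interval
  -- The lengths may accumulate at 0, so only finite partial sums are bounded. If ε is below all
  -- lengths that occur, the left strip of width ε lies in the ε-boundary and carries mass at least
  -- ε/(2|I_j|); dividing the boundary condition by ε yields the bound 2B.
  obtain ⟨ε, hε, hεε, hεs⟩ : ∃ ε : ℝ, 0 < ε ∧ ε < ε₀ ∧ ∀ j ∈ s, ε ≤ r j - l j := by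
    rcases s.eq_empty_or_nonempty with rfl | hs
    · exact ⟨ε₀ / 2, by linarith, by linarith, by simp⟩
    · refine ⟨min (ε₀ / 2) (s.inf' hs fun j => r j - l j), lt_min (by linarith) ?_, ?_, ?_⟩
      · rw [Finset.lt_inf'_iff]
        exact fun j _ => by linarith [hlr j]
      · exact (min_le_left _ _).trans_lt (by linarith)
      · exact fun j hj => (min_le_right _ _).trans (Finset.inf'_le _ hj)
  have h1 : ENNReal.ofReal ε * ∑ j ∈ s, (G.w j : ℝ≥0∞) / volume (G.I j) ≤
      2 * G.boundaryWeight ε := by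
    rw [Finset.mul_sum, boundaryWeight, ← ENNReal.tsum_mul_left]
    refine le_trans (Finset.sum_le_sum fun j hj => ?_) (ENNReal.sum_le_tsum s)
    have hsub : Ioo (l j) (l j + ε) ⊆ epsBoundary ε (G.I j) := by
      intro x hx
      refine ⟨by rw [hI]; exact ⟨hx.1, by linarith [hx.2, hεs j hj]⟩, ?_⟩
      rw [hI, frontier_Ioo (hlr j), Metric.mem_thickening_iff]
      refine ⟨l j, Or.inl rfl, ?_⟩
      rw [Real.dist_eq, abs_lt]
      constructor <;> linarith [hx.1, hx.2]
    have h2 : ENNReal.ofReal ε / volume (G.I j) ≤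
        2 * ∫⁻ x in epsBoundary ε (G.I j), ‖G.ρ j x‖ₑ := by
      rw [← lintegral_const_mul' _ _ (by simp)]
      refine le_trans ?_ (lintegral_mono_set hsub)
      have h3 : ENNReal.ofReal ε / volume (G.I j) =
          ∫⁻ _ in Ioo (l j) (l j + ε), 1 / volume (G.I j) := by
        rw [setLIntegral_const, Real.volume_Ioo, add_sub_cancel_left, ENNReal.mul_comm_div, one_mul]
      rw [h3]
      refine setLIntegral_mono' measurableSet_Ioo fun x hx => ?_
      exact ENNReal.div_le_of_le_mul ((hG.pair j).le_enorm hα ha hε₀ (hsub hx).1)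
    calc ENNReal.ofReal ε * (G.w j / volume (G.I j))
        = G.w j * (ENNReal.ofReal ε / volume (G.I j)) := by
          simp only [div_eq_mul_inv]; ring
      _ ≤ G.w j * (2 * ∫⁻ x in epsBoundary ε (G.I j), ‖G.ρ j x‖ₑ) := by gcongr
      _ = _ := by ring
  have h2 := h1.trans (mul_le_mul_right (hG.boundary ε hε hεε) 2)
  have h3 : 2 * ENNReal.ofReal (B * ε) = ENNReal.ofReal ε * ENNReal.ofReal (2 * B) := by
    rw [← ENNReal.ofReal_mul hε.le, show (2 : ℝ≥0∞) = ENNReal.ofReal 2 by norm_num,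
      ← ENNReal.ofReal_mul (by norm_num)]
    ring_nf
  rw [h3] at h2
  exact (ENNReal.mul_le_mul_iff_right (by simpa using hε) (by simp)).1 h2

end WeightedFamily

/-! ### Functions that decompose into standard pairs -/

/-- `g` is the density of a countable family of standard pairs of total weight at most `W` and with
`lengthSum` at most `Q`. -/
def Decomposes (α a b ε₀ : ℝ) (g : ℝ → ℂ) (W Q : ℝ≥0∞) : Prop :=
  ∃ G : WeightedFamily, (∀ j, IsStandardPair α a b ε₀ (G.I j) (G.ρ j)) ∧ G.totalWeight ≤ W ∧
    G.lengthSum ≤ Q ∧ g =ᵐ[volume] G.density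

theorem setLIntegral_ne_zero_of_ne_zero {X : Type*} [MeasurableSpace X] {μ : Measure X} {s : Set X}
    (hs : MeasurableSet s) (h0 : μ s ≠ 0) {g : X → ℝ≥0∞} (hg : AEMeasurable g (μ.restrict s))
    (hg' : ∀ x ∈ s, g x ≠ 0) : ∫⁻ x in s, g x ∂μ ≠ 0 := by
  intro h
  rw [lintegral_eq_zero_iff' hg, EventuallyEq, ae_restrict_iff' hs] at h
  refine h0 (measure_mono_null (fun x hx => ?_) h)
  simpa [hx] using hg' x hx

theorem indicator_Ioo_add_indicator_Ioo {E : Type*} [AddMonoid E] {g : ℝ → E} {p q r x : ℝ}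
    (hpq : p ≤ q) (hqr : q ≤ r) (hx : x ≠ q) :
    indicator (Ioo p q) g x + indicator (Ioo q r) g x = indicator (Ioo p r) g x := by
  rcases lt_or_gt_of_ne hx with h | h
  · rw [indicator_of_notMem (s := Ioo q r) (fun h' => absurd h'.1 (not_lt.2 h.le)), add_zero]
    refine indicator_eq_indicator ?_ rfl
    exact ⟨fun h' => ⟨h'.1, h.trans_le hqr⟩, fun h' => ⟨h'.1, h⟩⟩
  · rw [indicator_of_notMem (s := Ioo p q) (fun h' => absurd h'.2 (not_lt.2 h.le)), zero_add]
    refine indicator_eq_indicator ?_ rfl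
    exact ⟨fun h' => ⟨hpq.trans_lt h, h'.2⟩, fun h' => ⟨h, h'.2⟩⟩

theorem IsRegularOn.integrableOn {α a b R : ℝ} {I : Set ℝ} {p : ℝ → ℂ} (h : IsRegularOn α a b I p)
    (hα : 0 < α) (hI : IsOpenInterval I) (hR : ∀ x ∈ I, ‖p x‖ ≤ R) : IntegrableOn p I := by
  refine ⟨(h.continuousOn hα).aestronglyMeasurable hI.isOpen.measurableSet,
    .restrict_of_bounded (C := R) hI.volume_ne_top.lt_top ?_⟩
  exact (ae_restrict_iff' hI.isOpen.measurableSet).2 (ae_of_all _ hR)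

namespace Decomposes

variable {α a b ε₀ : ℝ} {g : ℝ → ℂ} {W Q : ℝ≥0∞}

theorem congr_ae (h : Decomposes α a b ε₀ g W Q) {g' : ℝ → ℂ} (hg : g' =ᵐ[volume] g) :
    Decomposes α a b ε₀ g' W Q := by
  obtain ⟨G, h1, h2, h3, h4⟩ := h
  exact ⟨G, h1, h2, h3, hg.trans h4⟩

theorem mono (h : Decomposes α a b ε₀ g W Q) {a' : ℝ} {W' Q' : ℝ≥0∞} (ha : a ≤ a') (hW : W ≤ W')
    (hQ : Q ≤ Q') : Decomposes α a' b ε₀ g W' Q' := by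
  obtain ⟨G, h1, h2, h3, h4⟩ := h
  exact ⟨G, fun j => (h1 j).mono ha, h2.trans hW, h3.trans hQ, h4⟩

theorem lintegral_le (h : Decomposes α a b ε₀ g W Q) : ∫⁻ x, ‖g x‖ₑ ≤ W := by
  obtain ⟨G, h1, h2, -, h4⟩ := h
  refine le_trans (le_of_eq (lintegral_congr_ae ?_)) ((G.lintegral_density_le h1).trans h2)
  filter_upwards [h4] with x hx using by rw [hx]

theorem zero : Decomposes α a b ε₀ (fun _ => 0) 0 0 := by
  refine ⟨⟨Empty, inferInstance, fun j => j.elim, fun j => j.elim, fun j => j.elim⟩,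
    fun j => j.elim, ?_, ?_, ?_⟩
  · simp [WeightedFamily.totalWeight]
  · simp [WeightedFamily.lengthSum]
  · refine ae_of_all _ fun x => ?_
    simp [WeightedFamily.density]

theorem tsum {κ : Type} [Countable κ] {g : κ → ℝ → ℂ} {W Q : κ → ℝ≥0∞}
    (h : ∀ i, Decomposes α a b ε₀ (g i) (W i) (Q i)) (hW : ∑' i, W i ≠ ∞) :
    Decomposes α a b ε₀ (fun x => ∑' i, g i x) (∑' i, W i) (∑' i, Q i) := by
  choose G h1 h2 h3 h4 using h
  have : ∀ i, Countable (G i).J := fun i => (G i).countable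
  let H : WeightedFamily := ⟨Σ i, (G i).J, inferInstance, fun k => (G k.1).I k.2,
    fun k => (G k.1).ρ k.2, fun k => (G k.1).w k.2⟩
  have hH : ∀ k : H.J, IsStandardPair α a b ε₀ (H.I k) (H.ρ k) := fun k => h1 k.1 k.2
  have hw : H.totalWeight ≤ ∑' i, W i := by
    refine le_trans (le_of_eq (ENNReal.tsum_sigma' _)) (ENNReal.tsum_le_tsum fun i => h2 i)
  refine ⟨H, hH, hw, ?_, ?_⟩
  · exact le_trans (le_of_eq (ENNReal.tsum_sigma' _)) (ENNReal.tsum_le_tsum fun i => h3 i)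
  -- Finite total weight gives absolute convergence almost everywhere, which permits regrouping the
  -- double sum.
  · filter_upwards [H.ae_summable_norm_term hH (ne_top_of_le_ne_top hW hw), ae_all_iff.2 h4]
      with x hx hx'
    exact (tsum_congr fun i => hx' i).trans hx.of_norm.tsum_sigma.symm

theorem add {g₁ g₂ : ℝ → ℂ} {W₁ W₂ Q₁ Q₂ : ℝ≥0∞} (h₁ : Decomposes α a b ε₀ g₁ W₁ Q₁)
    (h₂ : Decomposes α a b ε₀ g₂ W₂ Q₂) (hW₁ : W₁ ≠ ∞) (hW₂ : W₂ ≠ ∞) :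
    Decomposes α a b ε₀ (fun x => g₁ x + g₂ x) (W₁ + W₂) (Q₁ + Q₂) := by
  have := tsum (κ := Bool) (g := fun i => bif i then g₂ else g₁) (W := fun i => bif i then W₂ else W₁)
    (Q := fun i => bif i then Q₂ else Q₁) (α := α) (a := a) (b := b) (ε₀ := ε₀)
    (fun i => by cases i <;> assumption) (by
      rw [tsum_bool]; exact ENNReal.add_ne_top.2 ⟨hW₁, hW₂⟩)
  simpa only [tsum_bool, cond_true, cond_false] using this

theorem const_mul (h : Decomposes α a b ε₀ g W Q) (c : ℝ≥0) :
    Decomposes α a b ε₀ (fun x => ((c : ℝ) : ℂ) * g x) (c * W) (c * Q) := by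
  obtain ⟨G, h1, h2, h3, h4⟩ := h
  refine ⟨⟨G.J, G.countable, G.I, G.ρ, fun j => c * G.w j⟩, h1, ?_, ?_, ?_⟩
  · refine le_trans (le_of_eq ?_) (mul_le_mul_right h2 _)
    simp only [WeightedFamily.totalWeight, ENNReal.coe_mul]
    exact ENNReal.tsum_mul_left
  · refine le_trans (le_of_eq ?_) (mul_le_mul_right h3 _)
    simp only [WeightedFamily.lengthSum, ENNReal.coe_mul, mul_div_assoc]
    exact ENNReal.tsum_mul_left
  · filter_upwards [h4] with x hx
    rw [hx]
    simp only [WeightedFamily.density, NNReal.coe_mul, mul_smul]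
    rw [← tsum_mul_left]
    exact tsum_congr fun j => by simp

/-- The restriction of a regular function to an interval. -/
theorem single {p : ℝ → ℂ} {l r R : ℝ} (hα : 0 < α) (hl : 0 ≤ l) (hr : r ≤ 1) (hlr : r - l < ε₀)
    (hε₀ : 0 < ε₀) (hε₁ : ε₀ ≤ 1) (hp : IsRegularOn α a b (Ioo l r) p)
    (hR : ∀ x ∈ Ioo l r, ‖p x‖ ≤ R) :
    Decomposes α a b ε₀ (indicator (Ioo l r) p) (∫⁻ x in Ioo l r, ‖p x‖ₑ) (ENNReal.ofReal R) := by
  -- Empty intervals are admitted so that subdivisions with degenerate parts need no case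
  -- distinction.
  rcases le_or_gt r l with hle | hlt
  · rw [Ioo_eq_empty (not_lt.2 hle), indicator_empty]
    exact zero.mono le_rfl zero_le zero_le
  have hI : IsOpenInterval (Ioo l r) := ⟨l, r, hl, hlt, hr, rfl⟩
  have hint := hp.integrableOn hα hI hR
  set z := ∫ x in Ioo l r, ‖p x‖ with hz
  have hzl : ∫⁻ x in Ioo l r, ‖p x‖ₑ = ENNReal.ofReal z :=
    (ofReal_integral_norm_eq_lintegral_enorm hint).symm
  have hz0 : 0 < z := by
    have := setLIntegral_ne_zero_of_ne_zero measurableSet_Ioo hI.volume_ne_zero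
      hint.1.aemeasurable.enorm (fun x hx => enorm_ne_zero.2 (hp.ne_zero x hx))
    rwa [hzl, ne_eq, ENNReal.ofReal_eq_zero, not_le] at this
  let G : WeightedFamily := ⟨Unit, inferInstance, fun _ => Ioo l r,
    fun _ x => ((z⁻¹ : ℝ) : ℂ) * p x, fun _ => z.toNNReal⟩
  have hq := hp.const_mul (inv_pos.2 hz0)
  refine ⟨G, fun _ => ⟨hI, ?_, hε₁, hint.const_mul _, ?_, hq.ne_zero, hq.modulus, hq.argument⟩,
    ?_, ?_, ae_of_all _ fun x => ?_⟩
  · rw [Real.volume_Ioo]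
    exact (ENNReal.ofReal_lt_ofReal_iff hε₀).2 hlr
  · simp only [G, norm_mul, Complex.norm_real, Real.norm_of_nonneg (inv_pos.2 hz0).le]
    rw [integral_const_mul, ← hz, inv_mul_cancel₀ hz0.ne']
  · simp [WeightedFamily.totalWeight, G, hzl, ENNReal.ofReal]
  · simp only [WeightedFamily.lengthSum, G, tsum_fintype, Finset.univ_unique, Finset.sum_singleton]
    refine ENNReal.div_le_of_le_mul ?_
    change ENNReal.ofReal z ≤ _
    rw [← hzl, ← setLIntegral_const]
    refine setLIntegral_mono' measurableSet_Ioo fun x hx => ?_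
    rw [← ofReal_norm]
    exact ENNReal.ofReal_le_ofReal (hR x hx)
  · simp only [WeightedFamily.density, G, tsum_fintype, Finset.univ_unique, Finset.sum_singleton]
    by_cases hx : x ∈ Ioo l r
    · rw [indicator_of_mem hx, indicator_of_mem hx, Real.coe_toNNReal _ hz0.le, Complex.real_smul,
        ← mul_assoc, ← Complex.ofReal_mul, mul_inv_cancel₀ hz0.ne', Complex.ofReal_one, one_mul]
    · rw [indicator_of_notMem hx, indicator_of_notMem hx, smul_zero]

/-- Functions on adjacent intervals can be decomposed separately. -/
theorem glue {p q r : ℝ} {W₁ W₂ Q₁ Q₂ : ℝ≥0∞} (hpq : p ≤ q) (hqr : q ≤ r)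
    (h₁ : Decomposes α a b ε₀ (indicator (Ioo p q) g) W₁ Q₁)
    (h₂ : Decomposes α a b ε₀ (indicator (Ioo q r) g) W₂ Q₂) (hW₁ : W₁ ≠ ∞) (hW₂ : W₂ ≠ ∞) :
    Decomposes α a b ε₀ (indicator (Ioo p r) g) (W₁ + W₂) (Q₁ + Q₂) := by
  refine (h₁.add h₂ hW₁ hW₂).congr_ae ?_
  filter_upwards [Measure.ae_ne volume q] with x hx
  rw [← indicator_Ioo_add_indicator_Ioo hpq hqr hx]

end Decomposes

/-! ### Cutting an interval into pieces -/

/-- The equidistant partition of an interval. -/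
theorem exists_mem_Ioo_or_eq {l r : ℝ} {N : ℕ} (hN : 0 < N) {x : ℝ} (hx : x ∈ Ioo l r) :
    (∃ i < N, x ∈ Ioo (l + i * ((r - l) / N)) (l + (i + 1) * ((r - l) / N))) ∨
      ∃ i < N, x = l + i * ((r - l) / N) := by
  have hN' : (0 : ℝ) < N := by exact_mod_cast hN
  have hL : 0 < (r - l) / N := div_pos (by linarith [hx.1, hx.2]) hN'
  set L := (r - l) / N with hLdef
  have hNL : N * L = r - l := by rw [hLdef]; field_simp
  have hq : 0 ≤ (x - l) / L := div_nonneg (by linarith [hx.1]) hL.le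
  have h1 := Nat.floor_le hq
  have h2 := Nat.lt_floor_add_one ((x - l) / L)
  rw [le_div_iff₀ hL] at h1
  rw [div_lt_iff₀ hL] at h2
  have h3 : ⌊(x - l) / L⌋₊ < N := by
    rw [Nat.floor_lt hq, div_lt_iff₀ hL]
    linarith [hx.2]
  rcases h1.eq_or_lt with h | h
  · exact Or.inr ⟨_, h3, by linarith⟩
  · exact Or.inl ⟨_, h3, by linarith, by linarith⟩

namespace WeightedFamily

theorem exists_isCutting {ε₀ : ℝ} (hε₀ : 0 < ε₀) {V : Set ℝ} (hV : V = ∅ ∨ IsOpenInterval V) :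
    ∃ P, IsCutting ε₀ V P := by
  classical
  rcases hV with rfl | hV
  · exact ⟨∅, fun _ => rfl, fun h => absurd h (by simp), fun h => absurd h (by simp)⟩
  rcases lt_or_ge (volume V) (ENNReal.ofReal ε₀) with hlt | hge
  · exact ⟨{V}, fun h => absurd h hV.nonempty.ne_empty, fun _ _ => rfl,
      fun _ h => absurd hlt (not_lt.2 h)⟩
  obtain ⟨l, r, hl, hlr, hr, rfl⟩ := hV
  rw [Real.volume_Ioo, ENNReal.ofReal_le_ofReal_iff (by linarith)] at hge
  -- N > |V|/ε₀ makes the pieces shorter than ε₀. As |V| ≥ ε₀, also N ≤ 2|V|/ε₀, so the pieces have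
  -- length at least ε₀/2 ≥ ε₀/3.
  set N := ⌊(r - l) / ε₀⌋₊ + 1 with hN
  have hN0 : 0 < N := Nat.succ_pos _
  have hN' : (0 : ℝ) < N := by exact_mod_cast hN0
  have hq : 0 ≤ (r - l) / ε₀ := div_nonneg (by linarith) hε₀.le
  set L := (r - l) / N with hLdef
  have hNL : N * L = r - l := by rw [hLdef]; field_simp
  have hL : 0 < L := div_pos (by linarith) hN'
  have hL1 : L < ε₀ := by
    have h2 := Nat.lt_floor_add_one ((r - l) / ε₀)
    rw [hLdef, div_lt_iff₀ hN', mul_comm, ← div_lt_iff₀ hε₀, hN]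
    push_cast
    exact h2
  have hL2 : ε₀ / 3 ≤ L := by
    have h1 := Nat.floor_le hq
    rw [le_div_iff₀ hε₀] at h1
    rw [hLdef, le_div_iff₀ hN', hN]
    push_cast
    nlinarith
  let K : ℕ → Set ℝ := fun i => Ioo (l + i * L) (l + (i + 1) * L)
  have hvol : ∀ i, volume (K i) = ENNReal.ofReal L := fun i => by
    simp only [K]; rw [Real.volume_Ioo]; congr 1; ring
  have hsubK : ∀ i < N, l + (i + 1) * L ≤ r := by
    intro i hi
    have : ((i : ℝ) + 1) ≤ N := by exact_mod_cast hi
    nlinarith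
  refine ⟨(Finset.range N).image K, fun h => absurd h (nonempty_Ioo.2 hlr).ne_empty,
    fun _ h => absurd h (not_lt.2 ?_), fun _ _ => ⟨?_, ?_, ?_⟩⟩
  · rw [Real.volume_Ioo]; exact ENNReal.ofReal_le_ofReal hge
  · intro U hU
    obtain ⟨i, hi, rfl⟩ := Finset.mem_image.1 hU
    have hi := hsubK i (Finset.mem_range.1 hi)
    have hi0 : 0 ≤ (i : ℝ) * L := by positivity
    refine ⟨⟨_, _, by linarith, by linarith, by linarith, rfl⟩,
      Ioo_subset_Ioo (by linarith) hi, ?_, ?_⟩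
    · rw [hvol]; exact ENNReal.ofReal_le_ofReal hL2
    · rw [hvol]; exact (ENNReal.ofReal_lt_ofReal_iff hε₀).2 hL1
  · intro U hU U' hU' hne
    obtain ⟨i, -, rfl⟩ := Finset.mem_image.1 hU
    obtain ⟨i', -, rfl⟩ := Finset.mem_image.1 hU'
    have key : ∀ i i' : ℕ, i < i' → Disjoint (K i) (K i') := by
      intro i i' h
      refine Set.disjoint_left.2 fun x hx hx' => ?_
      have : ((i : ℝ) + 1) ≤ i' := by exact_mod_cast h
      have h1 := hx.2
      have h2 := hx'.1
      nlinarith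
    rcases lt_trichotomy i i' with h | rfl | h
    · exact key _ _ h
    · exact absurd rfl hne
    · exact (key _ _ h).symm
  · refine ((finite_lt_nat N).image fun i : ℕ => l + i * L).subset fun x hx => ?_
    rcases exists_mem_Ioo_or_eq hN0 hx.1 with ⟨i, hi, h⟩ | ⟨i, hi, h⟩
    · exact absurd (mem_iUnion₂.2 ⟨K i, Finset.mem_image_of_mem _ (Finset.mem_range.2 hi), h⟩) hx.2
    · exact ⟨i, hi, h.symm⟩

theorem IsCutting.piece {ε₀ : ℝ} {V : Set ℝ} {P : Finset (Set ℝ)} (h : IsCutting ε₀ V P)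
    (hV : V = ∅ ∨ IsOpenInterval V) {U : Set ℝ} (hU : U ∈ P) :
    IsOpenInterval U ∧ U ⊆ V ∧ volume U < ENNReal.ofReal ε₀ := by
  rcases hV with rfl | hV
  · rw [h.1 rfl] at hU
    exact absurd hU (by simp)
  rcases lt_or_ge (volume V) (ENNReal.ofReal ε₀) with hlt | hge
  · rw [h.2.1 hV.nonempty hlt, Finset.mem_singleton] at hU
    subst hU
    exact ⟨hV, Subset.rfl, hlt⟩
  · obtain ⟨h1, h2, -, h3⟩ := (h.2.2 hV.nonempty hge).1 U hU
    exact ⟨h1, h2, h3⟩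

theorem IsCutting.disjoint {ε₀ : ℝ} {V : Set ℝ} {P : Finset (Set ℝ)} (h : IsCutting ε₀ V P)
    {U U' : Set ℝ} (hU : U ∈ P) (hU' : U' ∈ P) (hne : U ≠ U') : Disjoint U U' := by
  rcases V.eq_empty_or_nonempty with hV | hV
  · rw [h.1 hV] at hU
    exact absurd hU (by simp)
  rcases lt_or_ge (volume V) (ENNReal.ofReal ε₀) with hlt | hge
  · rw [h.2.1 hV hlt, Finset.mem_singleton] at hU hU'
    exact absurd (hU.trans hU'.symm) hne
  · exact (h.2.2 hV hge).2.1 U hU U' hU' hne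

theorem IsCutting.finite_diff {ε₀ : ℝ} {V : Set ℝ} {P : Finset (Set ℝ)} (h : IsCutting ε₀ V P) :
    (V \ ⋃ U ∈ P, U).Finite := by
  rcases V.eq_empty_or_nonempty with rfl | hV
  · simp
  rcases lt_or_ge (volume V) (ENNReal.ofReal ε₀) with hlt | hge
  · rw [h.2.1 hV hlt]
    simp
  · exact (h.2.2 hV hge).2.2

end WeightedFamily

theorem enorm_coe_coe_nnreal (r : ℝ≥0) : ‖((r : ℝ) : ℂ)‖ₑ = r := by
  rw [← ofReal_norm, Complex.norm_real, Real.norm_of_nonneg r.coe_nonneg,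
    ENNReal.ofReal_coe_nnreal]

/-! ### Push-forward along branches and the density of an iterate -/

namespace SkewProduct

variable {S : SkewProduct} {α lam D Cτ : ℝ} {b : ℝ}

/-- The contribution of the inverse branch `h` to the transfer operator of `f^n`. -/
noncomputable def Branch.push {n : ℕ} (h : S.Branch n) (b : ℝ) (ρ : ℝ → ℂ) (x : ℝ) : ℂ :=
  Complex.exp (Complex.I * b * birkhoffSum S.f S.τ n (h.map x)) * ρ (h.map x) * |deriv h.map x|

theorem Branch.norm_push {n : ℕ} (h : S.Branch n) (b : ℝ) (ρ : ℝ → ℂ) (x : ℝ) :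
    ‖h.push b ρ x‖ = ‖ρ (h.map x)‖ * |deriv h.map x| := by
  rw [push, norm_mul, norm_mul, norm_exp_I_mul_mul, one_mul, Complex.norm_real, Real.norm_eq_abs,
    abs_abs]

theorem Branch.enorm_push {n : ℕ} (h : S.Branch n) (b : ℝ) (ρ : ℝ → ℂ) (x : ℝ) :
    ‖h.push b ρ x‖ₑ = ENNReal.ofReal |deriv h.map x| * ‖ρ (h.map x)‖ₑ := by
  rw [← ofReal_norm, norm_push, ENNReal.ofReal_mul (norm_nonneg _), ofReal_norm, mul_comm]

namespace IsAdmissible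

variable (hS : S.IsAdmissible α lam D Cτ)
include hS

theorem D_add_Cτ_nonneg {n : ℕ} (h : S.Branch n) : 0 ≤ D ∧ 0 ≤ Cτ := by
  obtain ⟨x, hx⟩ := h.cell_nonempty
  exact ⟨hS.D_nonneg, hS.Cτ_nonneg_of_mem (h.cell_subset_reg hx)⟩

/-- The contraction of the regularity constants under inverse branches. -/
theorem isRegularOn_push {n : ℕ} (h : S.Branch n) {E I : Set ℝ} {ρ : ℝ → ℂ} {a a' : ℝ}
    (hE : E ⊆ h.dom) (hEI : MapsTo h.map E I) (hρ : IsRegularOn α a b I ρ) (ha : 0 ≤ a)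
    (ha' : a * Real.exp (-(α * (lam * n))) + (D + Cτ) ≤ a') :
    IsRegularOn α a' b E (h.push b ρ) := by
  obtain ⟨hD, hC⟩ := hS.D_add_Cτ_nonneg h
  have hα := hS.alpha_pos
  obtain ⟨θ, hθ⟩ := hρ.argument
  have habs : ∀ x ∈ E, 0 < |deriv h.map x| := fun x hx => abs_pos.2 (hS.deriv_map_ne_zero (hE hx))
  refine ⟨fun x hx => ?_, fun x hx y hy => ?_,
    fun x => b * birkhoffSum S.f S.τ n (h.map x) + θ (h.map x), fun x hx => ⟨?_, ?_⟩⟩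
  · exact norm_pos_iff.1 (by
      rw [h.norm_push]; exact mul_pos (hρ.norm_pos (hEI hx)) (habs x hx))
  · rw [h.norm_push, h.norm_push, Real.log_mul (hρ.norm_pos (hEI hx)).ne' (habs x hx).ne',
      Real.log_mul (hρ.norm_pos (hEI hy)).ne' (habs y hy).ne', add_sub_add_comm]
    refine (abs_add_le _ _).trans ?_
    have h1 := hρ.modulus _ (hEI hx) _ (hEI hy)
    have h2 := hS.abs_log_deriv_map_sub_le (hE hx) (hE hy)
    have h3 : |h.map x - h.map y| ^ α ≤ Real.exp (-(α * (lam * n))) * |x - y| ^ α := by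
      calc |h.map x - h.map y| ^ α ≤ (Real.exp (-(lam * n)) * |x - y|) ^ α := by
            gcongr
            exact hS.abs_map_sub_le (hE hx) (hE hy)
        _ = _ := by
            rw [Real.mul_rpow (Real.exp_pos _).le (abs_nonneg _), ← Real.exp_mul]
            ring_nf
    calc _ ≤ a * (Real.exp (-(α * (lam * n))) * |x - y| ^ α) + D * |x - y| ^ α := by
          refine add_le_add (h1.trans ?_) h2
          gcongr
      _ = (a * Real.exp (-(α * (lam * n))) + D) * |x - y| ^ α := by ring
      _ ≤ a' * |x - y| ^ α := by
          gcongr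
          linarith
  · rw [h.norm_push]
    conv_lhs => rw [Branch.push, (hθ _ (hEI hx)).1]
    rw [Complex.ofReal_mul]
    push_cast
    rw [mul_add, Complex.exp_add]
    ring_nf
  · have d1 := (hS.hasDerivAt_birkhoffSum_map (hE hx)).const_mul b
    have d2 := (hθ _ (hEI hx)).2.1.hasDerivAt.comp x
      (hS.hasDerivAt_map (hE hx)).differentiableAt.hasDerivAt
    have d3 := d1.add d2
    refine ⟨d3.differentiableAt, ?_⟩
    have hd : deriv (fun x => b * birkhoffSum S.f S.τ n (h.map x) + θ (h.map x)) x = _ := d3.deriv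
    rw [hd]
    have h1 : |S.slope n (h.map x)| ≤ Cτ := hS.abs_slope_le (Branch.map_mem_reg (hE hx))
    have h2 := (hθ _ (hEI hx)).2.2
    have h3 := hS.abs_deriv_map_le (hE hx)
    -- As α < 1, the contraction rate of the Hölder modulus is the slower one, so the single
    -- condition on a' serves for modulus and argument.
    have h4 : Real.exp (-(lam * n)) ≤ Real.exp (-(α * (lam * n))) := by
      apply Real.exp_le_exp.2
      have : 0 ≤ lam * n := mul_nonneg hS.lam_pos.le (Nat.cast_nonneg n)
      nlinarith [hS.alpha_lt_one]
    calc |b * S.slope n (h.map x) + deriv θ (h.map x) * deriv h.map x|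
        ≤ |b| * |S.slope n (h.map x)| + |deriv θ (h.map x)| * |deriv h.map x| := by
          rw [← abs_mul, ← abs_mul]; exact abs_add_le _ _
      _ ≤ |b| * Cτ + a * |b| * Real.exp (-(α * (lam * n))) := by
          gcongr
          exact h3.trans h4
      _ = (a * Real.exp (-(α * (lam * n))) + Cτ) * |b| := by ring
      _ ≤ a' * |b| := by
          gcongr
          linarith

theorem lintegral_image_map {n : ℕ} (h : S.Branch n) {E : Set ℝ} (hE : MeasurableSet E)
    (hE' : E ⊆ h.dom) (ρ : ℝ → ℂ) :
    ∫⁻ x in h.map '' E, ‖ρ x‖ₑ = ∫⁻ x in E, ‖h.push b ρ x‖ₑ := by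
  rw [lintegral_image_eq_lintegral_abs_deriv_mul hE (fun x hx =>
    (hS.hasDerivAt_map (hE' hx)).differentiableAt.hasDerivAt.hasDerivWithinAt)
    (Branch.map_injOn.mono hE')]
  simp only [h.enorm_push]

theorem measurableSet_image_map {n : ℕ} (h : S.Branch n) {E : Set ℝ} (hE : MeasurableSet E)
    (hE' : E ⊆ h.dom) : MeasurableSet (h.map '' E) :=
  hE.image_of_continuousOn_injOn ((hS.continuousOn_map h).mono hE') (Branch.map_injOn.mono hE')

end IsAdmissible

/-- The supremum of `|h'|` for an inverse branch `h`. -/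
noncomputable def Branch.supDeriv {n : ℕ} (h : S.Branch n) : ℝ≥0∞ :=
  ⨆ x ∈ h.dom, ENNReal.ofReal |deriv h.map x|

theorem Branch.le_supDeriv {n : ℕ} {h : S.Branch n} {x : ℝ} (hx : x ∈ h.dom) :
    ENNReal.ofReal |deriv h.map x| ≤ h.supDeriv := le_iSup₂ (f := fun x (_ : x ∈ h.dom) =>
      ENNReal.ofReal |deriv h.map x|) x hx

theorem IsAdmissible.supDeriv_le (hS : S.IsAdmissible α lam D Cτ) {n : ℕ} (h : S.Branch n) :
    h.supDeriv ≤ ENNReal.ofReal (Real.exp (-(lam * n))) :=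
  iSup₂_le fun _ hx => ENNReal.ofReal_le_ofReal (hS.abs_deriv_map_le hx)

end SkewProduct

namespace WeightedFamily

open SkewProduct

variable {S : SkewProduct} {α lam D Cτ : ℝ} {b a a' ε₀ : ℝ} {n : ℕ} {G : WeightedFamily}

section

variable (hS : S.IsAdmissible α lam D Cτ)
include hS

theorem image_eq_empty_or_isOpenInterval {I : Set ℝ} (hI : IsOpenInterval I) (h : S.Branch n) :
    S.f^[n] '' (I ∩ h.cell) = ∅ ∨ IsOpenInterval (S.f^[n] '' (I ∩ h.cell)) := by
  rcases (I ∩ h.cell).eq_empty_or_nonempty with h0 | h0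
  · left; rw [h0, image_empty]
  · right
    exact hS.isOpenInterval_image h0 (hI.isOpen.inter (hS.isOpen_cell h))
      (inter_subset_right.trans h.cell_subset_reg) (hI.ordConnected.inter (hS.ordConnected_cell h))

theorem nonempty_cutting (hε₀ : 0 < ε₀) (hG : ∀ j, IsOpenInterval (G.I j)) :
    Nonempty (Cutting S ε₀ n G) := by
  choose P hP using fun j (h : S.Branch n) =>
    exists_isCutting hε₀ (image_eq_empty_or_isOpenInterval hS (hG j) h)
  exact ⟨⟨P, hP⟩⟩

variable (c : Cutting S ε₀ n G) (hG : ∀ j, IsStandardPair α a b ε₀ (G.I j) (G.ρ j))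
include hG

theorem iterI_eq (k : c.Index) : iterI c k = k.2.2.1 :=
  inter_eq_right.2 ((c.isCutting k.1 k.2.1).piece
    (image_eq_empty_or_isOpenInterval hS (hG k.1).interval k.2.1) k.2.2.2).2.1

theorem isOpenInterval_iterI (k : c.Index) : IsOpenInterval (iterI c k) := by
  rw [iterI_eq hS c hG k]
  exact ((c.isCutting k.1 k.2.1).piece
    (image_eq_empty_or_isOpenInterval hS (hG k.1).interval k.2.1) k.2.2.2).1

theorem volume_iterI_lt (k : c.Index) : volume (iterI c k) < ENNReal.ofReal ε₀ := by
  rw [iterI_eq hS c hG k]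
  exact ((c.isCutting k.1 k.2.1).piece
    (image_eq_empty_or_isOpenInterval hS (hG k.1).interval k.2.1) k.2.2.2).2.2

theorem measurableSet_iterI (k : c.Index) : MeasurableSet (iterI c k) :=
  (isOpenInterval_iterI hS c hG k).isOpen.measurableSet

omit hS hG in
theorem iterI_subset_dom (k : c.Index) : iterI c k ⊆ k.2.1.dom :=
  inter_subset_left.trans (image_mono inter_subset_right)

omit hG in
theorem mapsTo_map_iterI (k : c.Index) : MapsTo k.2.1.map (iterI c k) (G.I k.1) := by
  rintro _ ⟨⟨z, hz, rfl⟩, -⟩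
  rw [hS.map_iterate hz.2]
  exact hz.1

omit hS hG in
theorem iterRho_eq (k : c.Index) (x : ℝ) :
    iterRho c b k x = ((iterZ c k)⁻¹ : ℝ) * k.2.1.push b (G.ρ k.1) x := by
  rw [iterRho, Branch.push, mul_comm, Complex.ofReal_inv]

theorem isRegularOn_iterate_push (ha : 0 ≤ a)
    (ha' : a * Real.exp (-(α * (lam * n))) + (D + Cτ) ≤ a') (k : c.Index) :
    IsRegularOn α a' b (iterI c k) (k.2.1.push b (G.ρ k.1)) :=
  hS.isRegularOn_push k.2.1 (iterI_subset_dom c k) (mapsTo_map_iterI hS c k)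
    (hG k.1).isRegularOn ha ha'

theorem lintegral_enorm_push (k : c.Index) :
    ∫⁻ x in iterI c k, ‖k.2.1.push b (G.ρ k.1) x‖ₑ =
      ∫⁻ x in k.2.1.map '' iterI c k, ‖G.ρ k.1 x‖ₑ :=
  (hS.lintegral_image_map k.2.1 (measurableSet_iterI hS c hG k) (iterI_subset_dom c k) _).symm

theorem integrableOn_image_iterI (k : c.Index) :
    IntegrableOn (G.ρ k.1) (k.2.1.map '' iterI c k) :=
  (hG k.1).integrable.mono_set (mapsTo_map_iterI hS c k).image_subset

theorem integrableOn_push (k : c.Index) :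
    IntegrableOn (k.2.1.push b (G.ρ k.1)) (iterI c k) :=
  (integrable_indicator_iff (measurableSet_iterI hS c hG k)).1
    (hS.isTransfer_branch k.2.1 (measurableSet_iterI hS c hG k) (iterI_subset_dom c k)
      (integrableOn_image_iterI hS c hG k)).integrable_image

theorem ofReal_iterZ (k : c.Index) :
    ENNReal.ofReal (iterZ c k) = ∫⁻ x in iterI c k, ‖k.2.1.push b (G.ρ k.1) x‖ₑ := by
  rw [← ofReal_integral_norm_eq_lintegral_enorm (integrableOn_push hS c hG k)]
  simp only [Branch.norm_push]
  rfl

theorem iterZ_pos (k : c.Index) : 0 < iterZ c k := by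
  have hα := hS.alpha_pos
  have h0 : ∫⁻ x in iterI c k, ‖k.2.1.push b (G.ρ k.1) x‖ₑ ≠ 0 := by
    refine setLIntegral_ne_zero_of_ne_zero (measurableSet_iterI hS c hG k)
      (isOpenInterval_iterI hS c hG k).volume_ne_zero
      (integrableOn_push hS c hG k).1.aemeasurable.enorm fun x hx => ?_
    rw [← ofReal_norm, Branch.norm_push, ne_eq, ENNReal.ofReal_eq_zero, not_le]
    exact mul_pos ((hG k.1).isRegularOn.norm_pos (mapsTo_map_iterI hS c k hx))
      (abs_pos.2 (hS.deriv_map_ne_zero (iterI_subset_dom c k hx)))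
  rwa [← ofReal_iterZ hS c hG k, ne_eq, ENNReal.ofReal_eq_zero, not_le] at h0

theorem isStandardPair_iterate (ha : 0 ≤ a) (hε₁ : ε₀ ≤ 1)
    (ha' : a * Real.exp (-(α * (lam * n))) + (D + Cτ) ≤ a') (k : c.Index) :
    IsStandardPair α a' b ε₀ (iterI c k) (iterRho c b k) := by
  have hz := iterZ_pos hS c hG k
  have hr := (isRegularOn_iterate_push hS c hG ha ha' k).const_mul (inv_pos.2 hz)
  have he : iterRho c b k = fun x => ((iterZ c k)⁻¹ : ℝ) * k.2.1.push b (G.ρ k.1) x :=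
    funext (iterRho_eq c k)
  rw [he]
  refine ⟨isOpenInterval_iterI hS c hG k, volume_iterI_lt hS c hG k, hε₁,
    (integrableOn_push hS c hG k).const_mul _, ?_, hr.ne_zero, hr.modulus, hr.argument⟩
  simp only [norm_mul, Complex.norm_real, Real.norm_of_nonneg (inv_pos.2 hz).le, Branch.norm_push]
  rw [integral_const_mul]
  exact inv_mul_cancel₀ hz.ne'

omit hG in
-- A common point determines the branch by its itinerary, and then the piece by its image. Hence the
-- weights of the pieces coming from I_j are masses of ρ_j on disjoint subsets of I_j.
theorem disjoint_image_iterI {k k' : c.Index} (hk : k.1 = k'.1) (hne : k ≠ k') :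
    Disjoint (k.2.1.map '' iterI c k) (k'.2.1.map '' iterI c k') := by
  obtain ⟨j, h, U, hU⟩ := k
  obtain ⟨j', h', U', hU'⟩ := k'
  obtain rfl : j = j' := hk
  rw [Set.disjoint_left]
  rintro _ ⟨x, hx, rfl⟩ ⟨x', hx', hxx⟩
  have hxd := iterI_subset_dom c _ hx
  have hxd' := iterI_subset_dom c _ hx'
  simp only at hxx hxd hxd'
  obtain rfl : h = h' := by
    refine hS.branch_ext (Branch.map_mem hxd) ?_
    rw [← hxx]
    exact Branch.map_mem hxd'
  obtain rfl : x' = x := Branch.map_injOn hxd' hxd hxx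
  have hUU : U ≠ U' := fun h => hne (by subst h; rfl)
  exact Set.disjoint_left.1 ((c.isCutting j h).disjoint hU hU' hUU) hx.2 hx'.2

/-- The images of the pieces of `I_j` fill `I_j` up to a countable set. -/
theorem countable_diff_image_iterI (j : G.J) :
    (G.I j \ ⋃ k : (Σ (h : S.Branch n), {U : Set ℝ // U ∈ c.pieces j h}),
      k.1.map '' iterI c ⟨j, k⟩).Countable := by
  have := countable_branch S n
  refine ((hS.countable_compl_reg n).union (countable_iUnion fun h : S.Branch n =>
    ((c.isCutting j h).finite_diff.countable.image h.map))).mono fun x hx => ?_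
  by_cases hr : x ∈ S.reg n
  · right
    obtain ⟨h, hh⟩ := exists_branch hr
    have hV : S.f^[n] x ∈ S.f^[n] '' (G.I j ∩ h.cell) := ⟨x, ⟨hx.1, hh⟩, rfl⟩
    refine mem_iUnion.2 ⟨h, S.f^[n] x, ⟨hV, fun hU => hx.2 ?_⟩, hS.map_iterate hh⟩
    obtain ⟨U, hU, hxU⟩ := mem_iUnion₂.1 hU
    exact mem_iUnion.2 ⟨⟨h, U, hU⟩, S.f^[n] x, ⟨hV, hxU⟩, hS.map_iterate hh⟩
  · exact Or.inl ⟨(hG j).interval.subset_Ico hx.1, hr⟩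

theorem coe_iterate_w (k : c.Index) : ((iterate b c).w k : ℝ≥0∞) =
    G.w k.1 * ∫⁻ x in k.2.1.map '' iterI c k, ‖G.ρ k.1 x‖ₑ := by
  rw [← lintegral_enorm_push hS c hG k, ← ofReal_iterZ hS c hG k, mul_comm]
  change ((_ * _ : ℝ≥0) : ℝ≥0∞) = _
  rw [ENNReal.coe_mul]
  rfl

theorem tsum_lintegral_image_le (j : G.J) :
    ∑' k : (Σ (h : S.Branch n), {U : Set ℝ // U ∈ c.pieces j h}),
      ∫⁻ x in k.1.map '' iterI c ⟨j, k⟩, ‖G.ρ j x‖ₑ ≤ 1 := by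
  have := countable_branch S n
  rw [← lintegral_iUnion, ← (hG j).lintegral_enorm]
  · exact lintegral_mono_set (iUnion_subset fun k => (mapsTo_map_iterI hS c ⟨j, k⟩).image_subset)
  · exact fun k => hS.measurableSet_image_map _ (measurableSet_iterI hS c hG ⟨j, k⟩)
      (iterI_subset_dom c _)
  · intro k k' hne
    exact disjoint_image_iterI hS c (k := ⟨j, k⟩) (k' := ⟨j, k'⟩) rfl fun h => hne (by
      simpa using h)

theorem totalWeight_iterate_le : (iterate b c).totalWeight ≤ G.totalWeight := by
  have e : (iterate b c).totalWeight = ∑' k : c.Index,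
      G.w k.1 * ∫⁻ x in k.2.1.map '' iterI c k, ‖G.ρ k.1 x‖ₑ :=
    tsum_congr fun k => coe_iterate_w hS c hG k
  rw [e, ENNReal.tsum_sigma']
  refine ENNReal.tsum_le_tsum fun j => ?_
  have h1 := ENNReal.tsum_mul_left (a := (G.w j : ℝ≥0∞))
    (f := fun k : (Σ (h : S.Branch n), {U : Set ℝ // U ∈ c.pieces j h}) =>
      ∫⁻ x in k.1.map '' iterI c ⟨j, k⟩, ‖G.ρ j x‖ₑ)
  exact h1.le.trans (mul_le_of_le_one_right' (tsum_lintegral_image_le hS c hG j))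

theorem iterate_term_eq (k : c.Index) (x : ℝ) : (iterate b c).term k x =
    ((G.w k.1 : ℝ) : ℂ) * indicator (iterI c k) (k.2.1.push b (G.ρ k.1)) x := by
  have hz := iterZ_pos hS c hG k
  change (((iterZ c k).toNNReal * G.w k.1 : ℝ≥0) : ℝ) • indicator (iterI c k) (iterRho c b k) x = _
  by_cases hx : x ∈ iterI c k
  · rw [indicator_of_mem hx, indicator_of_mem hx, iterRho_eq, NNReal.coe_mul,
      Real.coe_toNNReal _ hz.le, Complex.real_smul, ← mul_assoc, ← Complex.ofReal_mul]
    congr 2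
    field_simp
  · rw [indicator_of_notMem hx, indicator_of_notMem hx, smul_zero, mul_zero]

/-- Each ρ_j is split into its restrictions to the sets h(U), which are transported one by one by
change of variables and summed. Finite total weight justifies the interchange of sums and integrals.
-/
theorem isTransfer_density (hw : G.totalWeight ≠ ∞) :
    S.IsTransfer b n G.density (iterate b c).density := by
  have := c.countable_index
  have hcB := countable_branch S n
  have hcJ := G.countable
  let u : c.Index → ℝ → ℂ := fun k x =>
    ((G.w k.1 : ℝ) : ℂ) * indicator (k.2.1.map '' iterI c k) (G.ρ k.1) x
  have hT : ∀ k : c.Index, S.IsTransfer b n (u k) ((iterate b c).term k) := fun k => by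
    have h1 := (hS.isTransfer_branch k.2.1 (b := b) (measurableSet_iterI hS c hG k)
      (iterI_subset_dom c k) (integrableOn_image_iterI hS c hG k)).const_mul ((G.w k.1 : ℝ) : ℂ)
    exact h1.congr_ae (ae_eq_refl _) (ae_of_all _ fun x => (iterate_term_eq hS c hG k x).symm)
  have hlu : ∀ k : c.Index, ∫⁻ x, ‖u k x‖ₑ = (iterate b c).w k := fun k => by
    rw [coe_iterate_w hS c hG k]
    simp only [u, enorm_mul, enorm_indicator_eq_indicator_enorm]
    rw [lintegral_const_mul' _ _ (by simp), lintegral_indicator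
      (hS.measurableSet_image_map _ (measurableSet_iterI hS c hG k) (iterI_subset_dom c k)), enorm_coe_coe_nnreal]
  have hlt : ∀ k : c.Index, ∫⁻ x, ‖(iterate b c).term k x‖ₑ ≤ (iterate b c).w k := fun k => by
    rw [coe_iterate_w hS c hG k, ← lintegral_enorm_push hS c hG k (b := b)]
    simp only [iterate_term_eq hS c hG k, enorm_mul, enorm_indicator_eq_indicator_enorm]
    rw [lintegral_const_mul' _ _ (by simp), lintegral_indicator (measurableSet_iterI hS c hG k),
      enorm_coe_coe_nnreal]
  have hwt : (iterate b c).totalWeight ≠ ∞ :=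
    ne_top_of_le_ne_top hw (totalWeight_iterate_le hS c hG)
  have hsu : ∑' k, ∫⁻ x, ‖u k x‖ₑ ≠ ∞ := by
    rw [tsum_congr hlu]; exact hwt
  have hT' := hS.isTransfer_tsum hT hsu
    (ne_top_of_le_ne_top hwt (ENNReal.tsum_le_tsum hlt))
  refine hT'.congr_ae ?_ (ae_eq_refl _)
  -- Off a countable set, each point of I_j lies in exactly one of the sets h(U), so the inner sum
  -- has a single nonzero term.
  have hbad := (countable_iUnion fun j => countable_diff_image_iterI hS c hG j).ae_notMem volume
  filter_upwards [ae_summable_norm_of_tsum_lintegral_ne_top (fun k => (hT k).integrable.1) hsu,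
    hbad] with x hx hxb
  rw [hx.of_norm.tsum_sigma, density_eq]
  refine tsum_congr fun j => ?_
  simp only [u, term]
  rw [tsum_mul_left, Complex.real_smul]
  congr 1
  by_cases hxI : x ∈ G.I j
  · have hx1 : x ∈ ⋃ k : (Σ (h : S.Branch n), {U : Set ℝ // U ∈ c.pieces j h}),
      k.1.map '' iterI c ⟨j, k⟩ := by
      by_contra h
      exact hxb (mem_iUnion.2 ⟨j, hxI, h⟩)
    obtain ⟨k, hk⟩ := mem_iUnion.1 hx1
    rw [tsum_eq_single k, indicator_of_mem hk, indicator_of_mem hxI]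
    intro k' hne
    refine indicator_of_notMem (fun h' => ?_) _
    exact Set.disjoint_left.1 (disjoint_image_iterI hS c (k := ⟨j, k⟩) (k' := ⟨j, k'⟩) rfl
      fun h => hne (by simpa using h.symm)) hk h'
  · rw [indicator_of_notMem hxI]
    convert tsum_zero with k
    exact indicator_of_notMem (fun h => hxI ((mapsTo_map_iterI hS c ⟨j, k⟩).image_subset h)) _

end

end WeightedFamily

/-! ### Growth lemma: the length sum under iteration -/

namespace SkewProduct

variable {S : SkewProduct} {α lam D Cτ : ℝ} {b : ℝ}

open Classical in
variable (S) in
/-- The sum of `sup |h'|` over the inverse branches `h` of `f^n` whose range meets `I`. -/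
noncomputable def hitSum (n : ℕ) (I : Set ℝ) : ℝ≥0∞ :=
  ∑' h : S.Branch n, if (I ∩ h.cell).Nonempty then h.supDeriv else 0

theorem hitSum_le_tsum {n : ℕ} {I : Set ℝ} : S.hitSum n I ≤ ∑' h : S.Branch n, h.supDeriv := by
  refine ENNReal.tsum_le_tsum fun h => ?_
  split_ifs
  · exact le_rfl
  · exact zero_le

namespace IsAdmissible

variable (hS : S.IsAdmissible α lam D Cτ)
include hS

theorem tsum_supDeriv_ne_top (n : ℕ) : ∑' h : S.Branch n, h.supDeriv ≠ ∞ := (hS.summability n).ne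

open Classical in
theorem tsum_ite_mem_cell_le (n : ℕ) (x : ℝ) :
    (∑' h : S.Branch n, if x ∈ h.cell then h.supDeriv else 0) ≤
      ENNReal.ofReal (Real.exp (-(lam * n))) := by
  by_cases hx : ∃ h : S.Branch n, x ∈ h.cell
  · obtain ⟨h, hh⟩ := hx
    rw [tsum_eq_single h, if_pos hh]
    · exact hS.supDeriv_le h
    · exact fun h' hne => if_neg fun hh' => hne (hS.branch_ext hh' hh)
  · push Not at hx
    simp [hx]

/-- Short intervals meet at most two large partition elements of `f^n`. -/
theorem exists_hitSum_le (n : ℕ) {δ : ℝ≥0∞} (hδ : 0 < δ) : ∃ ε : ℝ, 0 < ε ∧ ∀ I : Set ℝ,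
    IsOpenInterval I → volume I < ENNReal.ofReal ε →
    S.hitSum n I ≤ 2 * ENNReal.ofReal (Real.exp (-(lam * n))) + δ := by
  classical
  -- By summability, all branches outside a finite set Φ contribute less than δ; then ε is chosen
  -- below the lengths of the finitely many partition elements in Φ.
  obtain ⟨Φ, hΦ⟩ := ((ENNReal.tendsto_tsum_compl_atTop_zero
    (hS.tsum_supDeriv_ne_top n)).eventually (gt_mem_nhds hδ)).exists
  obtain ⟨ε, hε, hεΦ⟩ : ∃ ε : ℝ, 0 < ε ∧ ∀ h ∈ Φ, ENNReal.ofReal ε ≤ volume h.cell := by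
    have key : ∀ h : S.Branch n, ∃ ε : ℝ, 0 < ε ∧ ENNReal.ofReal ε ≤ volume h.cell := by
      intro h
      obtain ⟨l, r, -, hlr, -, hI⟩ := hS.isOpenInterval_cell h
      exact ⟨r - l, by linarith, by rw [hI, Real.volume_Ioo]⟩
    choose e he he' using key
    rcases Φ.eq_empty_or_nonempty with rfl | hne
    · exact ⟨1, one_pos, by simp⟩
    · exact ⟨Φ.inf' hne e, (Finset.lt_inf'_iff _).2 fun h _ => he h, fun h hh =>
        (ENNReal.ofReal_le_ofReal (Finset.inf'_le _ hh)).trans (he' h)⟩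
  refine ⟨ε, hε, fun I hI hvol => ?_⟩
  obtain ⟨l, r, hl, hlr, hr, rfl⟩ := hI
  -- An element of Φ is longer than I, so if it meets I it contains an endpoint of I. Each endpoint
  -- lies in at most one element, which accounts for the two terms e^{-λn}.
  have hpt : ∀ h : S.Branch n, (if (Ioo l r ∩ h.cell).Nonempty then h.supDeriv else 0) ≤
      ((if l ∈ h.cell then h.supDeriv else 0) + if r ∈ h.cell then h.supDeriv else 0) +
        indicator {h | h ∉ Φ} Branch.supDeriv h := by
    intro h
    split_ifs with h1 h2 h3 h3
    · exact le_add_right le_self_add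
    · exact le_add_right le_self_add
    · simp
    · by_cases hh : h ∈ Φ
      · exfalso
        obtain ⟨x, hx, hxc⟩ := h1
        refine absurd (hεΦ h hh) (not_le.2 (lt_of_le_of_lt (measure_mono fun y hy => ?_) hvol))
        have hoc := hS.ordConnected_cell h
        by_contra hy'
        rcases lt_or_ge l y with h4 | h4
        · exact h3 (hoc.out hxc hy ⟨hx.2.le, not_lt.1 fun h5 => hy' ⟨h4, h5⟩⟩)
        · exact h2 (hoc.out hy hxc ⟨h4, hx.1.le⟩)
      · rw [indicator_of_mem (show h ∈ {h | h ∉ Φ} from hh)]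
        exact le_add_self
    all_goals exact zero_le
  refine (ENNReal.tsum_le_tsum hpt).trans ?_
  rw [ENNReal.tsum_add, ENNReal.tsum_add, two_mul]
  gcongr
  · exact hS.tsum_ite_mem_cell_le n l
  · exact hS.tsum_ite_mem_cell_le n r
  · rw [← tsum_subtype]
    exact hΦ.le

end IsAdmissible

end SkewProduct

namespace WeightedFamily

open SkewProduct

variable {S : SkewProduct} {α lam D Cτ : ℝ} {b a a' ε₀ : ℝ} {n : ℕ} {G : WeightedFamily}

variable (hS : S.IsAdmissible α lam D Cτ) (c : Cutting S ε₀ n G)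
  (hG : ∀ j, IsStandardPair α a b ε₀ (G.I j) (G.ρ j))
include hS hG

theorem lintegral_enorm_push_le (ha : 0 ≤ a) (hε : Real.exp (a * ε₀ ^ α) ≤ 2) (k : c.Index) :
    ∫⁻ x in iterI c k, ‖k.2.1.push b (G.ρ k.1) x‖ₑ ≤
      2 * k.2.1.supDeriv / volume (G.I k.1) * volume (iterI c k) := by
  rw [← setLIntegral_const]
  refine setLIntegral_mono' (measurableSet_iterI hS c hG k) fun x hx => ?_
  rw [Branch.enorm_push, mul_comm 2, mul_div_assoc]
  exact mul_le_mul' (Branch.le_supDeriv (iterI_subset_dom c k hx))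
    ((hG k.1).enorm_le hS.alpha_pos ha hε (mapsTo_map_iterI hS c k hx))

-- An uncut image U has mass at most 2 sup|h'| |U|/|I_j|, which gives the first term. Pieces of a
-- cut image have length at least ε₀/3, which gives the second.
open Classical in
theorem tsum_pieces_le (ha : 0 ≤ a) (h0 : 0 < ε₀) (hε : Real.exp (a * ε₀ ^ α) ≤ 2) (j : G.J)
    (h : S.Branch n) :
    ∑' U : {U : Set ℝ // U ∈ c.pieces j h},
      (∫⁻ x in h.map '' iterI c ⟨j, h, U⟩, ‖G.ρ j x‖ₑ) / volume (iterI c ⟨j, h, U⟩) ≤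
    (if (G.I j ∩ h.cell).Nonempty then h.supDeriv else 0) * (2 / volume (G.I j)) +
      ENNReal.ofReal (3 / ε₀) *
        ∑' U : {U : Set ℝ // U ∈ c.pieces j h}, ∫⁻ x in h.map '' iterI c ⟨j, h, U⟩, ‖G.ρ j x‖ₑ := by
  have hc := c.isCutting j h
  rcases (G.I j ∩ h.cell).eq_empty_or_nonempty with hemp | hne
  · have hP := hc.1 (by rw [hemp, image_empty])
    have : IsEmpty {U : Set ℝ // U ∈ c.pieces j h} :=
      ⟨fun U => by
        have h1 : ∀ V ∈ c.pieces j h, False := fun V hV => by simp [hP] at hV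
        exact h1 U.1 U.2⟩
    rw [tsum_empty]
    exact zero_le
  rw [if_pos hne]
  rcases lt_or_ge (volume (S.f^[n] '' (G.I j ∩ h.cell))) (ENNReal.ofReal ε₀) with hlt | hge
  · have hP := hc.2.1 (hne.image _) hlt
    have hsub : ∀ U U' : {U : Set ℝ // U ∈ c.pieces j h}, U = U' := fun U U' => by
      have key : ∀ U ∈ c.pieces j h, U = S.f^[n] '' (G.I j ∩ h.cell) := fun U hU => by
        rwa [hP, Finset.mem_singleton] at hU
      exact Subtype.ext ((key _ U.2).trans (key _ U'.2).symm)
    refine le_add_right ?_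
    rw [tsum_eq_single (⟨S.f^[n] '' (G.I j ∩ h.cell), by rw [hP]; exact Finset.mem_singleton_self _⟩ :
      {U : Set ℝ // U ∈ c.pieces j h}) fun U' hU' => absurd (hsub _ _) hU']
    refine ENNReal.div_le_of_le_mul ?_
    rw [← mul_div_assoc, mul_comm _ (2 : ℝ≥0∞)]
    exact (lintegral_enorm_push hS c hG (b := b) ⟨j, h, _⟩).symm.le.trans
      (lintegral_enorm_push_le hS c hG ha hε _)
  · refine le_add_left ?_
    rw [← ENNReal.tsum_mul_left]
    refine ENNReal.tsum_le_tsum fun U => ?_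
    have hU := ((hc.2.2 (hne.image _) hge).1 U.1 U.2).2.2.1
    have hI : iterI c ⟨j, h, U⟩ = U.1 := iterI_eq hS c hG ⟨j, h, U⟩
    rw [hI, mul_comm, div_eq_mul_inv]
    gcongr
    rw [show 3 / ε₀ = (ε₀ / 3)⁻¹ by rw [inv_div], ENNReal.ofReal_inv_of_pos (by positivity)]
    exact ENNReal.inv_le_inv.2 hU

/-- The growth lemma. -/
theorem lengthSum_iterate_le (ha : 0 ≤ a) (h0 : 0 < ε₀) (hε : Real.exp (a * ε₀ ^ α) ≤ 2)
    {κ : ℝ≥0∞} (hκ : ∀ I, IsOpenInterval I → volume I < ENNReal.ofReal ε₀ → 2 * S.hitSum n I ≤ κ) :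
    (iterate b c).lengthSum ≤ κ * G.lengthSum + ENNReal.ofReal (3 / ε₀) * G.totalWeight := by
  have e : (iterate b c).lengthSum = ∑' k : c.Index,
      G.w k.1 * ((∫⁻ x in k.2.1.map '' iterI c k, ‖G.ρ k.1 x‖ₑ) / volume (iterI c k)) := by
    refine tsum_congr fun k => ?_
    rw [coe_iterate_w hS c hG k, mul_div_assoc]
    rfl
  rw [e, ENNReal.tsum_sigma', lengthSum, totalWeight, ← ENNReal.tsum_mul_left,
    ← ENNReal.tsum_mul_left, ← ENNReal.tsum_add]
  refine ENNReal.tsum_le_tsum fun j => ?_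
  have h1 := ENNReal.tsum_mul_left (a := (G.w j : ℝ≥0∞))
    (f := fun k : (Σ (h : S.Branch n), {U : Set ℝ // U ∈ c.pieces j h}) =>
      (∫⁻ x in k.1.map '' iterI c ⟨j, k⟩, ‖G.ρ j x‖ₑ) / volume (iterI c ⟨j, k⟩))
  refine h1.le.trans ?_
  have h2 : ∑' k : (Σ (h : S.Branch n), {U : Set ℝ // U ∈ c.pieces j h}),
      (∫⁻ x in k.1.map '' iterI c ⟨j, k⟩, ‖G.ρ j x‖ₑ) / volume (iterI c ⟨j, k⟩) ≤
      κ / volume (G.I j) + ENNReal.ofReal (3 / ε₀) := by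
    rw [ENNReal.tsum_sigma']
    refine (ENNReal.tsum_le_tsum fun h => tsum_pieces_le hS c hG ha h0 hε j h).trans ?_
    rw [ENNReal.tsum_add, ENNReal.tsum_mul_right, ENNReal.tsum_mul_left]
    gcongr
    · calc S.hitSum n (G.I j) * (2 / volume (G.I j))
          = 2 * S.hitSum n (G.I j) / volume (G.I j) := by
            rw [mul_comm 2, mul_div_assoc]
        _ ≤ _ := by
            gcongr
            exact hκ _ (hG j).interval (hG j).width
    · refine mul_le_of_le_one_right' ?_
      have := tsum_lintegral_image_le hS c hG j
      rwa [ENNReal.tsum_sigma'] at this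
  calc _ ≤ (G.w j : ℝ≥0∞) * (κ / volume (G.I j) + ENNReal.ofReal (3 / ε₀)) := by gcongr
    _ = _ := by
      simp only [div_eq_mul_inv]
      ring

end WeightedFamily

namespace SkewProduct.IsAdmissible

variable {S : SkewProduct} {α lam D Cτ : ℝ} {b a a' ε₀ : ℝ} {n : ℕ}

/-- The transfer operator acts on decompositions. -/
theorem exists_isTransfer (hS : S.IsAdmissible α lam D Cτ) (ha : 0 ≤ a) (h0 : 0 < ε₀)
    (h1 : ε₀ ≤ 1) (hε : Real.exp (a * ε₀ ^ α) ≤ 2)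
    (ha' : a * Real.exp (-(α * (lam * n))) + (D + Cτ) ≤ a')
    {κ : ℝ≥0∞} (hκ : ∀ I, IsOpenInterval I → volume I < ENNReal.ofReal ε₀ → 2 * S.hitSum n I ≤ κ)
    {g : ℝ → ℂ} {W Q : ℝ≥0∞} (hW : W ≠ ∞) (hg : Decomposes α a b ε₀ g W Q) :
    ∃ g', S.IsTransfer b n g g' ∧
      Decomposes α a' b ε₀ g' W (κ * Q + ENNReal.ofReal (3 / ε₀) * W) := by
  obtain ⟨G, hG, hGW, hGQ, hGg⟩ := hg
  obtain ⟨c⟩ := WeightedFamily.nonempty_cutting (n := n) hS h0 fun j => (hG j).interval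
  refine ⟨(WeightedFamily.iterate b c).density,
    (WeightedFamily.isTransfer_density hS c hG (ne_top_of_le_ne_top hW hGW)).congr_ae hGg.symm
      (ae_eq_refl _), WeightedFamily.iterate b c,
    WeightedFamily.isStandardPair_iterate hS c hG ha h1 ha',
    (WeightedFamily.totalWeight_iterate_le hS c hG).trans hGW,
    (WeightedFamily.lengthSum_iterate_le hS c hG ha h0 hε hκ).trans ?_, ae_eq_refl _⟩
  gcongr

end SkewProduct.IsAdmissible

/-! ### Transversality of slopes from the absence of a Lipschitz cohomology -/

theorem IsOpenInterval.exists_notMem_of_countable {I A : Set ℝ} (hI : IsOpenInterval I)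
    (hA : A.Countable) : ∃ x ∈ I, x ∉ A := by
  by_contra! h
  exact hI.volume_ne_zero (measure_mono_null h (hA.measure_zero volume))

namespace SkewProduct

variable {S : SkewProduct} {α lam D Cτ : ℝ} {b : ℝ}

namespace IsAdmissible

variable (hS : S.IsAdmissible α lam D Cτ)
include hS

theorem abs_sub_le_of_mem_cell {n : ℕ} {h : S.Branch n} {x y : ℝ} (hx : x ∈ h.cell)
    (hy : y ∈ h.cell) : |x - y| ≤ Real.exp (-(lam * n)) := by
  have h1 := hS.abs_map_sub_le (Branch.iterate_mem_dom hx) (Branch.iterate_mem_dom hy)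
  rw [hS.map_iterate hx, hS.map_iterate hy] at h1
  refine h1.trans (mul_le_of_le_one_right (Real.exp_pos _).le ?_)
  have hx1 := hS.iterate_mem_Ioo (h.cell_subset_reg hx)
  have hy1 := hS.iterate_mem_Ioo (h.cell_subset_reg hy)
  rw [abs_le]
  constructor <;> linarith [hx1.1, hx1.2, hy1.1, hy1.2]

theorem exists_mem_reg {I : Set ℝ} (hI : IsOpenInterval I) (n : ℕ) : ∃ x ∈ I, x ∈ S.reg n := by
  obtain ⟨x, hx, hx'⟩ := hI.exists_notMem_of_countable (hS.countable_compl_reg n)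
  exact ⟨x, hx, by_contra fun h => hx' ⟨hI.subset_Ico hx, h⟩⟩

theorem Cτ_nonneg : 0 ≤ Cτ := by
  obtain ⟨x, -, hx⟩ := hS.exists_mem_reg (I := Ioo 0 1) ⟨0, 1, le_rfl, one_pos, le_rfl, rfl⟩ 0
  exact hS.Cτ_nonneg_of_mem hx

/-- Covering makes some f^N map a partition element onto almost everything. For N ≥ 1 that image
lies in the image of f; N = 0 is impossible, since a partition element has length at most e^{-λ} <
1/2. -/
theorem countable_compl_image_f : (Ico (0 : ℝ) 1 \ S.f '' Ico 0 1).Countable := by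
  obtain ⟨x, -, hx⟩ := hS.exists_mem_reg (I := Ioo 0 1) ⟨0, 1, le_rfl, one_pos, le_rfl, rfl⟩ 1
  obtain ⟨h, -⟩ := exists_branch hx
  obtain ⟨N, hN⟩ := hS.covering 1
  have hN := hN h
  cases N with
  | zero =>
    exfalso
    simp only [Function.iterate_zero, image_id] at hN
    have key : ∀ l r : ℝ, 0 ≤ l → l < r → r ≤ 1 → ∃ x ∈ Ioo l r, x ∈ h.cell := by
      intro l r hl hlr hr
      have hI : IsOpenInterval (Ioo l r) := ⟨l, r, hl, hlr, hr, rfl⟩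
      obtain ⟨x, hx, hx'⟩ := hI.exists_notMem_of_countable hN
      exact ⟨x, hx, by_contra fun h => hx' ⟨hI.subset_Ico hx, h⟩⟩
    obtain ⟨x, hx, hxc⟩ := key 0 (1 / 4) le_rfl (by norm_num) (by norm_num)
    obtain ⟨y, hy, hyc⟩ := key (3 / 4) 1 (by norm_num) (by norm_num) le_rfl
    have h1 := (le_abs_self _).trans (hS.abs_sub_le_of_mem_cell hyc hxc)
    have h2 : Real.exp (-(lam * (1 : ℕ))) < 1 / 2 := by
      rw [Nat.cast_one, mul_one, ← Real.lt_log_iff_exp_lt (by norm_num), one_div, Real.log_inv]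
      exact neg_lt_neg hS.log_two_lt
    have h3 := h1.trans_lt h2
    linarith [hx.2, hy.1]
  | succ N =>
    have hsub : S.f^[N + 1] '' h.cell ⊆ S.f '' Ico 0 1 := by
      rintro _ ⟨z, hz, rfl⟩
      refine ⟨S.f^[N] z, hS.mapsTo_iterate N (reg_subset_Ico (h.cell_subset_reg hz)), ?_⟩
      rw [Function.iterate_succ_apply']
    refine Set.Countable.mono (fun x hx => ?_) hN
    exact ⟨hx.1, fun h' => hx.2 (hsub h')⟩

theorem countable_compl_image_iterate (m : ℕ) : (Ico (0 : ℝ) 1 \ S.f^[m] '' Ico 0 1).Countable := by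
  induction m with
  | zero => simp
  | succ m ih =>
    refine (hS.countable_compl_image_f.union (ih.image S.f)).mono fun x hx => ?_
    by_cases h1 : x ∈ S.f '' Ico 0 1
    · obtain ⟨z, hz, rfl⟩ := h1
      refine Or.inr ⟨z, ⟨hz, ?_⟩, rfl⟩
      rintro ⟨w, hw, rfl⟩
      exact hx.2 ⟨w, hw, Function.iterate_succ_apply' _ _ _⟩
    · exact Or.inl ⟨hx.1, h1⟩

theorem countable_compl_image_reg (m : ℕ) : (Ico (0 : ℝ) 1 \ S.f^[m] '' S.reg m).Countable := by
  refine ((hS.countable_compl_image_iterate m).union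
    ((hS.countable_compl_reg m).image S.f^[m])).mono fun x hx => ?_
  by_cases h1 : x ∈ S.f^[m] '' Ico 0 1
  · obtain ⟨z, hz, rfl⟩ := h1
    exact Or.inr ⟨z, ⟨hz, fun h => hx.2 ⟨z, h, rfl⟩⟩, rfl⟩
  · exact Or.inl ⟨hx.1, h1⟩

end IsAdmissible

variable (S) in
/-- The points with regular preimages of every order. -/
def backwardReg : Set ℝ := {x | ∀ m, x ∈ S.f^[m] '' S.reg m}

namespace IsAdmissible

variable (hS : S.IsAdmissible α lam D Cτ)
include hS

/-- Thus almost every point has a regular m-th preimage for every m, along which limits of slopes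
can be taken. These preimages need not form a single backward orbit. -/
theorem countable_compl_backwardReg : (Ico (0 : ℝ) 1 \ S.backwardReg).Countable := by
  refine (countable_iUnion hS.countable_compl_image_reg).mono fun x hx => ?_
  have h2 := hx.2
  simp only [backwardReg, mem_ofPred_eq, not_forall] at h2
  obtain ⟨m, hm⟩ := h2
  exact mem_iUnion.2 ⟨m, hx.1, hm⟩

theorem tendsto_exp_neg : Tendsto (fun n : ℕ => Real.exp (-(lam * n))) atTop (𝓝 0) := by
  refine Real.tendsto_exp_atBot.comp (tendsto_neg_atTop_atBot.comp ?_)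
  exact tendsto_natCast_atTop_atTop.const_mul_atTop hS.lam_pos

/-- If slopes along different inverse branches are exponentially close, then they converge. -/
theorem exists_limit_slope {K : ℝ} (hK : ∀ m, ∀ z₁ ∈ S.reg m, ∀ z₂ ∈ S.reg m,
    S.f^[m] z₁ = S.f^[m] z₂ → |S.slope m z₁ - S.slope m z₂| ≤ K * Real.exp (-(lam * m))) :
    ∃ g : ℝ → ℝ, Measurable g ∧ (∀ x, |g x| ≤ Cτ) ∧ ∀ x, ∀ z : ℕ → ℝ,
      (∀ m, z m ∈ S.reg m ∧ S.f^[m] (z m) = x) →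
      Tendsto (fun m => S.slope m (z m)) atTop (𝓝 (g x)) := by
  have hC := hS.Cτ_nonneg
  have hcB := countable_branch S
  -- The supremum over the branches is measurable, and it has the same limit as any selection,
  -- because the slopes over a common point nearly agree. Adding `Cτ` makes all slopes nonnegative,
  -- so branches that are not defined at x may contribute 0.
  let u : ℕ → ℝ → ℝ≥0∞ := fun m x => ⨆ h : S.Branch m, indicator h.dom (fun x =>
    ENNReal.ofReal (deriv (fun y => birkhoffSum S.f S.τ m (h.map y)) x + Cτ)) x
  have hu : ∀ m, Measurable (u m) := fun m => Measurable.iSup fun h =>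
    ((measurable_deriv _).add_const _).ennreal_ofReal.indicator
      (hS.isOpenInterval_dom h).isOpen.measurableSet
  have hlow : ∀ m, ∀ z ∈ S.reg m, ENNReal.ofReal (S.slope m z + Cτ) ≤ u m (S.f^[m] z) := by
    intro m z hz
    obtain ⟨h, hh⟩ := exists_branch hz
    refine le_iSup_of_le h (le_of_eq ?_)
    rw [indicator_of_mem (Branch.iterate_mem_dom hh),
      (hS.hasDerivAt_birkhoffSum_map (Branch.iterate_mem_dom hh)).deriv, hS.map_iterate hh]
  have hupp : ∀ m, ∀ z ∈ S.reg m, u m (S.f^[m] z) ≤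
      ENNReal.ofReal (S.slope m z + Cτ + K * Real.exp (-(lam * m))) := by
    intro m z hz
    refine iSup_le fun h => ?_
    by_cases hx : S.f^[m] z ∈ h.dom
    · rw [indicator_of_mem hx, (hS.hasDerivAt_birkhoffSum_map hx).deriv]
      refine ENNReal.ofReal_le_ofReal ?_
      have := (le_abs_self _).trans
        (hK m (h.map (S.f^[m] z)) (Branch.map_mem_reg hx) z hz (Branch.iterate_map hx))
      linarith
    · rw [indicator_of_notMem hx]
      exact zero_le
  let g₀ : ℝ → ℝ := fun x => (liminf (fun m => u m x) atTop).toReal - Cτ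
  have hg₀ : Measurable g₀ := (Measurable.liminf hu).ennreal_toReal.sub_const _
  -- The clamping keeps g bounded by `Cτ` also at points without preimages of every order.
  refine ⟨fun x => max (-Cτ) (min Cτ (g₀ x)), (measurable_const.max (measurable_const.min hg₀)),
    fun x => abs_le.2 ⟨le_max_left _ _, max_le (by linarith) (min_le_left _ _)⟩, ?_⟩
  intro x z hz
  have hexp := hS.tendsto_exp_neg
  -- The point f^k(z_{m+k}) is another m-th preimage of x, so its slope differs from that of z_m by
  -- at most K e^{-λm}; by the cocycle relation the first k steps add at most Cτ e^{-λm}.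
  have hcauchy : CauchySeq fun m => S.slope m (z m) := by
    refine cauchySeq_of_le_tendsto_0' (fun m => (K + Cτ) * Real.exp (-(lam * m))) ?_ (by
      simpa using hexp.const_mul (K + Cτ))
    intro m p hmp
    obtain ⟨k, rfl⟩ := Nat.exists_eq_add_of_le hmp
    have hzr := (hz (m + k)).1
    rw [add_comm m k] at hzr ⊢
    obtain ⟨h1, h2⟩ := hS.reg_add.1 hzr
    rw [dist_comm, Real.dist_eq, hS.slope_add h1 h2]
    have h3 : S.f^[m] (S.f^[k] (z (k + m))) = S.f^[m] (z m) := by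
      rw [← Function.iterate_add_apply, (hz m).2, add_comm m k, (hz (k + m)).2]
    have h4 := hK m _ h2 _ (hz m).1 h3
    have h5 : |S.slope k (z (k + m)) / deriv S.f^[m] (S.f^[k] (z (k + m)))| ≤
        Cτ * Real.exp (-(lam * m)) := by
      rw [abs_div, Real.exp_neg, ← div_eq_mul_inv]
      exact div_le_div₀ hC (hS.abs_slope_le h1) (Real.exp_pos _) (hS.abs_deriv_ge h2)
    rw [add_sub_right_comm, add_mul]
    exact (abs_add_le _ _).trans (add_le_add h4 h5)
  obtain ⟨s, hs⟩ := cauchySeq_tendsto_of_complete hcauchy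
  have hsl : |s| ≤ Cτ := le_of_tendsto hs.abs (Eventually.of_forall fun m =>
    hS.abs_slope_le (hz m).1)
  have hlim : Tendsto (fun m => u m x) atTop (𝓝 (ENNReal.ofReal (s + Cτ))) := by
    refine tendsto_of_tendsto_of_tendsto_of_le_of_le
      (ENNReal.tendsto_ofReal (hs.add_const Cτ)) ?_ (fun m => ?_) (fun m => ?_)
      (h := fun m => ENNReal.ofReal (S.slope m (z m) + Cτ + K * Real.exp (-(lam * m))))
    · refine ENNReal.tendsto_ofReal ?_
      simpa using (hs.add_const Cτ).add (hexp.const_mul K)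
    · have := hlow m _ (hz m).1
      rwa [(hz m).2] at this
    · have := hupp m _ (hz m).1
      rwa [(hz m).2] at this
  have hg : g₀ x = s := by
    simp only [g₀]
    rw [hlim.liminf_eq, ENNReal.toReal_ofReal (by linarith [(abs_le.1 hsl).1]), add_sub_cancel_right]
  simp only [hg, min_eq_right (abs_le.1 hsl).2, max_eq_right (abs_le.1 hsl).1]
  exact hs

omit hS in
theorem backwardReg_image {i : S.ι} {t : ℝ} {z : ℕ → ℝ} (ht : t ∈ S.O i)
    (hz : ∀ m, z m ∈ S.reg m ∧ S.f^[m] (z m) = t) (m : ℕ) :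
    z m ∈ S.reg (m + 1) ∧ S.f^[m + 1] (z m) = S.f t := by
  refine ⟨mem_reg_succ.2 ⟨(hz m).1, i, ?_⟩, ?_⟩
  · rwa [(hz m).2]
  · rw [Function.iterate_succ_apply', (hz m).2]

/-- This is the derivative of the cohomological equation. It is the limit of the cocycle relation
whose last step is one application of f at t. -/
theorem limit_slope_image {g : ℝ → ℝ} (hg : ∀ x, ∀ z : ℕ → ℝ,
      (∀ m, z m ∈ S.reg m ∧ S.f^[m] (z m) = x) →
      Tendsto (fun m => S.slope m (z m)) atTop (𝓝 (g x)))
    {i : S.ι} {t : ℝ} (ht : t ∈ S.O i) (ht' : t ∈ S.backwardReg) :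
    deriv S.f t * g (S.f t) = deriv S.τ t + g t := by
  choose z hz1 hz2 using ht'
  have hz : ∀ m, z m ∈ S.reg m ∧ S.f^[m] (z m) = t := fun m => ⟨hz1 m, hz2 m⟩
  have hd := hS.deriv_ne_zero ht
  let w : ℕ → ℝ := fun m => Nat.casesOn m (S.f t) z
  have hw : ∀ m, w m ∈ S.reg m ∧ S.f^[m] (w m) = S.f t := by
    intro m
    cases m with
    | zero => exact ⟨⟨hS.iterate_mem_Ioo (hS.mem_reg_one ht), fun k hk => absurd hk (by omega)⟩, rfl⟩
    | succ m => exact backwardReg_image ht hz m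
  have h1 := (tendsto_add_atTop_iff_nat 1).2 (hg _ w hw)
  have h2 : ∀ m, S.slope (m + 1) (w (m + 1)) = deriv S.τ t / deriv S.f t +
      S.slope m (z m) / deriv S.f t := by
    intro m
    have := hS.slope_add (n := 1) (hz1 m) (by rw [hz2 m]; exact hS.mem_reg_one ht)
    rw [hz2 m] at this
    simpa [slope] using this
  have h3 := ((hg _ z hz).div_const (deriv S.f t)).const_add (deriv S.τ t / deriv S.f t)
  have h4 := tendsto_nhds_unique (h1.congr h2) h3
  rw [h4]
  field_simp

/-- Transversality: the slopes along different inverse branches are not exponentially close. -/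
theorem exists_lt_abs_slope_sub (K : ℝ) : ∃ m, ∃ z₁ ∈ S.reg m, ∃ z₂ ∈ S.reg m,
    S.f^[m] z₁ = S.f^[m] z₂ ∧ K * Real.exp (-(lam * m)) < |S.slope m z₁ - S.slope m z₂| := by
  by_contra! hK
  obtain ⟨g, hgm, hgC, hg⟩ := hS.exists_limit_slope hK
  have hgi : ∀ x y : ℝ, IntervalIntegrable g volume x y := fun x y =>
    IntervalIntegrable.mono_fun' (g := fun _ => Cτ) intervalIntegrable_const
      hgm.aestronglyMeasurable (ae_of_all _ fun t => hgC t)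
  -- The transfer function is the primitive of the bounded limit slope g, hence Lipschitz with
  -- constant `Cτ`; the constant on O_i is read off at a chosen point of O_i.
  refine hS.not_cohomologous ⟨fun x => ∫ t in (0 : ℝ)..x, g t, Cτ.toNNReal,
    fun i => S.τ (hS.interval i).nonempty.some - (∫ t in (0 : ℝ)..S.f (hS.interval i).nonempty.some, g t) +
      ∫ t in (0 : ℝ)..(hS.interval i).nonempty.some, g t, ?_, ?_⟩
  · refine LipschitzOnWith.of_dist_le_mul fun x _ y _ => ?_
    rw [Real.dist_eq, Real.dist_eq, Real.coe_toNNReal _ hS.Cτ_nonneg,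
      intervalIntegral.integral_interval_sub_left (hgi _ _) (hgi _ _)]
    exact intervalIntegral.norm_integral_le_of_norm_le_const (f := g) fun t _ => hgC t
  · intro i
    -- The relation f'·(g∘f) = g + τ', valid off a countable set, is integrated over [x, y], and f
    -- is substituted; f may be increasing or decreasing there.
    have key : ∀ x ∈ S.O i, ∀ y ∈ S.O i, x ≤ y →
        (∫ t in S.f x..S.f y, g t) = (∫ t in x..y, g t) + (S.τ y - S.τ x) := by
      intro x hx y hy hxy
      have hsub : Icc x y ⊆ S.O i := (hS.interval i).ordConnected.out hx hy
      have hcont : ContinuousOn S.f (Icc x y) := (hS.f_contDiff i).continuousOn.mono hsub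
      have hd : ∀ t ∈ Icc x y, HasDerivWithinAt S.f (deriv S.f t) (Icc x y) t := fun t ht =>
        ((hS.contDiffAt_f (hsub ht)).differentiableAt (by norm_num)).hasDerivAt.hasDerivWithinAt
      have hτ : ∫ t in x..y, deriv S.τ t = S.τ y - S.τ x := by
        refine intervalIntegral.integral_eq_sub_of_hasDerivAt (fun t ht => ?_) ?_
        · rw [uIcc_of_le hxy] at ht
          exact ((hS.contDiffAt_τ (hsub ht)).differentiableAt (by norm_num)).hasDerivAt
        · refine ContinuousOn.intervalIntegrable fun t ht => ?_
          rw [uIcc_of_le hxy] at ht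
          exact (hS.contDiffAt_τ (hsub ht)).continuousAt_deriv_one.continuousWithinAt
      have hτi : IntervalIntegrable (deriv S.τ) volume x y := by
        refine ContinuousOn.intervalIntegrable fun t ht => ?_
        rw [uIcc_of_le hxy] at ht
        exact (hS.contDiffAt_τ (hsub ht)).continuousAt_deriv_one.continuousWithinAt
      have h1 : ∫ t in Icc x y, deriv S.f t * g (S.f t) = (∫ t in x..y, g t) + (S.τ y - S.τ x) := by
        rw [← hτ, ← intervalIntegral.integral_add (hgi _ _) hτi,
          intervalIntegral.integral_of_le hxy, ← integral_Icc_eq_integral_Ioc]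
        refine setIntegral_congr_ae measurableSet_Icc ?_
        filter_upwards [hS.countable_compl_backwardReg.ae_notMem volume] with t ht htI
        rw [hS.limit_slope_image hg (hsub htI)
          (by_contra fun h => ht ⟨(hS.interval i).subset_Ico (hsub htI), h⟩), add_comm]
      rw [← h1]
      rcases hcont.strictMonoOn_of_injOn_Icc' hxy ((hS.injOn_O i).mono hsub) with hm | hm
      · have h2 : S.f '' Icc x y = Icc (S.f x) (S.f y) :=
          hm.monotoneOn.image_Icc_subset.antisymm (intermediate_value_Icc hxy hcont)
        rw [intervalIntegral.integral_of_le (hm.monotoneOn (left_mem_Icc.2 hxy)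
          (right_mem_Icc.2 hxy) hxy), ← integral_Icc_eq_integral_Ioc, ← h2]
        exact integral_image_eq_integral_deriv_smul_of_monotoneOn measurableSet_Icc hd
          hm.monotoneOn g
      · have h2 : S.f '' Icc x y = Icc (S.f y) (S.f x) :=
          hm.antitoneOn.image_Icc_subset.antisymm (intermediate_value_Icc' hxy hcont)
        rw [intervalIntegral.integral_of_ge (hm.antitoneOn (left_mem_Icc.2 hxy)
          (right_mem_Icc.2 hxy) hxy), ← integral_Icc_eq_integral_Ioc, ← h2,
          integral_image_eq_integral_deriv_smul_of_antitoneOn measurableSet_Icc hd hm.antitoneOn g,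
          ← integral_neg]
        simp
    intro x hx
    have hp := (hS.interval i).nonempty.some_mem
    set p := (hS.interval i).nonempty.some
    have e1 := intervalIntegral.integral_interval_sub_left (hgi 0 (S.f x)) (hgi 0 (S.f p))
    have e2 := intervalIntegral.integral_interval_sub_left (hgi 0 x) (hgi 0 p)
    have e3 : (∫ t in S.f p..S.f x, g t) = (∫ t in p..x, g t) + (S.τ x - S.τ p) := by
      rcases le_total p x with h | h
      · exact key p hp x hx h
      · have := key x hx p hp h
        rw [intervalIntegral.integral_symm (S.f x), intervalIntegral.integral_symm x] 
        linarith
    linarith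

end IsAdmissible
end SkewProduct

/-! ### Transversal pairs of branches with uniform constants -/

namespace SkewProduct

variable {S : SkewProduct} {α lam D Cτ : ℝ} {b : ℝ}

/-- Two inverse branches of `f^n` that are defined on `(p, q)`, take values in `A` there, and have
transversal slopes. -/
structure IsTransversal (n : ℕ) (A : Set ℝ) (c v κ ε₀ : ℝ) (h₁ h₂ : S.Branch n) (p q : ℝ) :
    Prop where
  le_sub : v ≤ q - p
  sub_lt : q - p < ε₀
  subset₁ : Ioo p q ⊆ h₁.dom
  subset₂ : Ioo p q ⊆ h₂.dom
  mapsTo₁ : MapsTo h₁.map (Ioo p q) A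
  mapsTo₂ : MapsTo h₂.map (Ioo p q) A
  deriv₁ : ∀ x ∈ Ioo p q, κ ≤ |deriv h₁.map x|
  deriv₂ : ∀ x ∈ Ioo p q, κ ≤ |deriv h₂.map x|
  slope : ∀ x ∈ Ioo p q, c ≤ |S.slope n (h₁.map x) - S.slope n (h₂.map x)|

theorem IsTransversal.mono {n : ℕ} {A : Set ℝ} {c v κ ε₀ : ℝ} {h₁ h₂ : S.Branch n} {p q : ℝ}
    (h : S.IsTransversal n A c v κ ε₀ h₁ h₂ p q) {A' : Set ℝ} {v' κ' : ℝ} (hA : A ⊆ A')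
    (hv : v' ≤ v) (hκ : κ' ≤ κ) : S.IsTransversal n A' c v' κ' ε₀ h₁ h₂ p q :=
  ⟨hv.trans h.le_sub, h.sub_lt, h.subset₁, h.subset₂, h.mapsTo₁.mono_right hA,
    h.mapsTo₂.mono_right hA, fun x hx => hκ.trans (h.deriv₁ x hx),
    fun x hx => hκ.trans (h.deriv₂ x hx), h.slope⟩

namespace IsAdmissible

variable (hS : S.IsAdmissible α lam D Cτ)
include hS

theorem exp_mul_abs_deriv_map_le {n : ℕ} {h : S.Branch n} {x y : ℝ} (hx : x ∈ h.dom)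
    (hy : y ∈ h.dom) : Real.exp (-D) * |deriv h.map y| ≤ |deriv h.map x| := by
  have h1 := hS.distortion n h y hy x hx
  have hx0 := (hS.isOpenInterval_dom h).subset_Ioo hx
  have hy0 := (hS.isOpenInterval_dom h).subset_Ioo hy
  have h2 : |y - x| ^ α ≤ 1 := Real.rpow_le_one (abs_nonneg _) (by
    rw [abs_le]; constructor <;> linarith [hx0.1, hx0.2, hy0.1, hy0.2]) hS.alpha_pos.le
  have h3 : Real.exp (D * |y - x| ^ α) ≤ Real.exp D :=
    Real.exp_le_exp.2 (mul_le_of_le_one_right hS.D_nonneg h2)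
  have h4 := h1.trans h3
  rw [div_le_iff₀ (abs_pos.2 (hS.deriv_map_ne_zero hx))] at h4
  rw [Real.exp_neg, inv_mul_le_iff₀ (Real.exp_pos _)]
  exact h4

/-- Transversal branches with values in a given partition element. -/
theorem exists_isTransversal_cell {a ε₀ : ℝ} (ha : 0 ≤ a) (hε₀ : 0 < ε₀) : ∃ m : ℕ,
    ∀ {n N : ℕ} (k : S.Branch n), (Ico (0 : ℝ) 1 \ S.f^[N] '' k.cell).Countable →
    ∃ v κ : ℝ, 0 < v ∧ 0 < κ ∧ ∃ (h₁ h₂ : S.Branch (N + m)) (p q : ℝ),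
      S.IsTransversal (N + m) k.cell
        (Real.exp (-(lam * m)) + 2 * a * Real.exp (-(lam * (N + m : ℕ)))) v κ ε₀ h₁ h₂ p q := by
  -- In units of e^{-λm}: 2Cτ is lost when both branches are prolonged into the past, 2a pays for
  -- the phases of the density, and 1 remains as the transversality constant.
  obtain ⟨m, z₁, hz₁, z₂, hz₂, hzz, hlt⟩ := hS.exists_lt_abs_slope_sub (2 * Cτ + 2 * a + 1)
  refine ⟨m, fun {n N} k hk => ?_⟩
  obtain ⟨g₁, hg₁⟩ := exists_branch hz₁
  obtain ⟨g₂, hg₂⟩ := exists_branch hz₂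
  have hd₁ : S.f^[m] z₁ ∈ g₁.dom := Branch.iterate_mem_dom hg₁
  have hd₂ : S.f^[m] z₁ ∈ g₂.dom := hzz ▸ Branch.iterate_mem_dom hg₂
  have hcont : ∀ {n : ℕ} {h : S.Branch n} {x : ℝ}, x ∈ h.dom →
      ContinuousAt (fun y => S.slope n (h.map y)) x := fun {n h x} hx =>
    ContinuousAt.comp (g := S.slope n) (hS.continuousAt_slope (Branch.map_mem_reg hx))
      (hS.hasDerivAt_map hx).continuousAt
  have hev₁ : ∀ᶠ y in 𝓝 (S.f^[m] z₁), y ∈ g₁.dom ∧ y ∈ g₂.dom ∧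
      (2 * Cτ + 2 * a + 1) * Real.exp (-(lam * m)) <
        |S.slope m (g₁.map y) - S.slope m (g₂.map y)| := by
    have h1 : ContinuousAt (fun y => |S.slope m (g₁.map y) - S.slope m (g₂.map y)|) (S.f^[m] z₁) :=
      ((hcont hd₁).sub (hcont hd₂)).abs
    have h2 := h1.eventually (lt_mem_nhds (a := (2 * Cτ + 2 * a + 1) * Real.exp (-(lam * m))) (by
      beta_reduce
      rw [hS.map_iterate hg₁, hzz, hS.map_iterate hg₂]
      exact hlt))
    filter_upwards [(hS.isOpenInterval_dom g₁).isOpen.mem_nhds hd₁,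
      (hS.isOpenInterval_dom g₂).isOpen.mem_nhds hd₂, h2] with y h3 h4 h5 using ⟨h3, h4, h5⟩
  obtain ⟨l, r, hlr, hsub⟩ := mem_nhds_iff_exists_Ioo_subset.1 hev₁
  have hI : IsOpenInterval (Ioo l r) := isOpenInterval_of_isOpen ⟨_, hlr⟩ isOpen_Ioo
    isPreconnected_Ioo fun y hy => (hS.isOpenInterval_dom g₁).subset_Ico (hsub hy).1
  have hA : (Ico (0 : ℝ) 1 \ S.f^[N] '' (k.cell ∩ S.reg N)).Countable := by
    refine (hk.union ((hS.countable_compl_reg N).image S.f^[N])).mono fun x hx => ?_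
    by_cases h1 : x ∈ S.f^[N] '' k.cell
    · obtain ⟨z, hz, rfl⟩ := h1
      exact Or.inr ⟨z, ⟨reg_subset_Ico (k.cell_subset_reg hz), fun h => hx.2 ⟨z, ⟨hz, h⟩, rfl⟩⟩, rfl⟩
    · exact Or.inl ⟨hx.1, h1⟩
  -- With y outside the f^m-image of the countable exceptional set, every preimage g(y) under a
  -- branch of f^m has itself a regular N-th preimage in the given partition element.
  obtain ⟨y, hy, hyA⟩ := hI.exists_notMem_of_countable (hA.image S.f^[m])
  obtain ⟨hy₁, hy₂, hylt⟩ := hsub hy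
  -- A branch g of f^m is prolonged by N earlier steps that start in the given partition element.
  -- This changes the slope by at most Cτ e^{-λm}.
  have lift : ∀ g : S.Branch m, y ∈ g.dom → ∃ h : S.Branch (N + m), y ∈ h.dom ∧
      h.map y ∈ k.cell ∧ |S.slope (N + m) (h.map y) - S.slope m (g.map y)| ≤
        Cτ * Real.exp (-(lam * m)) := by
    intro g hg
    have hw : g.map y ∈ S.f^[N] '' (k.cell ∩ S.reg N) := by
      by_contra h
      exact hyA ⟨g.map y, ⟨reg_subset_Ico (Branch.map_mem_reg hg), h⟩, Branch.iterate_map hg⟩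
    obtain ⟨z, ⟨hzk, hzN⟩, hzw⟩ := hw
    have hzm : S.f^[N] z ∈ S.reg m := hzw ▸ Branch.map_mem_reg hg
    obtain ⟨h, hh⟩ := exists_branch (mem_reg_add hzN hzm)
    have hfz : S.f^[N + m] z = y := by
      rw [add_comm, Function.iterate_add_apply, hzw, Branch.iterate_map hg]
    have hmap : h.map y = z := by rw [← hfz]; exact hS.map_iterate hh
    refine ⟨h, hfz ▸ Branch.iterate_mem_dom hh, hmap.symm ▸ hzk, ?_⟩
    rw [hmap, hS.slope_add hzN hzm, hzw, add_sub_cancel_left, abs_div, Real.exp_neg,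
      ← div_eq_mul_inv]
    exact div_le_div₀ hS.Cτ_nonneg (hS.abs_slope_le hzN) (Real.exp_pos _)
      (hS.abs_deriv_ge (hzw ▸ hzm))
  obtain ⟨h₁, hh₁, hk₁, hs₁⟩ := lift g₁ hy₁
  obtain ⟨h₂, hh₂, hk₂, hs₂⟩ := lift g₂ hy₂
  have hylt' : Real.exp (-(lam * m)) + 2 * a * Real.exp (-(lam * (N + m : ℕ))) <
      |S.slope (N + m) (h₁.map y) - S.slope (N + m) (h₂.map y)| := by
    have e1 : Real.exp (-(lam * (N + m : ℕ))) ≤ Real.exp (-(lam * m)) := by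
      apply Real.exp_le_exp.2
      have : 0 ≤ lam * N := mul_nonneg hS.lam_pos.le (Nat.cast_nonneg N)
      push_cast
      nlinarith
    have e2 : 2 * a * Real.exp (-(lam * (N + m : ℕ))) ≤ 2 * a * Real.exp (-(lam * m)) := by gcongr
    have e3 : |S.slope m (g₁.map y) - S.slope m (g₂.map y)| ≤
        |S.slope (N + m) (h₁.map y) - S.slope (N + m) (h₂.map y)| +
          2 * (Cτ * Real.exp (-(lam * m))) := by
      rw [abs_le] at hs₁ hs₂
      rw [abs_le]
      have := abs_le.1 (le_refl |S.slope (N + m) (h₁.map y) - S.slope (N + m) (h₂.map y)|)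
      constructor <;> linarith [this.1, this.2, hs₁.1, hs₁.2, hs₂.1, hs₂.2]
    nlinarith
  have hev₂ : ∀ᶠ x in 𝓝 y, x ∈ h₁.dom ∧ x ∈ h₂.dom ∧ h₁.map x ∈ k.cell ∧ h₂.map x ∈ k.cell ∧
      Real.exp (-(lam * m)) + 2 * a * Real.exp (-(lam * (N + m : ℕ))) <
      |S.slope (N + m) (h₁.map x) - S.slope (N + m) (h₂.map x)| ∧ x ∈ Metric.ball y (ε₀ / 3) := by
    have h1 : ContinuousAt (fun x =>
      |S.slope (N + m) (h₁.map x) - S.slope (N + m) (h₂.map x)|) y :=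
      ((hcont hh₁).sub (hcont hh₂)).abs
    filter_upwards [(hS.isOpenInterval_dom h₁).isOpen.mem_nhds hh₁,
      (hS.isOpenInterval_dom h₂).isOpen.mem_nhds hh₂,
      (hS.hasDerivAt_map hh₁).continuousAt.eventually ((hS.isOpen_cell k).mem_nhds hk₁),
      (hS.hasDerivAt_map hh₂).continuousAt.eventually ((hS.isOpen_cell k).mem_nhds hk₂),
      h1.eventually (lt_mem_nhds hylt'), Metric.ball_mem_nhds y (ε := ε₀ / 3) (by positivity)]
      with x e1 e2 e3 e4 e5 e6 using ⟨e1, e2, e3, e4, e5, e6⟩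
  obtain ⟨p, q, hpq, hsub₂⟩ := mem_nhds_iff_exists_Ioo_subset.1 hev₂
  -- (p, q) is contained in the ball of radius ε₀/3 about y.
  have hlen : q - p < ε₀ := by
    by_contra! hge
    have e1 : max p (y - ε₀ / 3) < q := max_lt (hpq.1.trans hpq.2) (by linarith [hpq.2])
    rcases le_or_gt (q - y) (ε₀ / 3) with h | h
    · have h1 : y - ε₀ / 3 ∈ Ioo p q := ⟨by linarith, by linarith [hpq.2]⟩
      have h2 := (hsub₂ h1).2.2.2.2.2
      rw [Metric.mem_ball, Real.dist_eq, sub_sub_cancel_left, abs_neg, abs_of_pos (by positivity)]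
        at h2
      exact lt_irrefl _ h2
    · have h1 : y + ε₀ / 3 ∈ Ioo p q := ⟨by linarith [hpq.1], by linarith⟩
      have h2 := (hsub₂ h1).2.2.2.2.2
      rw [Metric.mem_ball, Real.dist_eq, add_sub_cancel_left, abs_of_pos (by positivity)] at h2
      exact lt_irrefl _ h2
  have hp₁ := abs_pos.2 (hS.deriv_map_ne_zero hh₁)
  have hp₂ := abs_pos.2 (hS.deriv_map_ne_zero hh₂)
  refine ⟨q - p, Real.exp (-D) * min |deriv h₁.map y| |deriv h₂.map y|,
    by linarith [hpq.1, hpq.2], mul_pos (Real.exp_pos _) (lt_min hp₁ hp₂), h₁, h₂, p, q,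
    le_rfl, hlen, fun x hx => (hsub₂ hx).1, fun x hx => (hsub₂ hx).2.1,
    fun x hx => (hsub₂ hx).2.2.1, fun x hx => (hsub₂ hx).2.2.2.1, fun x hx => ?_, fun x hx => ?_,
    fun x hx => (hsub₂ hx).2.2.2.2.1.le⟩
  · refine le_trans ?_ (hS.exp_mul_abs_deriv_map_le (hsub₂ hx).1 hh₁)
    gcongr
    exact min_le_left _ _
  · refine le_trans ?_ (hS.exp_mul_abs_deriv_map_le (hsub₂ hx).2.1 hh₂)
    gcongr
    exact min_le_right _ _

/-- Every interval of length at least `δ` contains the images of a pair of transversal branches,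
with uniform constants. -/
theorem exists_isTransversal {a δ ε₀ : ℝ} (ha : 0 ≤ a) (hδ : 0 < δ) (hε₀ : 0 < ε₀) :
    ∃ (n : ℕ) (c v κ : ℝ), 0 < c ∧ 0 < v ∧ 0 < κ ∧ ∀ l r : ℝ, 0 ≤ l → r ≤ 1 → δ ≤ r - l →
      ∃ (h₁ h₂ : S.Branch n) (p q : ℝ), S.IsTransversal n (Ioo l r)
        (c + 2 * a * Real.exp (-(lam * n))) v κ ε₀ h₁ h₂ p q := by
  obtain ⟨m, hm⟩ := hS.exists_isTransversal_cell ha hε₀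
  -- On the grid of mesh 1/M < δ/3, every interval of length δ contains a full grid cell. Finitely
  -- many cells suffice, so minima over them give uniform v and κ; N is uniform by the covering
  -- assumption and m does not depend on the cell.
  obtain ⟨M, hM⟩ := exists_nat_gt (3 / δ)
  have hM0 : (0 : ℝ) < M := (by positivity : 0 < 3 / δ).trans hM
  have hM0' : 0 < M := by exact_mod_cast hM0
  have hMδ : 3 / M < δ := by
    rw [div_lt_iff₀ hδ] at hM
    rw [div_lt_iff₀ hM0]
    linarith
  obtain ⟨n, hn⟩ := (hS.tendsto_exp_neg.eventually
    (gt_mem_nhds (by positivity : (0 : ℝ) < 1 / (4 * M)))).exists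
  obtain ⟨N, hN⟩ := hS.covering n
  -- Partition elements of f^n have diameter below 1/(4M), so one that meets the middle half of a
  -- grid cell stays inside the cell.
  have hcell : ∀ i : Fin M, ∃ k : S.Branch n, k.cell ⊆ Ioo ((i : ℝ) / M) ((i + 1) / M) := by
    intro i
    have hi : ((i : ℕ) : ℝ) + 1 ≤ M := by exact_mod_cast i.2
    have e0 : 0 < 1 / (4 * (M : ℝ)) := by positivity
    have e1 : (i : ℝ) / M + 4 * (1 / (4 * M)) = (i + 1) / M := by field_simp
    have e2 : ((i : ℝ) + 1) / M ≤ 1 := (div_le_one hM0).2 hi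
    have e3 : (0 : ℝ) ≤ (i : ℝ) / M := by positivity
    have hI : IsOpenInterval (Ioo ((i : ℝ) / M + 1 / (4 * M)) ((i : ℝ) / M + 3 * (1 / (4 * M)))) :=
      ⟨_, _, by linarith, by linarith, by linarith, rfl⟩
    obtain ⟨x, hx, hxr⟩ := hS.exists_mem_reg hI n
    obtain ⟨k, hk⟩ := exists_branch hxr
    refine ⟨k, fun y hy => ?_⟩
    have h1 := abs_le.1 (hS.abs_sub_le_of_mem_cell hy hk)
    exact ⟨by linarith [hx.1, h1.1], by linarith [hx.2, h1.2]⟩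
  choose k hk using hcell
  choose v κ hv hκ h₁ h₂ p q hT using fun i => hm (k i) (hN (k i))
  have : Nonempty (Fin M) := ⟨⟨0, hM0'⟩⟩
  obtain ⟨i₁, hi₁⟩ := Finite.exists_min v
  obtain ⟨i₂, hi₂⟩ := Finite.exists_min κ
  refine ⟨N + m, Real.exp (-(lam * m)), v i₁, κ i₂, Real.exp_pos _, hv _, hκ _,
    fun l r hl hr hlr => ?_⟩
  have f1 := Nat.floor_le (mul_nonneg hl hM0.le)
  have f2 := Nat.lt_floor_add_one (l * M)
  have hsub : ((⌊l * M⌋₊ + 1 : ℕ) + 1 : ℝ) / M ≤ r := by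
    rw [div_le_iff₀ hM0]
    rw [div_lt_iff₀ hM0] at hMδ
    push_cast
    nlinarith
  have hlt : ⌊l * M⌋₊ + 1 < M := by
    have h1 : ((⌊l * M⌋₊ + 1 : ℕ) + 1 : ℝ) ≤ M := by
      rw [div_le_iff₀ hM0] at hsub
      nlinarith
    exact_mod_cast h1
  -- The `+ 1` makes the left end of the grid cell lie to the right of l.
  let i : Fin M := ⟨⌊l * M⌋₊ + 1, hlt⟩
  refine ⟨h₁ i, h₂ i, p i, q i, (hT i).mono ((hk i).trans (Ioo_subset_Ioo ?_ hsub)) (hi₁ i) (hi₂ i)⟩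
  rw [le_div_iff₀ hM0]
  simp only [i]
  push_cast
  exact f2.le

end IsAdmissible
end SkewProduct

/-! ### Sums of two densities with almost opposite phases -/

theorem abs_log_sub_sub_log_sub_le {r r' s : ℝ} (hs : 0 < s) (hr : 2 * s ≤ r) (hr' : 2 * s ≤ r') :
    |Real.log (r - s) - Real.log (r' - s)| ≤ 2 * |Real.log r - Real.log r'| := by
  have key : ∀ r r' : ℝ, 2 * s ≤ r → 2 * s ≤ r' → r' ≤ r →
      |Real.log (r - s) - Real.log (r' - s)| ≤ 2 * |Real.log r - Real.log r'| := by
    intro r r' hr hr' hle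
    have h0 : 0 < r' := by linarith
    have h1 : 0 < r := by linarith
    have h2 : 0 < r' - s := by linarith
    have h3 : 0 < r - s := by linarith
    rw [abs_of_nonneg (sub_nonneg.2 (Real.log_le_log h2 (by linarith))),
      abs_of_nonneg (sub_nonneg.2 (Real.log_le_log h0 hle)), ← Real.log_div h3.ne' h2.ne',
      ← Real.log_div h1.ne' h0.ne']
    have : Real.log ((r / r') ^ 2) = 2 * Real.log (r / r') := by
      rw [Real.log_pow]; norm_num
    rw [← this]
    refine Real.log_le_log (div_pos h3 h2) ?_
    rw [div_pow, div_le_div_iff₀ h2 (by positivity)]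
    -- For r' ≤ r this is equivalent, up to the factor r − r', to (r − s)/(r' − s) ≤ (r/r')²; it
    -- holds because s is at most half of r and of r'.
    have h4 : s * (r + r') ≤ r * r' := by nlinarith
    nlinarith [mul_le_mul_of_nonneg_left h4 (sub_nonneg.2 hle)]
  rcases le_total r' r with h | h
  · exact key r r' hr hr' h
  · rw [abs_sub_comm, abs_sub_comm (Real.log r)]
    exact key r' r hr' hr h

/-- Twice the cosine becomes twice a sine of an angle at most π/8, and π/4 < 4/5. Staying away from
1 keeps the derivative of arccos bounded in what follows. -/
theorem abs_two_mul_cos_half_le {ψ : ℝ} {k : ℤ} (h : |ψ - (2 * k + 1) * Real.pi| ≤ Real.pi / 4) :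
    |2 * Real.cos (ψ / 2)| ≤ 4 / 5 := by
  set u := (ψ - (2 * k + 1) * Real.pi) / 2 with hu
  have h1 : ψ / 2 = u + Real.pi / 2 + k * Real.pi := by rw [hu]; ring
  have h2 : |Real.cos (ψ / 2)| = |Real.sin u| := by
    rw [h1, Real.cos_add_int_mul_pi, Real.cos_add_pi_div_two, abs_mul, abs_neg]
    simp
  have h3 : |u| ≤ Real.pi / 8 := by
    rw [hu, abs_div, abs_two]; linarith
  rw [abs_mul, abs_two, h2]
  have h4 := Real.abs_sin_le_abs (x := u)
  linarith [Real.pi_lt_d2]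

/-- A sum of two almost opposite unit vectors is a half sum of two other unit vectors. -/
theorem exp_add_exp_eq {θ₁ θ₂ : ℝ} (h : |2 * Real.cos ((θ₁ - θ₂) / 2)| ≤ 4 / 5) :
    Complex.exp (Complex.I * θ₁) + Complex.exp (Complex.I * θ₂) =
      1 / 2 * Complex.exp (Complex.I * ((θ₁ + θ₂) / 2 +
        Real.arccos (2 * Real.cos ((θ₁ - θ₂) / 2)) : ℝ)) +
      1 / 2 * Complex.exp (Complex.I * ((θ₁ + θ₂) / 2 -
        Real.arccos (2 * Real.cos ((θ₁ - θ₂) / 2)) : ℝ)) := by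
  -- Both sides equal 2 cos((θ₁ − θ₂)/2) times the exponential of the mean phase, because φ is
  -- chosen with cos φ = 2 cos((θ₁ − θ₂)/2). Unlike the left side, the summands on the right have
  -- constant modulus, so they never vanish.
  have hc : Real.cos (Real.arccos (2 * Real.cos ((θ₁ - θ₂) / 2))) = 2 * Real.cos ((θ₁ - θ₂) / 2) :=
    Real.cos_arccos (by linarith [(abs_le.1 h).1]) (by linarith [(abs_le.1 h).2])
  set φ := Real.arccos (2 * Real.cos ((θ₁ - θ₂) / 2))
  have key : ∀ x y : ℝ, Complex.exp (Complex.I * (x + y : ℝ)) + Complex.exp (Complex.I * (x - y : ℝ)) =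
      Complex.exp (Complex.I * x) * (2 * Real.cos y : ℝ) := by
    intro x y
    push_cast
    rw [Complex.two_cos, mul_add, mul_sub, sub_eq_add_neg, Complex.exp_add, Complex.exp_add]
    ring_nf
  have e1 := key ((θ₁ + θ₂) / 2) ((θ₁ - θ₂) / 2)
  have e2 := key ((θ₁ + θ₂) / 2) φ
  rw [show (θ₁ + θ₂) / 2 + (θ₁ - θ₂) / 2 = θ₁ by ring,
    show (θ₁ + θ₂) / 2 - (θ₁ - θ₂) / 2 = θ₂ by ring] at e1
  rw [← mul_add, e2, e1, hc]
  push_cast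
  ring

theorem hasDerivAt_arccos_two_mul_cos {ψ : ℝ → ℝ} {ψ' x : ℝ} (hψ : HasDerivAt ψ ψ' x)
    (h : |2 * Real.cos (ψ x / 2)| ≤ 4 / 5) :
    ∃ d, HasDerivAt (fun x => Real.arccos (2 * Real.cos (ψ x / 2))) d x ∧ |d| ≤ 2 * |ψ'| := by
  have hb := abs_le.1 h
  have h1 : HasDerivAt (fun x => 2 * Real.cos (ψ x / 2)) (2 * (-Real.sin (ψ x / 2) * (ψ' / 2))) x :=
    ((hψ.div_const 2).cos).const_mul 2
  have h2 := (Real.hasDerivAt_arccos (x := 2 * Real.cos (ψ x / 2)) (by linarith) (by linarith)).comp x h1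
  refine ⟨_, h2, ?_⟩
  -- The square root is at least √(1 − 16/25) = 3/5, which bounds the derivative of arccos by 2.
  have h3 : 1 / 2 ≤ Real.sqrt (1 - (2 * Real.cos (ψ x / 2)) ^ 2) := by
    apply Real.le_sqrt_of_sq_le
    nlinarith
  rw [abs_mul, abs_neg, abs_div, abs_one, abs_of_nonneg (Real.sqrt_nonneg _)]
  have h4 : 1 / Real.sqrt (1 - (2 * Real.cos (ψ x / 2)) ^ 2) ≤ 2 := by
    rw [div_le_iff₀ (by linarith)]; linarith
  have h5 : |2 * (-Real.sin (ψ x / 2) * (ψ' / 2))| ≤ |ψ'| := by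
    rw [show 2 * (-Real.sin (ψ x / 2) * (ψ' / 2)) = -(Real.sin (ψ x / 2) * ψ') by ring, abs_neg,
      abs_mul]
    exact mul_le_of_le_one_left (abs_nonneg _) (Real.abs_sin_le_one _)
  exact mul_le_mul h4 h5 (abs_nonneg _) (by norm_num)

/-- `θ` is a determination of the argument of `ρ` on `I` with derivative at most `A`. -/
def HasPhase (A : ℝ) (I : Set ℝ) (ρ : ℝ → ℂ) (θ : ℝ → ℝ) : Prop :=
  ∀ x ∈ I, ρ x = ‖ρ x‖ * Complex.exp (Complex.I * θ x) ∧ DifferentiableAt ℝ θ x ∧ |deriv θ x| ≤ A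

theorem isRegularOn_ofReal_mul_exp {α a b : ℝ} {I : Set ℝ} {r θ : ℝ → ℝ} (hr : ∀ x ∈ I, 0 < r x)
    (hr' : ∀ x ∈ I, ∀ y ∈ I, |Real.log (r x) - Real.log (r y)| ≤ a * |x - y| ^ α)
    (hθ : ∀ x ∈ I, ∃ d, HasDerivAt θ d x ∧ |d| ≤ a * |b|) :
    IsRegularOn α a b I fun x => (r x : ℂ) * Complex.exp (Complex.I * θ x) := by
  have hn : ∀ x ∈ I, ‖(r x : ℂ) * Complex.exp (Complex.I * θ x)‖ = r x := fun x hx => by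
    rw [norm_mul, Complex.norm_real, Real.norm_of_nonneg (hr x hx).le, mul_comm Complex.I,
      Complex.norm_exp_ofReal_mul_I, mul_one]
  refine ⟨fun x hx => ?_, fun x hx y hy => ?_, θ, fun x hx => ?_⟩
  · rw [← norm_pos_iff, hn x hx]; exact hr x hx
  · rw [hn x hx, hn y hy]; exact hr' x hx y hy
  · obtain ⟨d, hd, hd'⟩ := hθ x hx
    exact ⟨by rw [hn x hx], hd.differentiableAt, by rwa [hd.deriv]⟩

section

variable {α a b ε₀ R s : ℝ} {p₁ p₂ : ℝ → ℂ} {θ₁ θ₂ : ℝ → ℝ}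

/-- The sum of two regular functions, without cancellation. -/
theorem decomposes_add {u w : ℝ} (hα : 0 < α) (hu : 0 ≤ u) (hw : w ≤ 1) (huw : w - u < ε₀)
    (hε₀ : 0 < ε₀) (hε₁ : ε₀ ≤ 1) (h₁ : IsRegularOn α a b (Ioo u w) p₁)
    (h₂ : IsRegularOn α a b (Ioo u w) p₂) (hR₁ : ∀ x ∈ Ioo u w, ‖p₁ x‖ ≤ R)
    (hR₂ : ∀ x ∈ Ioo u w, ‖p₂ x‖ ≤ R) :
    Decomposes α a b ε₀ (indicator (Ioo u w) fun x => p₁ x + p₂ x)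
      ((∫⁻ x in Ioo u w, ‖p₁ x‖ₑ) + ∫⁻ x in Ioo u w, ‖p₂ x‖ₑ) (2 * ENNReal.ofReal R) := by
  have hfin : ∀ p : ℝ → ℂ, (∀ x ∈ Ioo u w, ‖p x‖ ≤ R) → ∫⁻ x in Ioo u w, ‖p x‖ₑ ≠ ∞ := by
    intro p hp
    refine ne_top_of_le_ne_top (b := ENNReal.ofReal R * volume (Ioo u w)) ?_ ?_
    · exact ENNReal.mul_ne_top (by simp) (by simp)
    · rw [← setLIntegral_const]
      refine setLIntegral_mono' measurableSet_Ioo fun x hx => ?_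
      rw [← ofReal_norm]
      exact ENNReal.ofReal_le_ofReal (hp x hx)
  rw [two_mul, indicator_add]
  exact (Decomposes.single hα hu hw huw hε₀ hε₁ h₁ hR₁).add
    (Decomposes.single hα hu hw huw hε₀ hε₁ h₂ hR₂) (hfin _ hR₁) (hfin _ hR₂)

theorem lintegral_enorm_ofReal_mul_exp {J : Set ℝ} (hJ : MeasurableSet J) {r : ℝ → ℝ} {θ : ℝ → ℝ}
    (hr : ∀ x ∈ J, 0 ≤ r x) :
    ∫⁻ x in J, ‖(r x : ℂ) * Complex.exp (Complex.I * θ x)‖ₑ = ∫⁻ x in J, ENNReal.ofReal (r x) := by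
  refine setLIntegral_congr_fun hJ fun x hx => ?_
  rw [← ofReal_norm, norm_mul, Complex.norm_real, Real.norm_of_nonneg (hr x hx), mul_comm Complex.I,
    Complex.norm_exp_ofReal_mul_I, mul_one]

/-- The sum of two regular functions with almost opposite phases. -/
theorem decomposes_add_of_opposite {u w : ℝ} (hα : 0 < α) (ha : 0 ≤ a) (hu : 0 ≤ u) (hw : w ≤ 1)
    (huw : w - u < ε₀) (hε₀ : 0 < ε₀) (hε₁ : ε₀ ≤ 1) (h₁ : IsRegularOn α a b (Ioo u w) p₁)
    (h₂ : IsRegularOn α a b (Ioo u w) p₂) (hθ₁ : HasPhase (a * |b|) (Ioo u w) p₁ θ₁)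
    (hθ₂ : HasPhase (a * |b|) (Ioo u w) p₂ θ₂)
    (hR₁ : ∀ x ∈ Ioo u w, ‖p₁ x‖ ≤ R) (hR₂ : ∀ x ∈ Ioo u w, ‖p₂ x‖ ≤ R) (hs : 0 < s)
    (hs₁ : ∀ x ∈ Ioo u w, 2 * s ≤ ‖p₁ x‖) (hs₂ : ∀ x ∈ Ioo u w, 2 * s ≤ ‖p₂ x‖)
    (hcos : ∀ x ∈ Ioo u w, |2 * Real.cos ((θ₁ x - θ₂ x) / 2)| ≤ 4 / 5) :
    ∃ W, Decomposes α (5 * a) b ε₀ (indicator (Ioo u w) fun x => p₁ x + p₂ x) W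
        (4 * ENNReal.ofReal R) ∧
      W + ENNReal.ofReal (s * (w - u)) ≤
        (∫⁻ x in Ioo u w, ‖p₁ x‖ₑ) + ∫⁻ x in Ioo u w, ‖p₂ x‖ₑ := by
  have hab : 0 ≤ a * |b| := mul_nonneg ha (abs_nonneg b)
  have hJ : MeasurableSet (Ioo u w) := measurableSet_Ioo
  rcases le_or_gt w u with hle | hlt
  · refine ⟨0, ?_, ?_⟩
    · rw [Ioo_eq_empty (not_lt.2 hle), indicator_empty]
      exact Decomposes.zero.mono le_rfl le_rfl zero_le
    · rw [ENNReal.ofReal_of_nonpos (by nlinarith), add_zero]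
      exact zero_le
  have hRs : s / 2 ≤ R := by
    have hm : (u + w) / 2 ∈ Ioo u w := ⟨by linarith, by linarith⟩
    linarith [hs₁ _ hm, hR₁ _ hm]
  -- The derivative of φ is at most 4a|b| and that of the mean phase at most a|b|; their sum
  -- explains the constant 5a.
  let φ : ℝ → ℝ := fun x => Real.arccos (2 * Real.cos ((θ₁ x - θ₂ x) / 2))
  have hφ : ∀ x ∈ Ioo u w, ∃ d, HasDerivAt φ d x ∧ |d| ≤ 4 * (a * |b|) := by
    intro x hx
    obtain ⟨d, hd, hd'⟩ := hasDerivAt_arccos_two_mul_cos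
      ((hθ₁ x hx).2.1.hasDerivAt.sub (hθ₂ x hx).2.1.hasDerivAt) (hcos x hx)
    refine ⟨d, hd, hd'.trans ?_⟩
    have := abs_sub (deriv θ₁ x) (deriv θ₂ x)
    linarith [(hθ₁ x hx).2.2, (hθ₂ x hx).2.2]
  have havg : ∀ x ∈ Ioo u w, ∃ d, HasDerivAt (fun x => (θ₁ x + θ₂ x) / 2) d x ∧ |d| ≤ a * |b| := by
    intro x hx
    refine ⟨_, ((hθ₁ x hx).2.1.hasDerivAt.add (hθ₂ x hx).2.1.hasDerivAt).div_const 2, ?_⟩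
    rw [abs_div, abs_two]
    have := abs_add_le (deriv θ₁ x) (deriv θ₂ x)
    linarith [(hθ₁ x hx).2.2, (hθ₂ x hx).2.2]
  have hreg : ∀ (p : ℝ → ℂ) (θ : ℝ → ℝ), IsRegularOn α a b (Ioo u w) p →
      HasPhase (a * |b|) (Ioo u w) p θ → (∀ x ∈ Ioo u w, 2 * s ≤ ‖p x‖) →
      IsRegularOn α (5 * a) b (Ioo u w)
        fun x => ((‖p x‖ - s : ℝ) : ℂ) * Complex.exp (Complex.I * θ x) := by
    intro p θ hp hθ hps
    refine isRegularOn_ofReal_mul_exp (fun x hx => by linarith [hps x hx]) (fun x hx y hy => ?_)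
      fun x hx => ⟨_, (hθ x hx).2.1.hasDerivAt, by linarith [(hθ x hx).2.2]⟩
    refine (abs_log_sub_sub_log_sub_le hs (hps x hx) (hps y hy)).trans ?_
    have h1 := hp.modulus x hx y hy
    have h2 : 0 ≤ a * |x - y| ^ α := mul_nonneg ha (Real.rpow_nonneg (abs_nonneg _) _)
    linarith
  have hconst : ∀ θ : ℝ → ℝ, (∀ x ∈ Ioo u w, ∃ d, HasDerivAt θ d x ∧ |d| ≤ 5 * a * |b|) →
      IsRegularOn α (5 * a) b (Ioo u w)
        fun x => ((s / 2 : ℝ) : ℂ) * Complex.exp (Complex.I * θ x) := by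
    intro θ hθ
    refine isRegularOn_ofReal_mul_exp (r := fun _ => s / 2) (fun x _ => by positivity)
      (fun x _ y _ => ?_) hθ
    rw [sub_self, abs_zero]
    positivity
  have hplus := hconst (fun x => (θ₁ x + θ₂ x) / 2 + φ x) fun x hx => by
    obtain ⟨d, hd, hd'⟩ := havg x hx
    obtain ⟨e, he, he'⟩ := hφ x hx
    exact ⟨_, hd.add he, (abs_add_le _ _).trans (by linarith)⟩
  have hminus := hconst (fun x => (θ₁ x + θ₂ x) / 2 - φ x) fun x hx => by
    obtain ⟨d, hd, hd'⟩ := havg x hx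
    obtain ⟨e, he, he'⟩ := hφ x hx
    exact ⟨_, hd.sub he, (abs_sub _ _).trans (by linarith)⟩
  have hnorm : ∀ (r : ℝ) (t : ℝ), 0 ≤ r → ‖(r : ℂ) * Complex.exp (Complex.I * t)‖ = r := by
    intro r t hr
    rw [norm_mul, Complex.norm_real, Real.norm_of_nonneg hr, mul_comm Complex.I,
      Complex.norm_exp_ofReal_mul_I, mul_one]
  -- Each modulus is lowered by s, with the phases kept. The part split off, s e^{iθ₁} + s e^{iθ₂},
  -- is replaced in `d2` by two functions of modulus s/2, so its mass density drops from 2s to s.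
  have d1 := decomposes_add hα hu hw huw hε₀ hε₁ (hreg p₁ θ₁ h₁ hθ₁ hs₁) (hreg p₂ θ₂ h₂ hθ₂ hs₂)
    (fun x hx => by rw [hnorm _ _ (by linarith [hs₁ x hx])]; linarith [hR₁ x hx])
    (fun x hx => by rw [hnorm _ _ (by linarith [hs₂ x hx])]; linarith [hR₂ x hx])
  have d2 := decomposes_add (R := R) hα hu hw huw hε₀ hε₁ hplus hminus
    (fun x hx => by rw [hnorm _ _ (by positivity)]; exact hRs)
    (fun x hx => by rw [hnorm _ _ (by positivity)]; exact hRs)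
  have hsave : ∀ p : ℝ → ℂ, IsRegularOn α a b (Ioo u w) p → (∀ x ∈ Ioo u w, 2 * s ≤ ‖p x‖) →
      (∫⁻ x in Ioo u w, ENNReal.ofReal (‖p x‖ - s)) + ENNReal.ofReal (s * (w - u)) =
        ∫⁻ x in Ioo u w, ‖p x‖ₑ := by
    intro p hp hps
    rw [ENNReal.ofReal_mul hs.le, ← Real.volume_Ioo, ← setLIntegral_const,
      ← lintegral_add_right _ measurable_const]
    refine setLIntegral_congr_fun hJ fun x hx => ?_
    rw [← ENNReal.ofReal_add (by linarith [hps x hx]) hs.le, sub_add_cancel, ofReal_norm]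
  have hhalf : (∫⁻ _ in Ioo u w, ENNReal.ofReal (s / 2)) + (∫⁻ _ in Ioo u w, ENNReal.ofReal (s / 2)) =
      ENNReal.ofReal (s * (w - u)) := by
    rw [setLIntegral_const, Real.volume_Ioo, ← ENNReal.ofReal_mul (by positivity),
      ← ENNReal.ofReal_add (mul_nonneg (by positivity) (by linarith))
        (mul_nonneg (by positivity) (by linarith))]
    congr 1
    ring
  have e₁ := hsave p₁ h₁ hs₁
  have e₂ := hsave p₂ h₂ hs₂
  rw [lintegral_enorm_ofReal_mul_exp hJ fun x hx => by linarith [hs₁ x hx],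
    lintegral_enorm_ofReal_mul_exp hJ fun x hx => by linarith [hs₂ x hx]] at d1
  rw [lintegral_enorm_ofReal_mul_exp (r := fun _ => s / 2) hJ fun x hx => by positivity,
    lintegral_enorm_ofReal_mul_exp (r := fun _ => s / 2) hJ fun x hx => by positivity, hhalf] at d2
  have hfin₁ : (∫⁻ x in Ioo u w, ENNReal.ofReal (‖p₁ x‖ - s)) ≠ ∞ := by
    refine ne_top_of_le_ne_top (h₁.integrableOn hα ⟨u, w, hu, hlt, hw, rfl⟩ hR₁).2.ne ?_
    rw [← e₁]; exact le_self_add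
  have hfin₂ : (∫⁻ x in Ioo u w, ENNReal.ofReal (‖p₂ x‖ - s)) ≠ ∞ := by
    refine ne_top_of_le_ne_top (h₂.integrableOn hα ⟨u, w, hu, hlt, hw, rfl⟩ hR₂).2.ne ?_
    rw [← e₂]; exact le_self_add
  refine ⟨_, ((d1.add d2 (ENNReal.add_ne_top.2 ⟨hfin₁, hfin₂⟩) (by simp)).congr_ae
    (ae_of_all _ fun x => ?_)).mono le_rfl le_rfl (le_of_eq (by ring)), le_of_eq ?_⟩
  · by_cases hx : x ∈ Ioo u w
    · simp only [indicator_of_mem hx]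
      have e := exp_add_exp_eq (hcos x hx)
      conv_lhs => rw [(hθ₁ x hx).1, (hθ₂ x hx).1]
      push_cast
      have e' := congrArg (fun z : ℂ => (s : ℂ) * z) e
      simp only [φ]
      push_cast at e'
      linear_combination e'
    · simp only [indicator_of_notMem hx, add_zero]
  · rw [← e₁, ← e₂]
    ring

end

/-! ### Cancellation at scale 1/|b| -/

theorem exists_eq_two_mul_add_one_mul_pi {m M : ℝ} (h : m + 2 * Real.pi ≤ M) :
    ∃ k : ℤ, (2 * k + 1) * Real.pi ∈ Icc m M := by
  have hπ := Real.pi_pos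
  refine ⟨⌈(m - Real.pi) / (2 * Real.pi)⌉, ?_, ?_⟩
  · have := Int.le_ceil ((m - Real.pi) / (2 * Real.pi))
    rw [div_le_iff₀ (by positivity)] at this
    linarith
  · have := Int.ceil_lt_add_one ((m - Real.pi) / (2 * Real.pi))
    rw [← sub_lt_iff_lt_add, lt_div_iff₀ (by positivity)] at this
    linarith

/-- A function with large derivative takes a value in `π + 2πℤ`. -/
theorem exists_eq_odd_mul_pi {ψ : ℝ → ℝ} {p q A : ℝ} (hpq : p < q)
    (hψ : ∀ x ∈ Icc p q, DifferentiableAt ℝ ψ x) (hA : ∀ x ∈ Icc p q, A ≤ |deriv ψ x|)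
    (h : 2 * Real.pi ≤ A * (q - p)) :
    ∃ x ∈ Icc p q, ∃ k : ℤ, ψ x = (2 * k + 1) * Real.pi := by
  have hc : ContinuousOn ψ (uIcc p q) := by
    rw [uIcc_of_le hpq.le]
    exact fun x hx => (hψ x hx).continuousAt.continuousWithinAt
  obtain ⟨x, hx, hd⟩ := exists_deriv_eq_slope ψ hpq (by rwa [uIcc_of_le hpq.le] at hc)
    fun x hx => (hψ x (Ioo_subset_Icc_self hx)).differentiableWithinAt
  have h1 : 2 * Real.pi ≤ |ψ q - ψ p| := by
    have h2 := hA x (Ioo_subset_Icc_self hx)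
    rw [hd, abs_div, abs_of_pos (sub_pos.2 hpq), le_div_iff₀ (sub_pos.2 hpq)] at h2
    exact h.trans h2
  have h3 : min (ψ p) (ψ q) + 2 * Real.pi ≤ max (ψ p) (ψ q) := by
    rw [← max_sub_min_eq_abs] at h1
    linarith [min_comm (ψ p) (ψ q), max_comm (ψ p) (ψ q)]
  obtain ⟨k, hk⟩ := exists_eq_two_mul_add_one_mul_pi h3
  obtain ⟨x, hx, hxk⟩ := intermediate_value_uIcc hc hk
  rw [uIcc_of_le hpq.le] at hx
  exact ⟨x, hx, k, hxk⟩

/-- `p₁ + p₂` can be decomposed on `(u, w)` in such a way that the total weight is at most the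
integral of `‖p₁‖ + ‖p₂‖` minus `σ`. -/
def CancelsOn (α a b ε₀ : ℝ) (p₁ p₂ : ℝ → ℂ) (u w : ℝ) (Q σ : ℝ≥0∞) : Prop :=
  ∃ W, W ≠ ∞ ∧ Decomposes α a b ε₀ (indicator (Ioo u w) fun x => p₁ x + p₂ x) W Q ∧
    W + σ ≤ (∫⁻ x in Ioo u w, ‖p₁ x‖ₑ) + ∫⁻ x in Ioo u w, ‖p₂ x‖ₑ

namespace CancelsOn

variable {α a b ε₀ : ℝ} {p₁ p₂ : ℝ → ℂ} {u v w : ℝ} {Q Q' σ σ' : ℝ≥0∞}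

theorem mono (h : CancelsOn α a b ε₀ p₁ p₂ u w Q σ) (hQ : Q ≤ Q') (hσ : σ' ≤ σ) :
    CancelsOn α a b ε₀ p₁ p₂ u w Q' σ' := by
  obtain ⟨W, hW, h1, h2⟩ := h
  exact ⟨W, hW, h1.mono le_rfl le_rfl hQ, le_trans (by gcongr) h2⟩

theorem empty (h : w ≤ u) : CancelsOn α a b ε₀ p₁ p₂ u w 0 0 := by
  refine ⟨0, by simp, ?_, by simp⟩
  rw [Ioo_eq_empty (not_lt.2 h), indicator_empty]
  exact Decomposes.zero

theorem setLIntegral_Ioo_add_le {g : ℝ → ℝ≥0∞} (huv : u ≤ v) (hvw : v ≤ w) :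
    (∫⁻ x in Ioo u v, g x) + ∫⁻ x in Ioo v w, g x ≤ ∫⁻ x in Ioo u w, g x := by
  rw [← lintegral_union measurableSet_Ioo (by
    rw [Set.disjoint_left]; intro x hx hx'; exact lt_asymm hx.2 hx'.1)]
  exact lintegral_mono_set (union_subset (Ioo_subset_Ioo_right hvw) (Ioo_subset_Ioo_left huv))

theorem glue (huv : u ≤ v) (hvw : v ≤ w) (h : CancelsOn α a b ε₀ p₁ p₂ u v Q σ)
    (h' : CancelsOn α a b ε₀ p₁ p₂ v w Q' σ') :
    CancelsOn α a b ε₀ p₁ p₂ u w (Q + Q') (σ + σ') := by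
  obtain ⟨W, hW, h1, h2⟩ := h
  obtain ⟨W', hW', h1', h2'⟩ := h'
  refine ⟨W + W', ENNReal.add_ne_top.2 ⟨hW, hW'⟩, h1.glue huv hvw h1' hW hW', ?_⟩
  calc W + W' + (σ + σ') = (W + σ) + (W' + σ') := by ring
    _ ≤ _ := add_le_add h2 h2'
    _ = ((∫⁻ x in Ioo u v, ‖p₁ x‖ₑ) + ∫⁻ x in Ioo v w, ‖p₁ x‖ₑ) +
        ((∫⁻ x in Ioo u v, ‖p₂ x‖ₑ) + ∫⁻ x in Ioo v w, ‖p₂ x‖ₑ) := by ring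
    _ ≤ _ := add_le_add (setLIntegral_Ioo_add_le huv hvw) (setLIntegral_Ioo_add_le huv hvw)

theorem equipartition {L : ℝ} (hL : 0 ≤ L) (M : ℕ)
    (h : ∀ i < M, CancelsOn α a b ε₀ p₁ p₂ (u + i * L) (u + (i + 1) * L) Q σ) :
    CancelsOn α a b ε₀ p₁ p₂ u (u + M * L) (M * Q) (M * σ) := by
  induction M with
  | zero => simpa using empty (le_refl u)
  | succ M ih =>
    have := (ih fun i hi => h i (by omega)).glue (by nlinarith [Nat.cast_nonneg (α := ℝ) M])
      (by nlinarith) (h M (by omega))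
    push_cast
    rwa [add_mul _ _ Q, add_mul _ _ σ, one_mul, one_mul]

end CancelsOn

section

variable {α a b ε₀ R s c : ℝ} {p₁ p₂ : ℝ → ℂ} {θ₁ θ₂ : ℝ → ℝ}

/-- The common assumptions on two functions with transversal phases. -/
structure TransversalPhases (α a b ε₀ R s c : ℝ) (p₁ p₂ : ℝ → ℂ) (θ₁ θ₂ : ℝ → ℝ) (u w : ℝ) :
    Prop where
  nonneg : 0 ≤ u
  le_one : w ≤ 1
  sub_lt : w - u < ε₀
  regular₁ : IsRegularOn α a b (Ioo u w) p₁
  regular₂ : IsRegularOn α a b (Ioo u w) p₂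
  phase₁ : HasPhase (a * |b|) (Ioo u w) p₁ θ₁
  phase₂ : HasPhase (a * |b|) (Ioo u w) p₂ θ₂
  le₁ : ∀ x ∈ Ioo u w, ‖p₁ x‖ ≤ R
  le₂ : ∀ x ∈ Ioo u w, ‖p₂ x‖ ≤ R
  ge₁ : ∀ x ∈ Ioo u w, 2 * s ≤ ‖p₁ x‖
  ge₂ : ∀ x ∈ Ioo u w, 2 * s ≤ ‖p₂ x‖
  transversal : ∀ x ∈ Ioo u w, c * |b| ≤ |deriv θ₁ x - deriv θ₂ x|

namespace TransversalPhases

variable {u w : ℝ}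

theorem mono (h : TransversalPhases α a b ε₀ R s c p₁ p₂ θ₁ θ₂ u w) {u' w' : ℝ} (hu : u ≤ u')
    (hw : w' ≤ w) : TransversalPhases α a b ε₀ R s c p₁ p₂ θ₁ θ₂ u' w' :=
  have hI : Ioo u' w' ⊆ Ioo u w := Ioo_subset_Ioo hu hw
  ⟨hu.trans' h.nonneg, hw.trans h.le_one, by linarith [h.sub_lt], h.regular₁.mono_set hI,
    h.regular₂.mono_set hI, fun x hx => h.phase₁ x (hI hx), fun x hx => h.phase₂ x (hI hx),
    fun x hx => h.le₁ x (hI hx), fun x hx => h.le₂ x (hI hx), fun x hx => h.ge₁ x (hI hx),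
    fun x hx => h.ge₂ x (hI hx), fun x hx => h.transversal x (hI hx)⟩

theorem cancelsOn_zero (h : TransversalPhases α a b ε₀ R s c p₁ p₂ θ₁ θ₂ u w) (hα : 0 < α)
    (ha : 0 ≤ a) (hε₀ : 0 < ε₀) (hε₁ : ε₀ ≤ 1) :
    CancelsOn α (5 * a) b ε₀ p₁ p₂ u w (2 * ENNReal.ofReal R) 0 := by
  rcases le_or_gt w u with hle | hlt
  · exact (CancelsOn.empty hle).mono zero_le le_rfl
  · have hI : IsOpenInterval (Ioo u w) := ⟨u, w, h.nonneg, hlt, h.le_one, rfl⟩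
    refine ⟨_, ENNReal.add_ne_top.2 ⟨(h.regular₁.integrableOn hα hI h.le₁).2.ne,
      (h.regular₂.integrableOn hα hI h.le₂).2.ne⟩, (decomposes_add hα h.nonneg h.le_one h.sub_lt hε₀
      hε₁ h.regular₁ h.regular₂ h.le₁ h.le₂).mono (by linarith) le_rfl le_rfl, ?_⟩
    rw [add_zero]

/-- Over the middle third the phase difference runs through at least 2π, so it meets an odd multiple
of π at some x₀. The η-neighbourhood of x₀ stays inside (u, w), and the phase difference varies
there by at most π/4, so the masses partly cancel. The rest on both sides is left alone; the length
sums add up to 2R + 4R + 2R. -/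
theorem cancelsOn_of_three_mul_le (h : TransversalPhases α a b ε₀ R s c p₁ p₂ θ₁ θ₂ u w) (hα : 0 < α)
    (ha : 0 ≤ a) (hε₀ : 0 < ε₀) (hε₁ : ε₀ ≤ 1) (hs : 0 < s) {η : ℝ} (hη : 0 < η)
    (hη₁ : 3 * η ≤ w - u) (hη₂ : 2 * (a * |b|) * η ≤ Real.pi / 4)
    (hc : 6 * Real.pi ≤ c * |b| * (w - u)) :
    CancelsOn α (5 * a) b ε₀ p₁ p₂ u w (8 * ENNReal.ofReal R) (ENNReal.ofReal (2 * s * η)) := by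
  have hdiff : ∀ x ∈ Ioo u w, DifferentiableAt ℝ (fun x => θ₁ x - θ₂ x) x := fun x hx =>
    (h.phase₁ x hx).2.1.sub (h.phase₂ x hx).2.1
  have hderiv : ∀ x ∈ Ioo u w, deriv (fun x => θ₁ x - θ₂ x) x = deriv θ₁ x - deriv θ₂ x :=
    fun x hx => deriv_fun_sub (h.phase₁ x hx).2.1 (h.phase₂ x hx).2.1
  have hsub : Icc (u + η) (w - η) ⊆ Ioo u w := fun x hx => ⟨by linarith [hx.1], by linarith [hx.2]⟩
  have hsub' : Icc (u + (w - u) / 3) (w - (w - u) / 3) ⊆ Icc (u + η) (w - η) :=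
    Icc_subset_Icc (by linarith) (by linarith)
  obtain ⟨x₀, hx₀, k, hk⟩ := exists_eq_odd_mul_pi (ψ := fun x => θ₁ x - θ₂ x)
    (p := u + (w - u) / 3) (q := w - (w - u) / 3) (A := c * |b|) (by linarith)
    (fun x hx => hdiff x (hsub (hsub' hx)))
    (fun x hx => by rw [hderiv x (hsub (hsub' hx))]; exact h.transversal x (hsub (hsub' hx)))
    (by linarith)
  replace hx₀ := hsub' hx₀
  have hJ : TransversalPhases α a b ε₀ R s c p₁ p₂ θ₁ θ₂ (x₀ - η) (x₀ + η) :=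
    h.mono (by linarith [hx₀.1]) (by linarith [hx₀.2])
  have hcos : ∀ x ∈ Ioo (x₀ - η) (x₀ + η), |2 * Real.cos ((θ₁ x - θ₂ x) / 2)| ≤ 4 / 5 := by
    intro x hx
    refine abs_two_mul_cos_half_le (k := k) ?_
    rw [← hk]
    have h1 := (convex_Ioo u w).norm_image_sub_le_of_norm_deriv_le (f := fun x => θ₁ x - θ₂ x)
      (C := 2 * (a * |b|)) hdiff (fun y hy => ?_) (hsub hx₀)
      (Ioo_subset_Ioo (by linarith [hx₀.1]) (by linarith [hx₀.2]) hx)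
    · rw [Real.norm_eq_abs, Real.norm_eq_abs] at h1
      refine h1.trans (le_trans ?_ hη₂)
      have : |x - x₀| ≤ η := abs_le.2 ⟨by linarith [hx.1], by linarith [hx.2]⟩
      exact mul_le_mul_of_nonneg_left this (by positivity)
    · rw [hderiv y hy, Real.norm_eq_abs]
      have := abs_sub (deriv θ₁ y) (deriv θ₂ y)
      linarith [(h.phase₁ y hy).2.2, (h.phase₂ y hy).2.2]
  have hI : IsOpenInterval (Ioo (x₀ - η) (x₀ + η)) :=
    ⟨_, _, hJ.nonneg, by linarith, hJ.le_one, rfl⟩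
  obtain ⟨W, hW, hW'⟩ := decomposes_add_of_opposite hα ha hJ.nonneg hJ.le_one hJ.sub_lt hε₀ hε₁
    hJ.regular₁ hJ.regular₂ hJ.phase₁ hJ.phase₂ hJ.le₁ hJ.le₂ hs hJ.ge₁ hJ.ge₂ hcos
  have hmid : CancelsOn α (5 * a) b ε₀ p₁ p₂ (x₀ - η) (x₀ + η) (4 * ENNReal.ofReal R)
      (ENNReal.ofReal (2 * s * η)) := by
    refine ⟨W, ?_, hW, ?_⟩
    · exact ne_top_of_le_ne_top (ENNReal.add_ne_top.2
        ⟨(hJ.regular₁.integrableOn hα hI hJ.le₁).2.ne, (hJ.regular₂.integrableOn hα hI hJ.le₂).2.ne⟩)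
        (le_self_add.trans hW')
    · rwa [show s * (x₀ + η - (x₀ - η)) = 2 * s * η by ring] at hW'
  have hl := (h.mono le_rfl (w' := x₀ - η) (by linarith [hx₀.2])).cancelsOn_zero hα ha hε₀ hε₁
  have hr := (h.mono (u' := x₀ + η) (by linarith [hx₀.1]) le_rfl).cancelsOn_zero hα ha hε₀ hε₁
  refine ((hl.glue (by linarith [hx₀.1]) (by linarith) hmid).glue (by linarith [hx₀.1])
    (by linarith [hx₀.2]) hr).mono (le_of_eq (by ring)) (by rw [zero_add, add_zero])

/-- The cancellation between two functions with transversal phases. -/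
theorem cancelsOn (h : TransversalPhases α a b ε₀ R s c p₁ p₂ θ₁ θ₂ u w) (hα : 0 < α)
    (ha : 0 < a) (hε₀ : 0 < ε₀) (hε₁ : ε₀ ≤ 1) (hs : 0 < s) (hR : 0 ≤ R) (hc : 0 < c) {v : ℝ}
    (hv : 0 < v) (hvw : v ≤ w - u) (hb : 6 * Real.pi / c ≤ |b| * v) :
    CancelsOn α (5 * a) b ε₀ p₁ p₂ u w (ENNReal.ofReal (2 * c * R * |b|))
      (ENNReal.ofReal (s * v * min (1 / 3) (c / (48 * a)))) := by
  have hπ := Real.pi_pos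
  -- An interval of length κ/|b| is just long enough for one cancellation; (u, w) is divided into M
  -- such intervals of length L, with L between κ/|b| and 2κ/|b|.
  set κ := 6 * Real.pi / c with hκ
  have hκ0 : 0 < κ := by positivity
  have hb0 : 0 < |b| := pos_of_mul_pos_left (hκ0.trans_le hb) hv.le
  have hwu : 0 < w - u := hv.trans_le hvw
  have hbw : κ ≤ |b| * (w - u) := hb.trans (by gcongr)
  set M := ⌊|b| * (w - u) / κ⌋₊ with hM
  have h1 : (1 : ℝ) ≤ |b| * (w - u) / κ := (one_le_div hκ0).2 hbw
  have hM1 : (1 : ℝ) ≤ M := by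
    have : 1 ≤ M := Nat.le_floor (by simpa using h1)
    exact_mod_cast this
  have hM2 : M * κ ≤ |b| * (w - u) := by
    rw [← le_div_iff₀ hκ0]; exact Nat.floor_le (by positivity)
  have hM3 : |b| * (w - u) ≤ 2 * M * κ := by
    have := (Nat.lt_floor_add_one (|b| * (w - u) / κ)).le
    rw [← hM, div_le_iff₀ hκ0] at this
    nlinarith
  have hM0 : (0 : ℝ) < M := by linarith
  set L := (w - u) / M with hL
  have hML : M * L = w - u := by rw [hL]; field_simp
  have hL0 : 0 < L := by positivity
  have hbL : κ ≤ |b| * L := by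
    rw [hL, ← mul_div_assoc, le_div_iff₀ hM0]; linarith
  -- The largest η with 3η ≤ κ/|b| and 2a|b|η ≤ π/4. The total saving 2sηM does not decay in |b|,
  -- since M is at least |b|v/(2κ).
  set η := min (κ / 3) (Real.pi / (8 * a)) / |b| with hη
  have hη0 : 0 < η := div_pos (lt_min (by positivity) (by positivity)) hb0
  have hbη : η * |b| = min (κ / 3) (Real.pi / (8 * a)) := by rw [hη]; field_simp
  have hmin : min (κ / 3) (Real.pi / (8 * a)) = κ * min (1 / 3) (c / (48 * a)) := by
    rw [mul_min_of_nonneg _ _ hκ0.le, hκ]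
    congr 1
    · ring
    · field_simp
      norm_num
  have hcell : ∀ i < M, CancelsOn α (5 * a) b ε₀ p₁ p₂ (u + i * L) (u + (i + 1) * L)
      (8 * ENNReal.ofReal R) (ENNReal.ofReal (2 * s * η)) := by
    intro i hi
    have hi' : (i : ℝ) + 1 ≤ M := by exact_mod_cast hi
    have hi0 : (0 : ℝ) ≤ i := Nat.cast_nonneg i
    have e : u + (i + 1) * L - (u + i * L) = L := by ring
    refine (h.mono (by nlinarith) (by nlinarith)).cancelsOn_of_three_mul_le hα ha.le hε₀ hε₁ hs hη0
      ?_ ?_ ?_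
    · rw [e]
      have : η * |b| ≤ κ / 3 := hbη.trans_le (min_le_left _ _)
      nlinarith
    · have : η * |b| ≤ Real.pi / (8 * a) := hbη.trans_le (min_le_right _ _)
      rw [le_div_iff₀ (by positivity)] at this
      linarith
    · rw [e]
      have : κ * c ≤ |b| * L * c := by gcongr
      rw [hκ, div_mul_cancel₀ _ hc.ne'] at this
      linarith
  have hall := CancelsOn.equipartition hL0.le M hcell
  rw [hML, add_sub_cancel] at hall
  have hMn : (M : ℝ≥0∞) = ENNReal.ofReal M := (ENNReal.ofReal_natCast M).symm
  refine hall.mono ?_ ?_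
  · rw [hMn, show (8 : ℝ≥0∞) = ENNReal.ofReal 8 by simp, ← ENNReal.ofReal_mul (by norm_num),
      ← ENNReal.ofReal_mul hM0.le]
    apply ENNReal.ofReal_le_ofReal
    have h2 : w - u ≤ 1 := by linarith [h.le_one, h.nonneg]
    have h3 : M * κ ≤ |b| := by nlinarith
    have h4 : M * (6 * Real.pi) ≤ |b| * c := by
      rw [hκ, ← mul_div_assoc, div_le_iff₀ hc] at h3; exact h3
    have h5 : M * 4 ≤ |b| * c := by nlinarith [Real.pi_gt_three]
    nlinarith
  · rw [hMn, ← ENNReal.ofReal_mul hM0.le]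
    apply ENNReal.ofReal_le_ofReal
    rw [hmin] at hbη
    set t := min (1 / 3) (c / (48 * a))
    have ht : 0 < t := lt_min (by norm_num) (by positivity)
    have h2 : |b| * v ≤ 2 * M * κ := le_trans (by gcongr) hM3
    have h3 : |b| * (v * t) ≤ |b| * (2 * M * η) := by
      calc |b| * (v * t) = |b| * v * t := by ring
        _ ≤ 2 * M * κ * t := by gcongr
        _ = |b| * (2 * M * η) := by rw [mul_assoc (2 * (M : ℝ)), ← hbη]; ring
    have h4 : v * t ≤ 2 * M * η := le_of_mul_le_mul_left h3 hb0
    calc s * v * t = s * (v * t) := by ring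
      _ ≤ s * (2 * M * η) := mul_le_mul_of_nonneg_left h4 hs.le
      _ = M * (2 * s * η) := by ring

end TransversalPhases

end

/-! ### Loss of weight for a single standard pair -/

namespace SkewProduct.IsAdmissible

variable {S : SkewProduct} {α lam D Cτ : ℝ} {b : ℝ} (hS : S.IsAdmissible α lam D Cτ)
include hS

/-- The phase of a pushed density has derivative b times the slope, up to the contracted phase of ρ.
Two such errors are absorbed by the term 2a e^{-λn} in the transversality constant. -/
theorem hasPhase_push {n : ℕ} (h : S.Branch n) {E I : Set ℝ} {ρ : ℝ → ℂ} {θ : ℝ → ℝ} {a a' : ℝ}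
    (hE : E ⊆ h.dom) (hEI : MapsTo h.map E I) (hθ : HasPhase (a * |b|) I ρ θ) (ha : 0 ≤ a)
    (ha' : a * Real.exp (-(lam * n)) + Cτ ≤ a') :
    HasPhase (a' * |b|) E (h.push b ρ)
        (fun x => b * birkhoffSum S.f S.τ n (h.map x) + θ (h.map x)) ∧
      ∀ x ∈ E, |deriv (fun x => b * birkhoffSum S.f S.τ n (h.map x) + θ (h.map x)) x -
        b * S.slope n (h.map x)| ≤ a * |b| * Real.exp (-(lam * n)) := by
  have hd : ∀ x ∈ E, HasDerivAt (fun x => b * birkhoffSum S.f S.τ n (h.map x) + θ (h.map x))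
      (b * S.slope n (h.map x) + deriv θ (h.map x) * deriv h.map x) x := fun x hx =>
    ((hS.hasDerivAt_birkhoffSum_map (hE hx)).const_mul b).add
      ((hθ _ (hEI hx)).2.1.hasDerivAt.comp x
        (hS.hasDerivAt_map (hE hx)).differentiableAt.hasDerivAt)
  have hb : ∀ x ∈ E, |deriv θ (h.map x) * deriv h.map x| ≤ a * |b| * Real.exp (-(lam * n)) := by
    intro x hx
    rw [abs_mul]
    exact mul_le_mul (hθ _ (hEI hx)).2.2 (hS.abs_deriv_map_le (hE hx)) (abs_nonneg _)
      (mul_nonneg ha (abs_nonneg _))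
  refine ⟨fun x hx => ⟨?_, (hd x hx).differentiableAt, ?_⟩, fun x hx => ?_⟩
  · rw [h.norm_push]
    conv_lhs => rw [Branch.push, (hθ _ (hEI hx)).1]
    rw [Complex.ofReal_mul]
    push_cast
    rw [mul_add, Complex.exp_add]
    ring_nf
  · rw [(hd x hx).deriv]
    have h1 : |b * S.slope n (h.map x)| ≤ |b| * Cτ := by
      rw [abs_mul]
      exact mul_le_mul_of_nonneg_left (hS.abs_slope_le (Branch.map_mem_reg (hE hx))) (abs_nonneg _)
    have h2 : (a * Real.exp (-(lam * n)) + Cτ) * |b| ≤ a' * |b| := by gcongr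
    refine (abs_add_le _ _).trans ?_
    linarith [hb x hx]
  · rw [(hd x hx).deriv, add_sub_cancel_left]
    exact hb x hx

end SkewProduct.IsAdmissible

theorem IsOpenInterval.endpoints {l r : ℝ} (h : IsOpenInterval (Ioo l r)) :
    0 ≤ l ∧ l < r ∧ r ≤ 1 := by
  have h1 : l < r := nonempty_Ioo.1 h.nonempty
  have h2 : Icc l r ⊆ Icc 0 1 := by
    rw [← closure_Ioo h1.ne, ← closure_Ioo zero_ne_one]
    exact closure_mono h.subset_Ioo
  rw [Icc_subset_Icc_iff h1.le] at h2
  exact ⟨h2.1, h1, h2.2⟩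

/-- The part of a regular function outside two disjoint intervals. -/
theorem exists_decomposes_sub_of_le {α a b ε₀ R : ℝ} {ρ : ℝ → ℂ} {l e₁ e₁' e₂ e₂' r : ℝ} (hα : 0 < α)
    (hl : 0 ≤ l) (hr : r ≤ 1) (hlr : r - l < ε₀) (hε₀ : 0 < ε₀) (hε₁ : ε₀ ≤ 1)
    (hρ : IsRegularOn α a b (Ioo l r) ρ) (hR : ∀ x ∈ Ioo l r, ‖ρ x‖ ≤ R)
    (h₁ : l ≤ e₁) (h₂ : e₁ ≤ e₁') (h₃ : e₁' ≤ e₂) (h₄ : e₂ ≤ e₂') (h₅ : e₂' ≤ r) :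
    ∃ g W, W ≠ ∞ ∧ Decomposes α a b ε₀ g W (3 * ENNReal.ofReal R) ∧
      indicator (Ioo l r) ρ =ᵐ[volume]
        (fun x => g x + (indicator (Ioo e₁ e₁') ρ x + indicator (Ioo e₂ e₂') ρ x)) ∧
      W + ((∫⁻ x in Ioo e₁ e₁', ‖ρ x‖ₑ) + ∫⁻ x in Ioo e₂ e₂', ‖ρ x‖ₑ) ≤
        ∫⁻ x in Ioo l r, ‖ρ x‖ₑ := by
  have key : ∀ u w, l ≤ u → w ≤ r → (∫⁻ x in Ioo u w, ‖ρ x‖ₑ) ≠ ∞ ∧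
      Decomposes α a b ε₀ (indicator (Ioo u w) ρ) (∫⁻ x in Ioo u w, ‖ρ x‖ₑ) (ENNReal.ofReal R) := by
    intro u w hu hw
    have hsub : Ioo u w ⊆ Ioo l r := Ioo_subset_Ioo hu hw
    refine ⟨?_, Decomposes.single hα (hl.trans hu) (hw.trans hr) (by linarith) hε₀ hε₁
      (hρ.mono_set hsub) fun x hx => hR x (hsub hx)⟩
    rcases le_or_gt w u with h | h
    · rw [Ioo_eq_empty (not_lt.2 h)]; simp
    · exact ((hρ.mono_set hsub).integrableOn hα ⟨u, w, hl.trans hu, h, hw.trans hr, rfl⟩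
        fun x hx => hR x (hsub hx)).2.ne
  -- The complement consists of three possibly empty intervals, hence the factor 3.
  obtain ⟨f1, d1⟩ := key l e₁ le_rfl (by linarith)
  obtain ⟨f2, d2⟩ := key e₁' e₂ (by linarith) (by linarith)
  obtain ⟨f3, d3⟩ := key e₂' r (by linarith) le_rfl
  refine ⟨_, _, ENNReal.add_ne_top.2 ⟨ENNReal.add_ne_top.2 ⟨f1, f2⟩, f3⟩,
    ((d1.add d2 f1 f2).add d3 (ENNReal.add_ne_top.2 ⟨f1, f2⟩) f3).mono le_rfl le_rfl
      (le_of_eq (by ring)), ?_, ?_⟩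
  · filter_upwards [Measure.ae_ne volume e₁, Measure.ae_ne volume e₁', Measure.ae_ne volume e₂,
      Measure.ae_ne volume e₂'] with x h6 h7 h8 h9
    rw [← indicator_Ioo_add_indicator_Ioo (h₁.trans (h₂.trans (h₃.trans h₄))) h₅ h9,
      ← indicator_Ioo_add_indicator_Ioo (h₁.trans (h₂.trans h₃)) h₄ h8,
      ← indicator_Ioo_add_indicator_Ioo (h₁.trans h₂) h₃ h7,
      ← indicator_Ioo_add_indicator_Ioo h₁ h₂ h6]
    ring
  · have e1 := CancelsOn.setLIntegral_Ioo_add_le (g := fun x => ‖ρ x‖ₑ) h₁ h₂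
    have e2 := CancelsOn.setLIntegral_Ioo_add_le (g := fun x => ‖ρ x‖ₑ) (h₁.trans h₂) h₃
    have e3 := CancelsOn.setLIntegral_Ioo_add_le (g := fun x => ‖ρ x‖ₑ) (h₁.trans (h₂.trans h₃)) h₄
    have e4 := CancelsOn.setLIntegral_Ioo_add_le (g := fun x => ‖ρ x‖ₑ)
      (h₁.trans (h₂.trans (h₃.trans h₄))) h₅
    refine le_trans ?_ e4
    refine le_trans ?_ (add_le_add_left (le_trans (add_le_add_left
      (le_trans (add_le_add_left e1 _) e2) _) e3) _)
    exact le_of_eq (by ring)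

theorem exists_decomposes_sub {α a b ε₀ R : ℝ} {ρ : ℝ → ℂ} {l r : ℝ} (hα : 0 < α)
    (hl : 0 ≤ l) (hr : r ≤ 1) (hlr : r - l < ε₀) (hε₀ : 0 < ε₀) (hε₁ : ε₀ ≤ 1)
    (hρ : IsRegularOn α a b (Ioo l r) ρ) (hR : ∀ x ∈ Ioo l r, ‖ρ x‖ ≤ R) {E₁ E₂ : Set ℝ}
    (h₁ : IsOpenInterval E₁) (h₂ : IsOpenInterval E₂) (hs₁ : E₁ ⊆ Ioo l r) (hs₂ : E₂ ⊆ Ioo l r)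
    (hd : Disjoint E₁ E₂) :
    ∃ g W, W ≠ ∞ ∧ Decomposes α a b ε₀ g W (3 * ENNReal.ofReal R) ∧
      indicator (Ioo l r) ρ =ᵐ[volume] (fun x => g x + (indicator E₁ ρ x + indicator E₂ ρ x)) ∧
      W + ((∫⁻ x in E₁, ‖ρ x‖ₑ) + ∫⁻ x in E₂, ‖ρ x‖ₑ) ≤ ∫⁻ x in Ioo l r, ‖ρ x‖ₑ := by
  obtain ⟨e₁, e₁', -, h1, -, rfl⟩ := h₁
  obtain ⟨e₂, e₂', -, h2, -, rfl⟩ := h₂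
  obtain ⟨a1, a2⟩ := (Ioo_subset_Ioo_iff h1).1 hs₁
  obtain ⟨a3, a4⟩ := (Ioo_subset_Ioo_iff h2).1 hs₂
  rw [Ioo_disjoint_Ioo] at hd
  rcases le_or_gt e₁' e₂ with h | h
  · exact exists_decomposes_sub_of_le hα hl hr hlr hε₀ hε₁ hρ hR a1 h1.le h h2.le a4
  · have h' : e₂' ≤ e₁ := by
      rcases min_le_iff.1 hd with h3 | h3 <;> rcases le_max_iff.1 h3 with h4 | h4 <;> linarith
    obtain ⟨g, W, hW, hg, he, hle⟩ :=
      exists_decomposes_sub_of_le hα hl hr hlr hε₀ hε₁ hρ hR a3 h2.le h' h1.le a2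
    refine ⟨g, W, hW, hg, ?_, ?_⟩
    · simp only [add_comm (indicator (Ioo e₁ e₁') ρ _)]
      exact he
    · rwa [add_comm (∫⁻ x in Ioo e₁ e₁', _)]

theorem IsStandardPair.decomposes {α a b ε₀ : ℝ} {I : Set ℝ} {ρ : ℝ → ℂ}
    (h : IsStandardPair α a b ε₀ I ρ) :
    Decomposes α a b ε₀ (indicator I ρ) 1 (1 / volume I) := by
  refine ⟨⟨Unit, inferInstance, fun _ => I, fun _ => ρ, fun _ => 1⟩, fun _ => h, ?_, ?_, ?_⟩
  · simp [WeightedFamily.totalWeight]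
  · simp [WeightedFamily.lengthSum]
  · refine ae_of_all _ fun x => ?_
    simp [WeightedFamily.density]

namespace SkewProduct

variable {S : SkewProduct} {α lam D Cτ : ℝ} {b a ε₀ : ℝ}

/-- The transfer operator cannot produce more than the total sum of `|h'|`. -/
theorem two_mul_hitSum_le (n : ℕ) (I : Set ℝ) :
    2 * S.hitSum n I ≤ 2 * ∑' h : S.Branch n, h.supDeriv := by
  gcongr
  exact hitSum_le_tsum

namespace IsAdmissible

variable (hS : S.IsAdmissible α lam D Cτ)
include hS

theorem isOpenInterval_image_map {n : ℕ} (h : S.Branch n) {p q : ℝ} (hpq : p < q)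
    (hsub : Ioo p q ⊆ h.dom) : IsOpenInterval (h.map '' Ioo p q) := by
  refine isOpenInterval_of_isOpen ((nonempty_Ioo.2 hpq).image _) ?_
    (isPreconnected_Ioo.image _ ((hS.continuousOn_map h).mono hsub)) ?_
  · rw [isOpen_iff_mem_nhds]
    rintro _ ⟨x, hx, rfl⟩
    have h1 := hS.hasStrictDerivAt_map (hsub hx)
    have h2 := hS.deriv_map_ne_zero (hsub hx)
    rw [hS.deriv_map (hsub hx)] at h2
    rw [← h1.map_nhds_eq h2]
    exact image_mem_map (isOpen_Ioo.mem_nhds hx)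
  · rintro _ ⟨x, hx, rfl⟩
    exact reg_subset_Ico (Branch.map_mem_reg (hsub hx))

/-- The constant 2a comes from a + (D + Cτ) ≤ 2a. The upper bound 2/δ uses that I has length at
least δ, and κ/4 comes from |ρ| ≥ 1/2, valid since I has length at most 1. -/
theorem transversalPhases_push {n : ℕ} {h₁ h₂ : S.Branch n} {l r p q δ c v κ : ℝ} {ρ : ℝ → ℂ}
    (hρ : IsStandardPair α a b ε₀ (Ioo l r) ρ) (ha : D + Cτ ≤ a) (ha0 : 0 ≤ a) (hδ : 0 < δ)
    (hδ' : δ ≤ r - l) (hε : Real.exp (a * ε₀ ^ α) ≤ 2) (hκ : 0 < κ)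
    (hT : S.IsTransversal n (Ioo l r) (c + 2 * a * Real.exp (-(lam * n))) v κ ε₀ h₁ h₂ p q)
    (hv : 0 < v) :
    ∃ θ₁ θ₂, TransversalPhases α (2 * a) b ε₀ (2 / δ) (κ / 4) c (h₁.push b ρ) (h₂.push b ρ)
      θ₁ θ₂ p q := by
  obtain ⟨hl, hlr, hr⟩ := hρ.interval.endpoints
  obtain ⟨hp, -, hq⟩ := IsOpenInterval.endpoints (l := p) (r := q)
    (isOpenInterval_of_isOpen (nonempty_Ioo.2 (by linarith [hT.le_sub])) isOpen_Ioo
      isPreconnected_Ioo (hT.subset₁.trans (hS.isOpenInterval_dom h₁).subset_Ico))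
  obtain ⟨θ, hθ⟩ := hρ.argument
  have hC := hS.Cτ_nonneg
  have hexp : Real.exp (-(lam * n)) ≤ 1 := Real.exp_le_one_iff.2
    (neg_nonpos.2 (mul_nonneg hS.lam_pos.le (Nat.cast_nonneg n)))
  have hexp' : Real.exp (-(α * (lam * n))) ≤ 1 := Real.exp_le_one_iff.2
    (neg_nonpos.2 (mul_nonneg hS.alpha_pos.le (mul_nonneg hS.lam_pos.le (Nat.cast_nonneg n))))
  have e1 : a * Real.exp (-(lam * n)) + Cτ ≤ 2 * a := by
    have := mul_le_of_le_one_right ha0 hexp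
    linarith [hS.D_nonneg]
  have e2 : a * Real.exp (-(α * (lam * n))) + (D + Cτ) ≤ 2 * a := by
    have := mul_le_of_le_one_right ha0 hexp'
    linarith
  obtain ⟨P₁, P₁'⟩ := hS.hasPhase_push (b := b) h₁ hT.subset₁ hT.mapsTo₁ hθ ha0 e1
  obtain ⟨P₂, P₂'⟩ := hS.hasPhase_push (b := b) h₂ hT.subset₂ hT.mapsTo₂ hθ ha0 e1
  have hle : ∀ x ∈ Ioo l r, ‖ρ x‖ ≤ 2 / δ := by
    intro x hx
    have h1 := hρ.enorm_le hS.alpha_pos ha0 hε hx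
    rw [Real.volume_Ioo, ← ofReal_norm, show (2 : ℝ≥0∞) = ENNReal.ofReal 2 by norm_num,
      ← ENNReal.ofReal_div_of_pos (by linarith), ENNReal.ofReal_le_ofReal_iff (by
        have : 0 < r - l := by linarith
        positivity)] at h1
    exact h1.trans (by gcongr)
  have hge : ∀ x ∈ Ioo l r, 1 / 2 ≤ ‖ρ x‖ := by
    intro x hx
    have h1 := hρ.le_enorm hS.alpha_pos ha0 hε hx
    rw [Real.volume_Ioo, ← ofReal_norm, show (2 : ℝ≥0∞) = ENNReal.ofReal 2 by norm_num,
      ← ENNReal.ofReal_mul (by norm_num), ← ENNReal.ofReal_mul (by positivity),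
      ENNReal.one_le_ofReal] at h1
    nlinarith [norm_nonneg (ρ x)]
  have hle' : ∀ h : S.Branch n, Ioo p q ⊆ h.dom → MapsTo h.map (Ioo p q) (Ioo l r) →
      ∀ x ∈ Ioo p q, ‖h.push b ρ x‖ ≤ 2 / δ := by
    intro h hsub hm x hx
    rw [h.norm_push]
    exact (mul_le_of_le_one_right (norm_nonneg _)
      ((hS.abs_deriv_map_le (hsub hx)).trans hexp)).trans (hle _ (hm hx))
  have hge' : ∀ h : S.Branch n, (∀ x ∈ Ioo p q, κ ≤ |deriv h.map x|) →
      MapsTo h.map (Ioo p q) (Ioo l r) → ∀ x ∈ Ioo p q, 2 * (κ / 4) ≤ ‖h.push b ρ x‖ := by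
    intro h hd hm x hx
    rw [h.norm_push]
    calc 2 * (κ / 4) = 1 / 2 * κ := by ring
      _ ≤ _ := mul_le_mul (hge _ (hm hx)) (hd x hx) hκ.le (norm_nonneg _)
  refine ⟨_, _, hp, hq, hT.sub_lt, hS.isRegularOn_push h₁ hT.subset₁ hT.mapsTo₁ hρ.isRegularOn ha0 e2,
    hS.isRegularOn_push h₂ hT.subset₂ hT.mapsTo₂ hρ.isRegularOn ha0 e2, P₁, P₂,
    hle' h₁ hT.subset₁ hT.mapsTo₁, hle' h₂ hT.subset₂ hT.mapsTo₂, hge' h₁ hT.deriv₁ hT.mapsTo₁,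
    hge' h₂ hT.deriv₂ hT.mapsTo₂, fun x hx => ?_⟩
  have f1 := abs_le.1 (P₁' x hx)
  have f2 := abs_le.1 (P₂' x hx)
  have f3 : |b| * (c + 2 * a * Real.exp (-(lam * n))) ≤
      |b * S.slope n (h₁.map x) - b * S.slope n (h₂.map x)| := by
    rw [← mul_sub, abs_mul]
    exact mul_le_mul_of_nonneg_left (hT.slope x hx) (abs_nonneg _)
  rcases le_abs.1 f3 with f4 | f4
  · exact le_abs.2 (Or.inl (by linarith [f1.1, f1.2, f2.1, f2.2]))
  · exact le_abs.2 (Or.inr (by linarith [f1.1, f1.2, f2.1, f2.2]))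

/-- The image of a standard pair on a long interval loses some weight. -/
theorem exists_isTransfer_of_isTransversal {n : ℕ} {h₁ h₂ : S.Branch n} {l r p q δ c v κ : ℝ}
    {ρ : ℝ → ℂ} (hρ : IsStandardPair α a b ε₀ (Ioo l r) ρ) (ha : D + Cτ ≤ a) (ha0 : 0 < a)
    (hδ : 0 < δ) (hδ' : δ ≤ r - l) (hε₀ : 0 < ε₀) (hε : Real.exp (a * ε₀ ^ α) ≤ 2) (hκ : 0 < κ)
    (hc : 0 < c) (hv : 0 < v)
    (hT : S.IsTransversal n (Ioo l r) (c + 2 * a * Real.exp (-(lam * n))) v κ ε₀ h₁ h₂ p q)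
    (hb : 6 * Real.pi / c ≤ |b| * v) :
    ∃ g' W, S.IsTransfer b n (indicator (Ioo l r) ρ) g' ∧
      W + ENNReal.ofReal (κ / 4 * v * min (1 / 3) (c / (48 * (2 * a)))) ≤ 1 ∧
      Decomposes α (5 * (2 * a)) b ε₀ g' W (ENNReal.ofReal (2 * c * (2 / δ) * |b|) +
        ((2 * ∑' h : S.Branch n, h.supDeriv) * (3 * ENNReal.ofReal (2 / δ)) +
          ENNReal.ofReal (3 / ε₀))) := by
  obtain ⟨θ₁, θ₂, hθ⟩ := hS.transversalPhases_push hρ ha ha0.le hδ hδ' hε hκ hT hv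
  obtain ⟨W, hW, hdec, hsave⟩ := hθ.cancelsOn hS.alpha_pos (by positivity) hε₀ hρ.le_one
    (by positivity) (by positivity) hc hv hT.le_sub hb
  have hpq : p < q := by linarith [hT.le_sub]
  have i₁ := hS.isOpenInterval_image_map h₁ hpq hT.subset₁
  have i₂ := hS.isOpenInterval_image_map h₂ hpq hT.subset₂
  have hne : h₁ ≠ h₂ := by
    rintro rfl
    have hm : (p + q) / 2 ∈ Ioo p q := ⟨by linarith, by linarith⟩
    have := hT.slope _ hm
    rw [sub_self, abs_zero] at this
    have : 0 < 2 * a * Real.exp (-(lam * n)) := by positivity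
    linarith
  have hdisj : Disjoint (h₁.map '' Ioo p q) (h₂.map '' Ioo p q) := by
    refine (hS.disjoint_cell hne).mono ?_ ?_
    · rintro _ ⟨x, hx, rfl⟩; exact Branch.map_mem (hT.subset₁ hx)
    · rintro _ ⟨x, hx, rfl⟩; exact Branch.map_mem (hT.subset₂ hx)
  have s₁ : h₁.map '' Ioo p q ⊆ Ioo l r := hT.mapsTo₁.image_subset
  have s₂ : h₂.map '' Ioo p q ⊆ Ioo l r := hT.mapsTo₂.image_subset
  have hle : ∀ x ∈ Ioo l r, ‖ρ x‖ ≤ 2 / δ := by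
    intro x hx
    have h1 := hρ.enorm_le hS.alpha_pos ha0.le hε hx
    rw [Real.volume_Ioo, ← ofReal_norm, show (2 : ℝ≥0∞) = ENNReal.ofReal 2 by norm_num,
      ← ENNReal.ofReal_div_of_pos (by linarith), ENNReal.ofReal_le_ofReal_iff (by
        have : 0 < r - l := by linarith
        positivity)] at h1
    exact h1.trans (by gcongr)
  obtain ⟨hl, hlr, hr⟩ := hρ.interval.endpoints
  have hwidth : r - l < ε₀ := by
    have := hρ.width
    rwa [Real.volume_Ioo, ENNReal.ofReal_lt_ofReal_iff hε₀] at this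
  -- The density is split into its restrictions to the images of (p, q) under the two branches,
  -- whose push-forwards cancel, and a remainder that is transferred without any gain.
  obtain ⟨g, W', hW', hg, hgeq, hgW⟩ := exists_decomposes_sub hS.alpha_pos hl hr hwidth hε₀ hρ.le_one
    hρ.isRegularOn hle i₁ i₂ s₁ s₂ hdisj
  have hexp' : Real.exp (-(α * (lam * n))) ≤ 1 := Real.exp_le_one_iff.2
    (neg_nonpos.2 (mul_nonneg hS.alpha_pos.le (mul_nonneg hS.lam_pos.le (Nat.cast_nonneg n))))
  obtain ⟨g', hT', hdec'⟩ := hS.exists_isTransfer (n := n) ha0.le hε₀ hρ.le_one hε (a' := 5 * (2 * a))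
    (by have := mul_le_of_le_one_right ha0.le hexp'; linarith)
    (fun I _ _ => two_mul_hitSum_le n I) hW' hg
  have t₁ := hS.isTransfer_branch (b := b) h₁ measurableSet_Ioo hT.subset₁
    (hρ.integrable.mono_set s₁)
  have t₂ := hS.isTransfer_branch (b := b) h₂ measurableSet_Ioo hT.subset₂
    (hρ.integrable.mono_set s₂)
  have hsum : W' + W + ENNReal.ofReal (κ / 4 * v * min (1 / 3) (c / (48 * (2 * a)))) ≤ 1 := by
    rw [hS.lintegral_image_map (b := b) h₁ measurableSet_Ioo hT.subset₁,
      hS.lintegral_image_map (b := b) h₂ measurableSet_Ioo hT.subset₂, hρ.lintegral_enorm] at hgW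
    rw [add_assoc]
    exact le_trans (add_le_add_right hsave _) hgW
  have hW1 : W' ≤ 1 := le_trans (le_trans (le_self_add) le_self_add) hsum
  refine ⟨_, W' + W, (hS.isTransfer_add hT' (hS.isTransfer_add t₁ t₂)).congr_ae hgeq.symm
    (ae_eq_refl _), hsum, ((hdec'.add hdec hW' hW).congr_ae (ae_of_all _ fun x => ?_)).mono le_rfl
    le_rfl ?_⟩
  · by_cases hx : x ∈ Ioo p q
    · simp only [indicator_of_mem hx]
      rfl
    · simp only [indicator_of_notMem hx, add_zero]
  · rw [add_comm]
    gcongr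
    exact mul_le_of_le_one_right' hW1

end IsAdmissible
end SkewProduct

/-! ### Loss of weight for a family, and recovery of regularity -/

namespace SkewProduct.IsAdmissible

variable {S : SkewProduct} {α lam D Cτ : ℝ} {b a ε₀ : ℝ} (hS : S.IsAdmissible α lam D Cτ)
include hS

/-- After a fixed number of iterations, every standard family loses a fixed part of its weight. -/
theorem exists_isTransfer_isStandard {B : ℝ} (ha : D + Cτ ≤ a) (ha0 : 0 < a) (hε₀ : 0 < ε₀)
    (hε₁ : ε₀ ≤ 1) (hε : Real.exp (a * ε₀ ^ α) ≤ 2) (hB : 0 < B) :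
    ∃ (n : ℕ) (σ : ℝ) (K : ℝ≥0∞) (b₁ : ℝ), 0 < σ ∧ K ≠ ∞ ∧ 1 ≤ b₁ ∧ ∀ b : ℝ, b₁ ≤ |b| →
      ∀ G : WeightedFamily, G.IsStandard α a b B ε₀ → G.totalWeight = 1 →
      ∃ g' W, S.IsTransfer b n G.density g' ∧ W + ENNReal.ofReal σ ≤ 1 ∧
        Decomposes α (10 * a) b ε₀ g' W (ENNReal.ofReal |b| * K) := by
  -- The length sum is at most 2B, so intervals shorter than δ carry weight at most 2Bδ = 1/2.
  have hδ : 0 < 1 / (4 * B) := by positivity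
  obtain ⟨n, c, v, κ, hc, hv, hκ, hT⟩ := hS.exists_isTransversal ha0.le hδ hε₀
  set δ := 1 / (4 * B) with hδdef
  set σ := κ / 4 * v * min (1 / 3) (c / (48 * (2 * a))) with hσ
  have hσ0 : 0 < σ := mul_pos (by positivity) (lt_min (by norm_num) (by positivity))
  set H := 2 * ∑' h : S.Branch n, h.supDeriv with hH
  have hH' : H ≠ ∞ := ENNReal.mul_ne_top (by simp) (hS.tsum_supDeriv_ne_top n)
  set K₁ := H * (3 * ENNReal.ofReal (2 / δ)) + ENNReal.ofReal (3 / ε₀) with hK₁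
  have hK₁' : K₁ ≠ ∞ := ENNReal.add_ne_top.2
    ⟨ENNReal.mul_ne_top hH' (ENNReal.mul_ne_top (by simp) (by simp)), by simp⟩
  refine ⟨n, σ / 2, ENNReal.ofReal (2 * c * (2 / δ)) + (K₁ + H * ENNReal.ofReal (2 * B)),
    1 + 6 * Real.pi / c / v, by positivity, ENNReal.add_ne_top.2 ⟨by simp, ENNReal.add_ne_top.2
      ⟨hK₁', ENNReal.mul_ne_top hH' ENNReal.ofReal_ne_top⟩⟩, ?_, fun b hb G hG hG1 => ?_⟩
  · have : 0 ≤ 6 * Real.pi / c / v := by positivity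
    linarith
  have hb1 : 1 ≤ |b| := le_trans (by
    have : 0 ≤ 6 * Real.pi / c / v := by positivity
    linarith) hb
  have hbv : 6 * Real.pi / c ≤ |b| * v := by
    rw [← div_le_iff₀ hv]; linarith
  classical
  set ind : G.J → ℝ≥0∞ := fun j => if ENNReal.ofReal δ ≤ volume (G.I j) then 1 else 0 with hind
  have hexp' : Real.exp (-(α * (lam * n))) ≤ 1 := Real.exp_le_one_iff.2
    (neg_nonpos.2 (mul_nonneg hS.alpha_pos.le (mul_nonneg hS.lam_pos.le (Nat.cast_nonneg n))))
  -- Only long intervals lose weight, and their length-sum bound is uniform of order |b|. Short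
  -- intervals cost a multiple of 1/|I_j|, which adds up to the length sum of the family.
  have hpair : ∀ j, ∃ g' W, S.IsTransfer b n (indicator (G.I j) (G.ρ j)) g' ∧
      W + ENNReal.ofReal σ * ind j ≤ 1 ∧ Decomposes α (10 * a) b ε₀ g' W
        (ENNReal.ofReal (2 * c * (2 / δ) * |b|) + K₁ + H * (1 / volume (G.I j))) := by
    intro j
    have hp := hG.pair j
    by_cases hj : ENNReal.ofReal δ ≤ volume (G.I j)
    · obtain ⟨l, r, hl, hlr, hr, hI⟩ := hp.interval
      rw [hI] at hp hj ⊢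
      rw [Real.volume_Ioo, ENNReal.ofReal_le_ofReal_iff (by linarith)] at hj
      obtain ⟨h₁, h₂, p, q, hT'⟩ := hT l r hl hr hj
      obtain ⟨g', W, h1, h2, h3⟩ := hS.exists_isTransfer_of_isTransversal hp ha ha0 hδ hj hε₀ hε hκ
        hc hv hT' hbv
      refine ⟨g', W, h1, ?_, h3.mono (by linarith) le_rfl ?_⟩
      · refine le_trans ?_ h2
        gcongr
        refine mul_le_of_le_one_right' ?_
        simp only [hind]
        split_ifs <;> simp
      · exact le_self_add
    · obtain ⟨g', h1, h2⟩ := hS.exists_isTransfer (n := n) (a' := 10 * a) ha0.le hε₀ hε₁ hε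
        (by have := mul_le_of_le_one_right ha0.le hexp'; linarith)
        (fun I _ _ => two_mul_hitSum_le n I) ENNReal.one_ne_top hp.decomposes
      refine ⟨g', 1, h1, by simp [hind, hj], h2.mono le_rfl le_rfl ?_⟩
      rw [mul_one, add_comm]
      gcongr
      exact le_add_self.trans le_add_self
  choose g' W hg' hW hdec using hpair
  have := G.countable
  -- Weight at least 1/2 lies on long intervals and loses the fraction σ, whence σ/2.
  have hWtot : ∑' j, (G.w j : ℝ≥0∞) * W j + ENNReal.ofReal (σ / 2) ≤ 1 := by
    have e1 : ∑' j, (G.w j : ℝ≥0∞) * W j + ENNReal.ofReal σ * ∑' j, (G.w j : ℝ≥0∞) * ind j ≤ 1 := by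
      rw [← hG1, WeightedFamily.totalWeight, ← ENNReal.tsum_mul_left, ← ENNReal.tsum_add]
      refine ENNReal.tsum_le_tsum fun j => ?_
      calc _ = (G.w j : ℝ≥0∞) * (W j + ENNReal.ofReal σ * ind j) := by ring
        _ ≤ _ := mul_le_of_le_one_right' (hW j)
    have e2 : 1 ≤ ∑' j, (G.w j : ℝ≥0∞) * ind j + 1 / 2 := by
      calc (1 : ℝ≥0∞) ≤ ∑' j, ((G.w j : ℝ≥0∞) * ind j +
            ENNReal.ofReal δ * ((G.w j : ℝ≥0∞) / volume (G.I j))) := by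
            rw [← hG1]
            refine ENNReal.tsum_le_tsum fun j => ?_
            simp only [hind]
            split_ifs with hj
            · rw [mul_one]; exact le_self_add
            · rw [mul_zero, zero_add, ← mul_div_assoc, ENNReal.le_div_iff_mul_le
                (Or.inl (hG.pair j).interval.volume_ne_zero)
                (Or.inl (hG.pair j).interval.volume_ne_top), mul_comm]
              gcongr
              exact (not_le.1 hj).le
        _ = ∑' j, (G.w j : ℝ≥0∞) * ind j + ENNReal.ofReal δ * G.lengthSum := by
            rw [ENNReal.tsum_add, ENNReal.tsum_mul_left]; rfl
        _ ≤ _ := by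
            gcongr
            refine (mul_le_mul_right (hG.lengthSum_le hS.alpha_pos ha0.le hε₀ hε) _).trans ?_
            rw [← ENNReal.ofReal_mul hδ.le, hδdef,
              show 1 / (4 * B) * (2 * B) = 1 / 2 by field_simp; norm_num,
              ENNReal.ofReal_div_of_pos (by norm_num)]
            simp
    have e3 : (1 : ℝ≥0∞) / 2 ≤ ∑' j, (G.w j : ℝ≥0∞) * ind j := by
      refine ENNReal.le_of_add_le_add_right (a := 1 / 2) (by simp) ?_
      rwa [ENNReal.add_halves]
    refine le_trans ?_ e1
    gcongr
    rw [div_eq_mul_one_div, ENNReal.ofReal_mul hσ0.le]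
    gcongr
    rwa [ENNReal.ofReal_div_of_pos (by norm_num), ENNReal.ofReal_one, ENNReal.ofReal_ofNat]
  have hWne : ∑' j, (G.w j : ℝ≥0∞) * W j ≠ ∞ :=
    ne_top_of_le_ne_top ENNReal.one_ne_top (le_self_add.trans hWtot)
  have hd := fun j => (hdec j).const_mul (G.w j)
  refine ⟨_, _, ?_, hWtot, (Decomposes.tsum hd hWne).mono le_rfl le_rfl ?_⟩
  · have h1 := hS.isTransfer_tsum (fun j => (hg' j).const_mul ((G.w j : ℝ) : ℂ)) ?_
      (ne_top_of_le_ne_top hWne (ENNReal.tsum_le_tsum fun j => (hd j).lintegral_le))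
    · exact h1
    · have h2 := G.tsum_lintegral_enorm_term hG.pair
      rw [hG1] at h2
      exact ne_of_eq_of_ne h2 ENNReal.one_ne_top
  · calc ∑' j, (G.w j : ℝ≥0∞) *
          (ENNReal.ofReal (2 * c * (2 / δ) * |b|) + K₁ + H * (1 / volume (G.I j)))
        = ∑' j, ((ENNReal.ofReal (2 * c * (2 / δ) * |b|) + K₁) * (G.w j : ℝ≥0∞) +
            H * ((G.w j : ℝ≥0∞) / volume (G.I j))) := by
          refine tsum_congr fun j => ?_
          rw [one_div, ENNReal.div_eq_inv_mul]
          ring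
      _ = (ENNReal.ofReal (2 * c * (2 / δ) * |b|) + K₁) + H * G.lengthSum := by
          rw [ENNReal.tsum_add, ENNReal.tsum_mul_left, ENNReal.tsum_mul_left]
          rw [show ∑' j, (G.w j : ℝ≥0∞) = 1 from hG1, mul_one]
          rfl
      _ ≤ (ENNReal.ofReal |b| * ENNReal.ofReal (2 * c * (2 / δ)) + ENNReal.ofReal |b| * K₁) +
            ENNReal.ofReal |b| * (H * ENNReal.ofReal (2 * B)) := by
          have h1 : 1 ≤ ENNReal.ofReal |b| := ENNReal.one_le_ofReal.2 hb1
          rw [← ENNReal.ofReal_mul (abs_nonneg b), mul_comm |b|]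
          refine add_le_add (add_le_add le_rfl (le_mul_of_one_le_left' h1))
            ((mul_le_mul_right (hG.lengthSum_le hS.alpha_pos ha0.le hε₀ hε) _).trans
              (le_mul_of_one_le_left' h1))
      _ = _ := by ring

/-- Iterating blocks of length `n` shrinks the length sum. -/
theorem exists_isTransfer_mul {n : ℕ} {a₁ : ℝ} (ha : 0 ≤ a₁) (haa : a ≤ a₁) (hε₀ : 0 < ε₀)
    (hε₁ : ε₀ ≤ 1) (hε : Real.exp (a₁ * ε₀ ^ α) ≤ 2)
    (ha' : a₁ * Real.exp (-(α * (lam * n))) + (D + Cτ) ≤ a)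
    (hκ : ∀ I, IsOpenInterval I → volume I < ENNReal.ofReal ε₀ → 2 * S.hitSum n I ≤ 2⁻¹)
    {g : ℝ → ℂ} {W Q : ℝ≥0∞} (hW : W ≤ 1) (hg : Decomposes α a₁ b ε₀ g W Q) (q : ℕ) :
    ∃ g', S.IsTransfer b (n * (q + 1)) g g' ∧
      Decomposes α a b ε₀ g' W (2⁻¹ ^ (q + 1) * Q + 2 * ENNReal.ofReal (3 / ε₀)) := by
  have hW' : W ≠ ∞ := ne_top_of_le_ne_top ENNReal.one_ne_top hW
  induction q with
  | zero =>
    obtain ⟨g', h1, h2⟩ := hS.exists_isTransfer ha hε₀ hε₁ hε ha' hκ hW' hg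
    refine ⟨g', by simpa using h1, h2.mono le_rfl le_rfl ?_⟩
    rw [zero_add, pow_one, mul_comm 2]
    gcongr
    exact hW.trans (by norm_num)
  | succ q ih =>
    obtain ⟨g', h1, h2⟩ := ih
    obtain ⟨g'', h3, h4⟩ := hS.exists_isTransfer ha hε₀ hε₁ hε ha' hκ hW'
      (h2.mono haa le_rfl le_rfl)
    refine ⟨g'', hS.isTransfer_comp h1 h3, h4.mono le_rfl le_rfl ?_⟩
    -- The recursion Q ↦ Q/2 + 3/ε₀ has the fixed point 2·(3/ε₀).
    calc 2⁻¹ * (2⁻¹ ^ (q + 1) * Q + 2 * ENNReal.ofReal (3 / ε₀)) + ENNReal.ofReal (3 / ε₀) * W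
        ≤ 2⁻¹ * (2⁻¹ ^ (q + 1) * Q + 2 * ENNReal.ofReal (3 / ε₀)) + ENNReal.ofReal (3 / ε₀) := by
          gcongr
          exact mul_le_of_le_one_right' hW
      _ = 2⁻¹ ^ (q + 1 + 1) * Q + 2 * ENNReal.ofReal (3 / ε₀) := by
          rw [mul_add, ← mul_assoc 2⁻¹ 2, ENNReal.inv_mul_cancel (by simp) (by simp), one_mul,
            pow_succ 2⁻¹ (q + 1), add_assoc, ← two_mul]
          ring

/-- For a suitable block length the assumptions of `exists_isTransfer_mul` hold. -/
theorem exists_block : ∃ n : ℕ, 0 < n ∧ Real.exp (-(α * (lam * n))) ≤ 1 / 22 ∧ ∃ ε : ℝ, 0 < ε ∧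
    ∀ I, IsOpenInterval I → volume I < ENNReal.ofReal ε → 2 * S.hitSum n I ≤ 2⁻¹ := by
  have ht : Tendsto (fun n : ℕ => Real.exp (-(α * (lam * n)))) atTop (𝓝 0) := by
    refine Real.tendsto_exp_neg_atTop_nhds_zero.comp ?_
    exact (tendsto_natCast_atTop_atTop.const_mul_atTop hS.lam_pos).const_mul_atTop hS.alpha_pos
  -- With 1/22 the constant 11a contracts to a/2, leaving a/2 for D + Cτ. It also gives 2(2/22 +
  -- 1/8) ≤ 1/2 for the length sum.
  obtain ⟨n, hn, hn0⟩ := ((ht.eventually (ge_mem_nhds (by norm_num : (0 : ℝ) < 1 / 22))).and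
    (eventually_gt_atTop 0)).exists
  obtain ⟨ε, hε, h⟩ := hS.exists_hitSum_le n (δ := ENNReal.ofReal (1 / 8)) (by simp)
  refine ⟨n, hn0, hn, ε, hε, fun I hI hIε => ?_⟩
  have h1 : Real.exp (-(lam * n)) ≤ 1 / 22 := by
    refine le_trans (Real.exp_le_exp.2 ?_) hn
    have : 0 ≤ lam * n := mul_nonneg hS.lam_pos.le (Nat.cast_nonneg n)
    nlinarith [hS.alpha_lt_one]
  calc 2 * S.hitSum n I ≤ 2 * (2 * ENNReal.ofReal (Real.exp (-(lam * n))) + ENNReal.ofReal (1 / 8)) := by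
        gcongr; exact h I hI hIε
    _ = ENNReal.ofReal (2 * (2 * Real.exp (-(lam * n)) + 1 / 8)) := by
        rw [ENNReal.ofReal_mul (by norm_num), ENNReal.ofReal_add (by positivity) (by norm_num),
          ENNReal.ofReal_mul (by norm_num), ENNReal.ofReal_ofNat]
    _ ≤ ENNReal.ofReal 2⁻¹ := ENNReal.ofReal_le_ofReal (by linarith)
    _ = 2⁻¹ := by rw [ENNReal.ofReal_inv_of_pos (by norm_num), ENNReal.ofReal_ofNat]

/-- After about `log |b|` iterations, a standard family has lost a fixed part of its weight, and its
length sum is bounded again. -/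
theorem exists_isTransfer_ceil_log {n₀ : ℕ} {B : ℝ} (hn₀ : 0 < n₀)
    (hexp : Real.exp (-(α * (lam * n₀))) ≤ 1 / 22) (ha : 2 * (D + Cτ) ≤ a) (ha0 : 0 < a)
    (hε₀ : 0 < ε₀) (hε₁ : ε₀ ≤ 1) (hε : Real.exp (11 * a * ε₀ ^ α) ≤ 2)
    (hκ : ∀ I, IsOpenInterval I → volume I < ENNReal.ofReal ε₀ → 2 * S.hitSum n₀ I ≤ 2⁻¹)
    (hB : 0 < B) :
    ∃ b₀ C σ : ℝ, 1 < b₀ ∧ 0 < C ∧ 0 < σ ∧ ∀ b : ℝ, b₀ ≤ |b| → ∀ G : WeightedFamily,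
      G.IsStandard α a b B ε₀ → G.totalWeight = 1 →
      ∃ g' W, S.IsTransfer b ⌈C * Real.log |b|⌉₊ G.density g' ∧ W + ENNReal.ofReal σ ≤ 1 ∧
        Decomposes α a b ε₀ g' W (ENNReal.ofReal (7 / ε₀)) := by
  have hD : 0 ≤ D + Cτ := add_nonneg hS.D_nonneg hS.Cτ_nonneg
  have hεle : ∀ a', a' ≤ 11 * a → Real.exp (a' * ε₀ ^ α) ≤ 2 := fun a' h => le_trans (by gcongr) hε
  obtain ⟨n₁, σ, K, b₁, hσ, hK, hb₁, hstart⟩ := hS.exists_isTransfer_isStandard (B := B)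
    (by linarith) ha0 hε₀ hε₁ (hεle a (by linarith)) hB
  -- A bound for the growth of the length sum during r < n₀ steps, independent of r.
  set H : ℝ≥0∞ := ∑ r ∈ Finset.range n₀, 2 * ∑' h : S.Branch r, h.supDeriv with hH
  have hH' : H ≠ ∞ := ENNReal.sum_ne_top.2 fun r _ =>
    ENNReal.mul_ne_top (by simp) (hS.tsum_supDeriv_ne_top r)
  set K' : ℝ≥0∞ := H * K + ENNReal.ofReal (3 / ε₀) with hK'
  have hK'' : K' ≠ ∞ := ENNReal.add_ne_top.2 ⟨ENNReal.mul_ne_top hH' hK, by simp⟩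
  have hlog2 : 0 < Real.log 2 := Real.log_pos one_lt_two
  have hlog2' : Real.log 2 ≤ 1 := by linarith [Real.log_two_lt_d9]
  have hn₀' : (1 : ℝ) ≤ n₀ := by exact_mod_cast hn₀
  set E := Real.exp (n₁ + n₀) with hE
  have hE0 : 1 ≤ E := Real.one_le_exp (by positivity)
  -- C is such that the number of halvings is at least 2 log₂|b| up to a constant: one factor |b|
  -- compensates the growth of the length sum, the other the constants K' and E. The bound |b| ≥ E
  -- makes n at least n₁ + n₀.
  refine ⟨b₁ + (1 + K'.toReal) * E, 2 * n₀ / Real.log 2, σ, ?_, by positivity, hσ,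
    fun b hb G hG hG1 => ?_⟩
  · have : 0 < (1 + K'.toReal) * E := by positivity
    linarith
  have hKE : 0 ≤ K'.toReal * E := by positivity
  have hb1 : 1 ≤ |b| := by nlinarith
  have hbb : b₁ ≤ |b| := by nlinarith
  have hbE : E ≤ |b| := by nlinarith
  have hbK : K'.toReal * E ≤ |b| := by nlinarith
  have hbpos : 0 < |b| := by linarith
  set n := ⌈2 * n₀ / Real.log 2 * Real.log |b|⌉₊ with hn
  have hlogb : (n₁ : ℝ) + n₀ ≤ Real.log |b| := by
    rw [Real.le_log_iff_exp_le hbpos]; exact hbE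
  have hlogb0 : 0 ≤ Real.log |b| := le_trans (by positivity) hlogb
  have hnle : 2 * n₀ / Real.log 2 * Real.log |b| ≤ n := Nat.le_ceil _
  have hC1 : 1 ≤ 2 * n₀ / Real.log 2 := by
    rw [one_le_div hlog2]; linarith
  have hnn : n₁ + n₀ ≤ n := by
    have : ((n₁ + n₀ : ℕ) : ℝ) ≤ n := by
      push_cast
      nlinarith
    exact_mod_cast this
  obtain ⟨q, hq⟩ : ∃ q, (n - n₁) / n₀ = q + 1 :=
    Nat.exists_eq_add_one.2 (Nat.div_pos (by omega) hn₀)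
  set r := (n - n₁) % n₀ with hr
  have hrlt : r < n₀ := Nat.mod_lt _ hn₀
  -- n₁ steps for the cancellation, a remainder r without gain, and q + 1 contracting blocks; the
  -- regularity constant passes through 10a and 11a and returns to a.
  have hsplit : n₁ + r + n₀ * (q + 1) = n := by
    have := Nat.mod_add_div (n - n₁) n₀
    rw [hq] at this
    omega
  obtain ⟨g₁, W, hT₁, hW, hd₁⟩ := hstart b hbb G hG hG1
  have hW1 : W ≤ 1 := le_self_add.trans hW
  have hexp' : Real.exp (-(α * (lam * r))) ≤ 1 := Real.exp_le_one_iff.2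
    (neg_nonpos.2 (mul_nonneg hS.alpha_pos.le (mul_nonneg hS.lam_pos.le (Nat.cast_nonneg r))))
  obtain ⟨g₂, hT₂, hd₂⟩ := hS.exists_isTransfer (n := r) (a' := 11 * a) (κ := H) (by positivity) hε₀
    hε₁ (hεle (10 * a) (by linarith))
    (by have := mul_le_of_le_one_right (by positivity : 0 ≤ 10 * a) hexp'; linarith)
    (fun I _ _ => (two_mul_hitSum_le r I).trans
      (Finset.single_le_sum (f := fun r => 2 * ∑' h : S.Branch r, h.supDeriv)
        (fun _ _ => zero_le) (Finset.mem_range.2 hrlt)))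
    (ne_top_of_le_ne_top ENNReal.one_ne_top hW1) hd₁
  obtain ⟨g₃, hT₃, hd₃⟩ := hS.exists_isTransfer_mul (a := a) (by positivity) (by linarith) hε₀ hε₁ hε
    (by nlinarith) hκ hW1 hd₂ q
  refine ⟨g₃, W, ?_, hW, hd₃.mono le_rfl le_rfl ?_⟩
  · rw [← hsplit]
    exact hS.isTransfer_comp (hS.isTransfer_comp hT₁ hT₂) hT₃
  · have h1 : H * (ENNReal.ofReal |b| * K) + ENNReal.ofReal (3 / ε₀) * W ≤ ENNReal.ofReal |b| * K' := by
      rw [hK', mul_add]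
      have hb' : 1 ≤ ENNReal.ofReal |b| := ENNReal.one_le_ofReal.2 hb1
      refine add_le_add (le_of_eq (by ring)) ?_
      rw [mul_comm]
      exact mul_le_mul_left (hW1.trans hb') _
    have h2 : |b| ^ 2 ≤ 2 ^ (q + 1) * E := by
      have e1 : (n : ℝ) = n₁ + r + n₀ * (q + 1) := by rw [← hsplit]; push_cast; ring
      have e2 : (r : ℝ) ≤ n₀ := by exact_mod_cast hrlt.le
      have e3 : 2 * Real.log |b| ≤ (q + 1) * Real.log 2 + (n₁ + n₀) := by
        rw [div_mul_eq_mul_div, div_le_iff₀ hlog2, e1] at hnle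
        have e4 : (n₁ + r : ℝ) * Real.log 2 ≤ n₀ * (n₁ + n₀) := by
          have : (n₁ + r : ℝ) * Real.log 2 ≤ (n₁ + n₀) * 1 := by gcongr
          nlinarith [(Nat.cast_nonneg n₁ : (0 : ℝ) ≤ n₁)]
        have e5 : n₀ * (2 * Real.log |b|) ≤ n₀ * ((q + 1) * Real.log 2 + (n₁ + n₀)) := by
          nlinarith
        exact le_of_mul_le_mul_left e5 (by linarith)
      calc |b| ^ 2 = Real.exp (2 * Real.log |b|) := by
            rw [two_mul, Real.exp_add, Real.exp_log hbpos, sq]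
        _ ≤ Real.exp ((q + 1) * Real.log 2 + (n₁ + n₀)) := Real.exp_le_exp.2 e3
        _ = 2 ^ (q + 1) * E := by
            rw [Real.exp_add, mul_comm ((q : ℝ) + 1), Real.exp_mul, Real.exp_log two_pos, hE]
            norm_cast
    have h3 : |b| * K'.toReal ≤ 2 ^ (q + 1) := by
      have e1 : |b| * K'.toReal * E ≤ |b| * |b| := by
        rw [mul_assoc]; gcongr
      have e2 : |b| * K'.toReal * E ≤ 2 ^ (q + 1) * E := by linarith [sq |b|]
      exact le_of_mul_le_mul_right e2 (by linarith)
    have h4 : 2⁻¹ ^ (q + 1) * (ENNReal.ofReal |b| * K') ≤ ENNReal.ofReal (1 / ε₀) := by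
      rw [← ENNReal.ofReal_toReal hK'', ← ENNReal.ofReal_mul hbpos.le,
        show (2⁻¹ : ℝ≥0∞) = ENNReal.ofReal 2⁻¹ by
          rw [ENNReal.ofReal_inv_of_pos (by norm_num), ENNReal.ofReal_ofNat],
        ← ENNReal.ofReal_pow (by norm_num), ← ENNReal.ofReal_mul (by positivity)]
      apply ENNReal.ofReal_le_ofReal
      rw [inv_pow, inv_mul_le_iff₀ (by positivity)]
      refine h3.trans (le_mul_of_one_le_right (by positivity) ?_)
      rwa [one_le_div hε₀]
    calc _ ≤ ENNReal.ofReal (1 / ε₀) + 2 * ENNReal.ofReal (3 / ε₀) := by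
          gcongr
          exact le_trans (by gcongr) h4
      _ = ENNReal.ofReal (1 / ε₀ + 2 * (3 / ε₀)) := by
          rw [ENNReal.ofReal_add (by positivity) (by positivity), ENNReal.ofReal_mul (by norm_num),
            ENNReal.ofReal_ofNat]
      _ = ENNReal.ofReal (7 / ε₀) := by congr 1; ring

end SkewProduct.IsAdmissible

/-! ### The proposition -/

theorem mainTheorem4 (S : SkewProduct) (α lam D Cτ : ℝ)
    (hS : S.IsAdmissible α lam D Cτ) :
    ∃ a₀ : ℝ, 0 < a₀ ∧ ∀ a : ℝ, a₀ ≤ a →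
    ∃ ε₁ : ℝ, 0 < ε₁ ∧ ∀ ε₀ : ℝ, 0 < ε₀ → ε₀ ≤ ε₁ →
    ∃ B₀ : ℝ, 0 < B₀ ∧ ∀ B : ℝ, B₀ ≤ B →
    ∃ b₀ C : ℝ, 1 < b₀ ∧ 0 < C ∧
    ∀ γ : ℝ, 0 < γ →
    ∃ γ₁ : ℝ, 0 < γ₁ ∧ γ₁ < γ ∧
    ∀ b : ℝ, b₀ ≤ |b| →
    ∃ n : ℕ, n = ⌈C * Real.log |b|⌉₊ ∧
    ∀ G : WeightedFamily, G.IsStandard α a b B ε₀ → G.totalWeight = 1 →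
      Nonempty (WeightedFamily.Cutting S ε₀ n G) ∧
      ∀ c : WeightedFamily.Cutting S ε₀ n G,
        ∃ Gs : WeightedFamily, Gs.IsStandard α a b B ε₀ ∧
          Gs.Equivalent (WeightedFamily.iterate b c) ∧
          Gs.totalWeight ≤ ENNReal.ofReal (Real.exp (-γ₁)) := by
  obtain ⟨n₀, hn₀, hexp, ε₂, hε₂, hhit⟩ := hS.exists_block
  have hD : 0 ≤ D + Cτ := add_nonneg hS.D_nonneg hS.Cτ_nonneg
  have hα := hS.alpha_pos
  refine ⟨2 * (D + Cτ) + 1, by linarith, fun a ha => ?_⟩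
  have ha0 : 0 < a := by linarith
  have hlog2 : 0 < Real.log 2 := Real.log_pos one_lt_two
  have hx : 0 < Real.log 2 / (11 * a) := by positivity
  -- The last bound amounts to 11a ε₀^α ≤ ln 2: the factor-2 comparison must hold up to the largest
  -- regularity constant that occurs.
  refine ⟨min (min 1 ε₂) ((Real.log 2 / (11 * a)) ^ α⁻¹), lt_min (lt_min one_pos hε₂)
    (Real.rpow_pos_of_pos hx _), fun ε₀ hε₀ hε₀' => ?_⟩
  have hε₁ : ε₀ ≤ 1 := hε₀'.trans ((min_le_left _ _).trans (min_le_left _ _))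
  have hε : Real.exp (11 * a * ε₀ ^ α) ≤ 2 := by
    have h1 : ε₀ ^ α ≤ Real.log 2 / (11 * a) := by
      calc ε₀ ^ α ≤ ((Real.log 2 / (11 * a)) ^ α⁻¹) ^ α := by
            gcongr; exact hε₀'.trans (min_le_right _ _)
        _ = _ := Real.rpow_inv_rpow hx.le hα.ne'
    rw [le_div_iff₀ (by positivity)] at h1
    calc Real.exp (11 * a * ε₀ ^ α) ≤ Real.exp (Real.log 2) := Real.exp_le_exp.2 (by linarith)
      _ = 2 := Real.exp_log two_pos
  have hεa : Real.exp (a * ε₀ ^ α) ≤ 2 := le_trans (by gcongr; linarith) hε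
  -- The final length sum 7/ε₀ times the constant 4 of `boundaryWeight_le`.
  refine ⟨28 / ε₀, by positivity, fun B hB => ?_⟩
  have hB0 : 0 < B := lt_of_lt_of_le (by positivity) hB
  obtain ⟨b₀, C, σ, hb₀, hC, hσ, hmain⟩ := hS.exists_isTransfer_ceil_log (B := B) hn₀ hexp
    (by linarith) ha0 hε₀ hε₁ hε (fun I hI hIε => hhit I hI (hIε.trans_le (ENNReal.ofReal_le_ofReal
      (hε₀'.trans ((min_le_left _ _).trans (min_le_right _ _)))))) hB0
  refine ⟨b₀, C, hb₀, hC, fun γ hγ => ⟨min σ (γ / 2), lt_min hσ (by linarith),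
    (min_le_right _ _).trans_lt (by linarith), fun b hb => ⟨_, rfl, fun G hG hG1 =>
    ⟨WeightedFamily.nonempty_cutting hS hε₀ fun j => (hG.pair j).interval, fun c => ?_⟩⟩⟩⟩
  obtain ⟨g', W, hT, hW, Gs, hpair, hGsW, hGsQ, hGs⟩ := hmain b hb G hG hG1
  refine ⟨Gs, ⟨hpair, hB0, fun ε hε0 hεε => ?_⟩, ?_, ?_⟩
  · calc Gs.boundaryWeight ε ≤ ENNReal.ofReal (4 * ε) * Gs.lengthSum :=
          WeightedFamily.boundaryWeight_le hα ha0.le hεa hpair hε0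
      _ ≤ ENNReal.ofReal (4 * ε) * ENNReal.ofReal (7 / ε₀) := by gcongr
      _ = ENNReal.ofReal (28 / ε₀ * ε) := by
          rw [← ENNReal.ofReal_mul (by positivity)]; congr 1; ring
      _ ≤ ENNReal.ofReal (B * ε) := ENNReal.ofReal_le_ofReal (by gcongr)
  -- The given iterate and the constructed family have densities that are images of the same
  -- function; off [0,1) both vanish.
  · have hT' := WeightedFamily.isTransfer_density (b := b) hS c hG.pair
      (by rw [hG1]; exact ENNReal.one_ne_top)
    have h1 := (hT.congr_ae (ae_eq_refl _) hGs).unique hT'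
    rw [EventuallyEq, ae_restrict_iff' measurableSet_Ico] at h1
    filter_upwards [h1] with x hx
    by_cases hx' : x ∈ Ico (0 : ℝ) 1
    · exact hx hx'
    · rw [WeightedFamily.density_eq_zero hpair hx', WeightedFamily.density_eq_zero
        (WeightedFamily.isStandardPair_iterate hS c hG.pair ha0.le hε₁ le_rfl) hx']
  · have h1 : W ≤ 1 - ENNReal.ofReal σ := ENNReal.le_sub_of_add_le_right (by simp) hW
    calc Gs.totalWeight ≤ 1 - ENNReal.ofReal σ := hGsW.trans h1
      _ = ENNReal.ofReal (1 - σ) := by rw [ENNReal.ofReal_sub _ hσ.le, ENNReal.ofReal_one]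
      _ ≤ ENNReal.ofReal (Real.exp (-min σ (γ / 2))) := by
          apply ENNReal.ofReal_le_ofReal
          calc 1 - σ ≤ Real.exp (-σ) := by linarith [Real.add_one_le_exp (-σ)]
            _ ≤ _ := Real.exp_le_exp.2 (neg_le_neg (min_le_left _ _))
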